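/- For integers $a,b,c\ge 0$ let $\Phi_{a,b,c}\in\mathbb C[\alpha_1,\dots,\alpha_{b+c};\beta_1,\dots,\beta_{a+c};\gamma_1,\dots,\gamma_{a+b}]$ be polynomials such that, for all $a,b,c$: $\Phi_{a,b,c}$ is homogeneous of degree $ab+bc+ca$; it is symmetric in the $\alpha_i$, in the $\beta_j$ and in the $\gamma_k$; it has degree at most $a$ in each $\alpha_i$, at most $b$ in each $\beta_j$ and at most $c$ in each $\gamma_k$; $$\Phi_{a,b,0}=\prod_{i=1}^{b}\prod_{j=1}^{a}(\alpha_i-\beta_j);$$ and for $c\ge1$ $$\Phi_{a,b,c}\big|_{\beta_j=\alpha_i}=(-1)^b\prod_{k=1}^{a+b}(\alpha_i-\gamma_k)\;\Phi_{a,b,c-1},$$ where the arguments of $\Phi_{a,b,c-1}$ are those of $\Phi_{a,b,c}$ with $\alpha_i$ and $\beta_j$ removed. There is exactly one such family, and for pairwise distinct $\alpha_i$ $$\Phi_{a,b,c}=\sum_{I\subset\{1,\dots,b+c\},\ \#I=c}\frac{\prod_{i\notin I}\prod_{j=1}^{a+c}(\alpha_i-\beta_j)\ \prod_{i\in I}\prod_{k=1}^{a+b}(\alpha_i-\gamma_k)}{\prod_{i\in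 I}\prod_{j\notin I}(\alpha_i-\alpha_j)} .$$ This family has the following properties for all $a,b,c\ge0$. (1) Let $\alpha,\beta,\gamma_1,\dots,\gamma_{a+b}\in\mathbb C$ with $\gamma_k\ne\alpha$ for all $k$, and put $\Gamma=\mathrm{diag}\big(\tfrac{\gamma_k-\beta}{\alpha-\gamma_k}\big)_{1\le k\le a+b}$ and $C'=(\alpha-\beta)^{ab}\prod_{k=1}^{a+b}(\alpha-\gamma_k)^c$. Then, at $\alpha_i=\alpha$ and $\beta_j=\beta$ for all $i,j$, $$\Phi_{a,b,c}=C'\int_{U(c)}\det(1+\Gamma\otimes\Omega)\,(\det\Omega^{-1})^{b}\,d\Omega=C'\,s_{Y_{b,c}}(\Gamma),$$ where $d\Omega$ is the Haar probability measure on the unitary group $U(c)$, $Y_{b,c}$ is the rectangular Young diagram with $b$ rows and $c$ columns, and $s_{Y_{b,c}}(\Gamma)$ is the Schur function (sum over semistandard Young tableaux) evaluated at the $a+b$ eigenvalues of $\Gamma$. (2) Let $q=e^{2\pi i/3}$. At $\alpha_i=1$, $\beta_j=q^2$, $\gamma_k=q$ for all $i,j,k$, $$\Phi_{a,b,c}=e^{\frac{i\pi}{6}(ab+3bc-ca)}\;3^{(ab+bc+ca)/2}\;\dim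 V,$$ where $V$ is the irreducible polynomial representation of $GL_{a+b}(\mathbb C)$ with Young diagram $Y_{b,c}$ (it exists, and the formula holds for every such $V$). -/

import Mathlib

open scoped BigOperators Kronecker MatrixGroups

noncomputable section

namespace ThreeArch

/-! ### The polynomials `Φ_{a,b,c}` -/

/-- The three series of parameters `α_1, …, α_{b+c}`, `β_1, …, β_{a+c}`, `γ_1, …, γ_{a+b}`. -/
inductive Param (a b c : ℕ) : Type
  | alpha (i : Fin (b + c)) : Param a b c
  | beta (j : Fin (a + c)) : Param a b c
  | gamma (k : Fin (a + b)) : Param a b c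

/-- The assignment of complex values to the parameters. -/
def point {a b c : ℕ} (α : Fin (b + c) → ℂ) (β : Fin (a + c) → ℂ) (γ : Fin (a + b) → ℂ) :
    Param a b c → ℂ
  | .alpha i => α i
  | .beta j => β j
  | .gamma k => γ k

/-- The value of a polynomial in the parameters. -/
def value {a b c : ℕ} (P : MvPolynomial (Param a b c) ℂ)
    (α : Fin (b + c) → ℂ) (β : Fin (a + c) → ℂ) (γ : Fin (a + b) → ℂ) : ℂ :=
  MvPolynomial.eval (point α β γ) P

/-- The properties that determine the family `Φ_{a,b,c}`: homogeneity of degree `ab + bc + ca`,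
symmetry in each of the three series, the bounds on the partial degrees, the factorized initial
condition at `c = 0`, and the recurrence relation at `β_j = α_i`, in which `α_i` and `β_j` are
removed. -/
structure IsThreeArchFamily (Φ : ∀ a b c : ℕ, MvPolynomial (Param a b c) ℂ) : Prop where
  homogeneous : ∀ a b c, (Φ a b c).IsHomogeneous (a * b + b * c + c * a)
  symmetric : ∀ a b c (σ : Equiv.Perm (Fin (b + c))) (τ : Equiv.Perm (Fin (a + c)))
    (υ : Equiv.Perm (Fin (a + b))) (α : Fin (b + c) → ℂ) (β : Fin (a + c) → ℂ)
    (γ : Fin (a + b) → ℂ),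
    value (Φ a b c) (α ∘ σ) (β ∘ τ) (γ ∘ υ) = value (Φ a b c) α β γ
  degree_alpha : ∀ a b c i, (Φ a b c).degreeOf (.alpha i) ≤ a
  degree_beta : ∀ a b c j, (Φ a b c).degreeOf (.beta j) ≤ b
  degree_gamma : ∀ a b c k, (Φ a b c).degreeOf (.gamma k) ≤ c
  initial : ∀ a b (α : Fin b → ℂ) (β : Fin a → ℂ) (γ : Fin (a + b) → ℂ),
    value (Φ a b 0) α β γ = ∏ i, ∏ j, (α i - β j)
  recurrence : ∀ a b c (α : Fin (b + c + 1) → ℂ) (β : Fin (a + c + 1) → ℂ)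
    (γ : Fin (a + b) → ℂ) (i : Fin (b + c + 1)) (j : Fin (a + c + 1)), β j = α i →
    value (Φ a b (c + 1)) α β γ =
      (-1) ^ b * (∏ k, (α i - γ k)) * value (Φ a b c) (α ∘ i.succAbove) (β ∘ j.succAbove) γ

/-- The explicit formula for `Φ_{a,b,c}` at pairwise distinct `α_i`: a sum over the subsets `I` of
`{1, …, b+c}` with `c` elements. -/
def subsetSum {a b c : ℕ} (α : Fin (b + c) → ℂ) (β : Fin (a + c) → ℂ) (γ : Fin (a + b) → ℂ) : ℂ :=
  ∑ I ∈ Finset.powersetCard c (Finset.univ : Finset (Fin (b + c))),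
    ((∏ i ∈ Iᶜ, ∏ j, (α i - β j)) * (∏ i ∈ I, ∏ k, (α i - γ k))) /
      (∏ i ∈ I, ∏ j ∈ Iᶜ, (α i - α j))

/-! ### Schur functions -/

/-- The rectangular Young diagram with `b` rows and `c` columns. -/
def rect (b c : ℕ) : YoungDiagram where
  cells := Finset.range b ×ˢ Finset.range c
  isLowerSet := by
    rintro ⟨i, j⟩ ⟨i', j'⟩ h hij
    have h1 : i' ≤ i := h.1
    have h2 : j' ≤ j := h.2
    simp only [Finset.coe_product, Finset.coe_range, Set.mem_prod, Set.mem_Iio] at hij ⊢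
    omega

/-- Semistandard Young tableaux of shape `μ` with entries in `{0, …, N - 1}`. -/
abbrev Tableau (μ : YoungDiagram) (N : ℕ) : Type :=
  {T : SemistandardYoungTableau μ // ∀ p : μ.cells, T p.1.1 p.1.2 < N}

instance (μ : YoungDiagram) (N : ℕ) : Finite (Tableau μ N) := by
  refine Finite.of_injective
    (fun (T : Tableau μ N) (p : μ.cells) => (⟨T.1 p.1.1 p.1.2, T.2 p⟩ : Fin N)) ?_
  intro T T' h
  apply Subtype.ext
  ext i j
  by_cases hij : (i, j) ∈ μ
  · exact congrArg Fin.val (congrFun h ⟨(i, j), hij⟩)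
  · rw [T.1.zeros hij, T'.1.zeros hij]

/-- The Schur function `s_μ(x_1, …, x_N)`, the sum over semistandard Young tableaux of shape `μ`
with entries in an `N`-element alphabet. -/
def schur (μ : YoungDiagram) {N : ℕ} (x : Fin N → ℂ) : ℂ :=
  ∑ᶠ T : Tableau μ N, ∏ p : μ.cells, x ⟨T.1 p.1.1 p.1.2, T.2 p⟩

/-! ### The unitary group and its Haar measure -/

/-- The unitary group `U(c)`. -/
abbrev U (c : ℕ) : Type := Matrix.unitaryGroup (Fin c) ℂ

instance (c : ℕ) : CompactSpace (U c) := by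
  apply isCompact_iff_compactSpace.mp
  have hK : IsCompact (Set.univ.pi fun _ : Fin c => Set.univ.pi fun _ : Fin c =>
      Metric.closedBall (0 : ℂ) 1) :=
    isCompact_univ_pi fun _ => isCompact_univ_pi fun _ => isCompact_closedBall _ _
  refine IsCompact.of_isClosed_subset (X := Matrix (Fin c) (Fin c) ℂ) hK
    (isClosed_unitary (R := Matrix (Fin c) (Fin c) ℂ)) ?_
  intro M hM
  exact fun i _ j _ => mem_closedBall_zero_iff.mpr (entry_norm_bound_of_unitary hM i j)

instance (c : ℕ) : MeasurableSpace (U c) := borel _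

instance (c : ℕ) : BorelSpace (U c) := ⟨rfl⟩

/-- The Haar measure on `U(c)`, of total mass `1`. -/
def unitaryHaar (c : ℕ) : MeasureTheory.Measure (U c) :=
  MeasureTheory.Measure.haarMeasure ⊤

/-! ### Irreducible representations of the general linear group -/

/-- `ρ` is the irreducible polynomial representation of `GL_N(ℂ)` with Young diagram `μ`: it is
finite-dimensional and irreducible, its matrix coefficients are polynomials in the matrix entries,
`μ` has at most `N` rows, and there is a highest weight vector of weight `μ`, that is, a nonzero
vector on which the upper triangular matrices act through `g ↦ ∏ i, g i i ^ μ_i`. -/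
structure IsIrrepWithDiagram {N : ℕ} {V : Type*} [AddCommGroup V] [Module ℂ V]
    (ρ : Representation ℂ (GL (Fin N) ℂ) V) (μ : YoungDiagram) : Prop where
  finite : Module.Finite ℂ V
  irreducible : ρ.IsIrreducible
  polynomial : ∀ (f : Module.Dual ℂ V) (v : V), ∃ p : MvPolynomial (Fin N × Fin N) ℂ,
    ∀ g : GL (Fin N) ℂ,
      f (ρ g v) = MvPolynomial.eval (fun ij => (g : Matrix (Fin N) (Fin N) ℂ) ij.1 ij.2) p
  rows : μ.colLen 0 ≤ N
  highest : ∃ v : V, v ≠ 0 ∧ ∀ g : GL (Fin N) ℂ,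
    (g : Matrix (Fin N) (Fin N) ℂ).BlockTriangular id →
      ρ g v = (∏ i : Fin N, (g : Matrix (Fin N) (Fin N) ℂ) i i ^ μ.rowLen i) • v

/-- The primitive cube root of unity `q = exp(2πi/3)`. -/
def q : ℂ := Complex.exp (2 * Real.pi * Complex.I / 3)

end ThreeArch

end

/-! ### The three-polynomial resultant as a determinant of coefficients -/

noncomputable section

namespace ThreeArch

open Polynomial Matrix

variable {R : Type*} [CommRing R]

/-! The polynomial `Φ` is a resultant of three polynomials. Let A, Q, P be monic with roots α, β, γ,
hence of degrees b + c, a + c, a + b. The a + b + c polynomials X^s A (s < a), X^r Q (r < b), X^r P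
(r < c) all have degree below a + b + c, and up to sign `Φ` is the determinant of their
coefficients, `sylvesterDet`. Multiplication by the Vandermonde determinant of γ makes the P-columns
unitriangular and turns the other columns into values at the roots of P
(`det_vandermonde_mul_det_coeffMatrix`). A common root of A and Q then factors out, which is the
recurrence; for c = 0 the determinant is the classical resultant; degrees and homogeneity are read
off from the columns. Uniqueness and the sum over subsets both come from interpolation in one β at
the points α_i (`IsThreeArchFamily.value_eq_subsetSum`).

If all α_i and all β_j coincide, column operations turn the values into powers of Γ_k, and what
remains is the alternant with exponents 0, …, a - 1, a + c, …, a + b + c - 1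
(`det_vandermonde_mul_sylvesterDet_const`). Its quotient by the Vandermonde determinant is a
Jacobi–Trudi determinant in elementary symmetric functions, by the same coefficient identity
(`det_vandermonde_mul_jacobiTrudi`). Expanding that determinant one variable at a time gives a sum
over chains of horizontal strips, that is, over tableaux (`schur_rect`).

The unitary integral and the dimension share one criterion, `IsRectCharacter`: a symmetric
polynomial of degree at most c in each variable that satisfies a first order Euler equation, a
second order Casimir equation and a normalization is the rectangular Schur function
(`IsRectCharacter.eval_eq_schur`). After multiplication by the Vandermonde determinant, the
equations prescribe the sum and the sum of squares of the exponents of each monomial, and only one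
alternant is compatible with them.

For the integral the equations are integration by parts for the Haar measure (`haarCoeff_lieDeriv`);
neither Weyl's integration formula nor orthogonality of characters enters. For an irreducible
representation they express that the Casimir element is a scalar (`IsHighestRep.casimirAct_eq`),
while the degree bound and the normalization come from letting invertible matrices degenerate to
singular ones (`IsHighestRep.weightProj_eq_zero`, `IsHighestRep.trace_ev_proj`). The dimension is
therefore the Schur function at (1, …, 1). The representation exists as an irreducible quotient of
the span of the translates of a power of a leading minor. At the cube roots of unity every Γ_k
equals q, and homogeneity of the Schur function gives the closed form. -/

/-- The monic polynomial with the given roots. -/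
def rootPoly {n : ℕ} (δ : Fin n → R) : R[X] := ∏ i, (X - C (δ i))

theorem rootPoly_monic {n : ℕ} (δ : Fin n → R) : (rootPoly δ).Monic :=
  monic_prod_of_monic _ _ fun _ _ => monic_X_sub_C _

theorem natDegree_rootPoly [Nontrivial R] {n : ℕ} (δ : Fin n → R) : (rootPoly δ).natDegree = n := by
  rw [rootPoly, natDegree_prod_of_monic _ _ fun k _ => monic_X_sub_C _]; simp

theorem degree_rootPoly_le {n : ℕ} (δ : Fin n → R) : (rootPoly δ).degree ≤ (n : WithBot ℕ) := by
  nontriviality R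
  rw [degree_eq_natDegree (rootPoly_monic δ).ne_zero, natDegree_rootPoly]

theorem eval_rootPoly {n : ℕ} (δ : Fin n → R) (x : R) :
    (rootPoly δ).eval x = ∏ i, (x - δ i) := by
  simp [rootPoly, eval_prod]

theorem eval_rootPoly_root {n : ℕ} (δ : Fin n → R) (i : Fin n) : (rootPoly δ).eval (δ i) = 0 := by
  rw [eval_rootPoly]; exact Finset.prod_eq_zero (Finset.mem_univ i) (sub_self _)

theorem eval_rootPoly_succAbove {n : ℕ} (δ : Fin (n + 1) → R) (i : Fin (n + 1)) (x : R) :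
    (rootPoly δ).eval x = (x - δ i) * (rootPoly (δ ∘ i.succAbove)).eval x := by
  rw [eval_rootPoly, eval_rootPoly, Fin.prod_univ_succAbove _ i]; rfl

theorem map_rootPoly {S : Type*} [CommRing S] (f : R →+* S) {n : ℕ} (δ : Fin n → R) :
    (rootPoly δ).map f = rootPoly (f ∘ δ) := by
  simp [rootPoly, Polynomial.map_prod]

theorem rootPoly_comp_perm {n : ℕ} (δ : Fin n → R) (σ : Equiv.Perm (Fin n)) :
    rootPoly (δ ∘ σ) = rootPoly δ :=
  Equiv.prod_comp σ fun i => X - C (δ i)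

/-- The coefficient matrix of the polynomials `G j`, `j < N`, and `X ^ r * P`, `r < c`. -/
def coeffMatrix {N : ℕ} (c : ℕ) (G : Fin N → R[X]) (P : R[X]) :
    Matrix (Fin N ⊕ Fin c) (Fin N ⊕ Fin c) R :=
  of fun i j => (Sum.elim G (fun r : Fin c => X ^ (r : ℕ) * P) j).coeff
    (Sum.elim (fun k : Fin N => (k : ℕ)) (fun r : Fin c => N + r) i)

/-- Evaluation at the roots of `P` turns the coefficient matrix into an alternant. -/
theorem det_vandermonde_mul_det_coeffMatrix {N c : ℕ} (G : Fin N → R[X])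
    (hG : ∀ j, (G j).degree < (N + c : ℕ)) (γ : Fin N → R) :
    (vandermonde γ).det * (coeffMatrix c G (rootPoly γ)).det =
      (of fun k j => (G j).eval (γ k)).det := by
  nontriviality R
  set P : R[X] := rootPoly γ with hP
  have hPm : P.Monic := rootPoly_monic γ
  have hPd : P.natDegree = N := natDegree_rootPoly γ
  have hPe : ∀ k, P.eval (γ k) = 0 := eval_rootPoly_root γ
  -- Left multiplication by `W` evaluates a column at the roots `γ k` in the first N rows and keeps
  -- the top c coefficients in the others. The columns X^r P vanish in the first rows, and their top
  -- coefficients form a unitriangular block because P is monic of degree N.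
  let W : Matrix (Fin N ⊕ Fin c) (Fin N ⊕ Fin c) R :=
    fromBlocks (vandermonde γ) (of fun k (r : Fin c) => γ k ^ (N + r : ℕ)) 0 1
  have hW : W.det = (vandermonde γ).det := by simp [W]
  have heval : ∀ p : R[X], p.degree < (N + c : ℕ) → ∀ k,
      (∑ i : Fin N, γ k ^ (i : ℕ) * p.coeff i) +
        ∑ r : Fin c, γ k ^ (N + r : ℕ) * p.coeff (N + r) = p.eval (γ k) := by
    intro p hp k
    rw [eval_eq_sum_degreeLTEquiv (mem_degreeLT.2 hp)]
    rw [Fin.sum_univ_add]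
    simp [degreeLTEquiv, mul_comm]
  have hXP : ∀ r : Fin c, (X ^ (r : ℕ) * P).degree < ((N + c : ℕ) : WithBot ℕ) := by
    intro r
    rw [hPm.degree_mul, degree_X_pow, degree_eq_natDegree hPm.ne_zero, hPd, add_comm]
    exact_mod_cast Nat.add_lt_add_left r.2 N
  have hmul : W * coeffMatrix c G P =
      fromBlocks (of fun k j => (G j).eval (γ k)) 0 (of fun (r : Fin c) j => (G j).coeff (N + r))
        (of fun r r' : Fin c => (X ^ (r' : ℕ) * P).coeff (N + r)) := by
    ext (k | r) (j | r')
    · simp [W, coeffMatrix, Matrix.mul_apply, heval _ (hG j), vandermonde_apply]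
    · simp [W, coeffMatrix, Matrix.mul_apply, heval _ (hXP r'), vandermonde_apply, hPe]
    · simp [W, coeffMatrix, Matrix.mul_apply, Matrix.one_apply]
    · simp [W, coeffMatrix, Matrix.mul_apply, Matrix.one_apply]
  have hT : (of fun r r' : Fin c => (X ^ (r' : ℕ) * P).coeff (N + r)).det = 1 := by
    rw [det_of_isUpperTriangular]
    · refine Finset.prod_eq_one fun r _ => ?_
      simp [coeff_X_pow_mul, ← hPd, hPm]
    · intro r r' h
      have h' : (r' : ℕ) < r := h
      simp only [of_apply, coeff_X_pow_mul']
      rw [if_pos (by omega), coeff_eq_zero_of_natDegree_lt (by omega)]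
  rw [← hW, ← det_mul, hmul, det_fromBlocks_zero₁₂, hT, mul_one]

/-- The polynomials `A, X A, …, X ^ (a - 1) A, Q, X Q, …, X ^ (b - 1) Q`. -/
def blockPoly (a b : ℕ) (A Q : R[X]) : Fin (a + b) → R[X] :=
  Fin.addCases (fun s : Fin a => X ^ (s : ℕ) * A) (fun r : Fin b => X ^ (r : ℕ) * Q)

theorem degree_blockPoly_lt {a b c : ℕ} (α : Fin (b + c) → R) (β : Fin (a + c) → R)
    (j : Fin (a + b)) :
    (blockPoly a b (rootPoly α) (rootPoly β) j).degree <
      ((a + b + c : ℕ) : WithBot ℕ) := by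
  have key : ∀ (n d : ℕ) (A : R[X]), A.degree ≤ d → n + d < a + b + c →
      (X ^ n * A).degree < ((a + b + c : ℕ) : WithBot ℕ) := by
    intro n d A hA h
    refine lt_of_le_of_lt ((degree_mul_le _ _).trans (add_le_add (degree_X_pow_le n) hA)) ?_
    exact_mod_cast h
  refine Fin.addCases (fun s => ?_) (fun r => ?_) j
  · simp only [blockPoly, Fin.addCases_left]
    exact key _ _ _ (degree_rootPoly_le α) (by omega)
  · simp only [blockPoly, Fin.addCases_right]
    exact key _ _ _ (degree_rootPoly_le β) (by omega)

/-- The determinant of the system `u P + v Q + w A` with `deg u < c`, `deg v < b`, `deg w < a`,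
where `A`, `Q`, `P` have the roots `α`, `β`, `γ`. -/
def sylvesterDet {a b c : ℕ} (α : Fin (b + c) → R) (β : Fin (a + c) → R) (γ : Fin (a + b) → R) : R :=
  (coeffMatrix c (blockPoly a b (rootPoly α) (rootPoly β))
    (rootPoly γ)).det

theorem map_sylvesterDet {S : Type*} [CommRing S] (f : R →+* S) {a b c : ℕ} (α : Fin (b + c) → R)
    (β : Fin (a + c) → R) (γ : Fin (a + b) → R) :
    f (sylvesterDet α β γ) = sylvesterDet (f ∘ α) (f ∘ β) (f ∘ γ) := by
  unfold sylvesterDet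
  rw [RingHom.map_det]
  congr 1
  ext i (j | r)
  · simp only [coeffMatrix, RingHom.mapMatrix_apply, map_apply, of_apply, Sum.elim_inl,
      ← coeff_map]
    congr 1
    refine Fin.addCases (fun s => ?_) (fun r => ?_) j
    · simp only [blockPoly, Fin.addCases_left, Polynomial.map_mul, map_rootPoly, Polynomial.map_pow, map_X]
    · simp only [blockPoly, Fin.addCases_right, Polynomial.map_mul, map_rootPoly, Polynomial.map_pow,
        map_X]
  · simp only [coeffMatrix, RingHom.mapMatrix_apply, map_apply, of_apply, Sum.elim_inr,
      ← coeff_map, Polynomial.map_mul, map_rootPoly, Polynomial.map_pow, map_X]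

theorem sylvesterDet_comp_perm {a b c : ℕ} (α : Fin (b + c) → R) (β : Fin (a + c) → R)
    (γ : Fin (a + b) → R) (σ : Equiv.Perm (Fin (b + c))) (τ : Equiv.Perm (Fin (a + c)))
    (υ : Equiv.Perm (Fin (a + b))) :
    sylvesterDet (α ∘ σ) (β ∘ τ) (γ ∘ υ) = sylvesterDet α β γ := by
  simp only [sylvesterDet, rootPoly_comp_perm]

theorem det_vandermonde_mul_sylvesterDet {a b c : ℕ} (α : Fin (b + c) → R) (β : Fin (a + c) → R)
    (γ : Fin (a + b) → R) :
    (vandermonde γ).det * sylvesterDet α β γ =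
      (of fun k j => (blockPoly a b (rootPoly α) (rootPoly β) j).eval (γ k)).det :=
  det_vandermonde_mul_det_coeffMatrix _ (degree_blockPoly_lt α β) γ

/-- A common root of `A` and `Q` splits off. -/
theorem det_vandermonde_mul_sylvesterDet_succ {a b c : ℕ} (α : Fin (b + c + 1) → R)
    (β : Fin (a + c + 1) → R) (γ : Fin (a + b) → R) (i : Fin (b + c + 1)) (j : Fin (a + c + 1))
    (h : β j = α i) :
    (vandermonde γ).det * sylvesterDet (c := c + 1) α β γ =
      (vandermonde γ).det *
        ((∏ k, (γ k - α i)) * sylvesterDet (α ∘ i.succAbove) (β ∘ j.succAbove) γ) := by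
  rw [mul_left_comm, det_vandermonde_mul_sylvesterDet, det_vandermonde_mul_sylvesterDet,
    ← det_mul_column]
  congr 1
  ext k l
  simp only [of_apply]
  refine Fin.addCases (fun s => ?_) (fun r => ?_) l
  · simp only [blockPoly, Fin.addCases_left, eval_mul, eval_pow, eval_X]
    rw [show (rootPoly α).eval (γ k) = _ from eval_rootPoly_succAbove α i (γ k)]
    ring
  · simp only [blockPoly, Fin.addCases_right, eval_mul, eval_pow, eval_X]
    rw [show (rootPoly β).eval (γ k) = _ from eval_rootPoly_succAbove β j (γ k), h]
    ring

theorem det_vandermonde_X_ne_zero (n : ℕ) :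
    (vandermonde (MvPolynomial.X : Fin n → MvPolynomial (Fin n) ℂ)).det ≠ 0 :=
  det_vandermonde_ne_zero_iff.2 (MvPolynomial.X_injective)

/-- The Vandermonde factor can only be cancelled when it is nonzero. The γ are therefore replaced by
independent variables, the factor is cancelled in the polynomial ring, and the identity is
specialized back. -/
theorem sylvesterDet_succ {a b c : ℕ} (α : Fin (b + c + 1) → ℂ)
    (β : Fin (a + c + 1) → ℂ) (γ : Fin (a + b) → ℂ) (i : Fin (b + c + 1)) (j : Fin (a + c + 1))
    (h : β j = α i) :
    sylvesterDet (c := c + 1) α β γ =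
        (∏ k, (γ k - α i)) * sylvesterDet (α ∘ i.succAbove) (β ∘ j.succAbove) γ := by
  have key := mul_left_cancel₀ (det_vandermonde_X_ne_zero _)
    (det_vandermonde_mul_sylvesterDet_succ (fun l => MvPolynomial.C (α l))
      (fun l => MvPolynomial.C (β l)) MvPolynomial.X i j (congrArg _ h))
  have := congrArg (MvPolynomial.eval γ) key
  rw [map_mul, map_sylvesterDet, map_sylvesterDet, map_prod] at this
  simpa [Function.comp_def] using this

/-- The powers X^(a + r) may be exchanged for X^r times the polynomial with roots `y`, monic of the
same degree. These columns vanish at the points `y`, so the matrix becomes block triangular. -/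
theorem det_vandermonde_append {a b : ℕ} (y : Fin a → R) (x : Fin b → R) :
    (vandermonde (Fin.append y x)).det = (vandermonde y).det *
      ((∏ i, (rootPoly y).eval (x i)) * (vandermonde x).det) := by
  nontriviality R
  rw [← det_mul_column, ← det_fromBlocks_zero₁₂ _ (of fun (r : Fin b) (s : Fin a) => x r ^ (s : ℕ)),
    det_eval_matrixOfPolynomials_eq_det_vandermonde (Fin.append y x)
      (blockPoly a b 1 (rootPoly y)), ← det_reindex_self finSumFinEquiv.symm]
  · congr 1
    ext (i | i) (j | j)
    · simp [blockPoly, vandermonde_apply]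
    · simp [blockPoly, eval_rootPoly_root]
    · simp [blockPoly]
    · simp [blockPoly, vandermonde_apply, mul_comm]
  · intro i
    refine Fin.addCases (fun s => ?_) (fun r => ?_) i
    · simp [blockPoly]
    · simp only [blockPoly, Fin.addCases_right, Fin.val_natAdd]
      rw [(monic_X_pow _).natDegree_mul (rootPoly_monic y), natDegree_X_pow, natDegree_rootPoly,
        add_comm]
  · intro i
    refine Fin.addCases (fun s => ?_) (fun r => ?_) i
    · simp [blockPoly]
    · simp only [blockPoly, Fin.addCases_right]
      exact (monic_X_pow _).mul (rootPoly_monic y)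

/-- Each of the two polynomials vanishes at its own roots, so the matrix of values is block
diagonal, with Vandermonde blocks whose rows are scaled by the values of the other polynomial. -/
theorem det_eval_blockPoly_append {a b : ℕ} (y : Fin a → R) (x : Fin b → R) :
    (of fun k j => (blockPoly a b (rootPoly x) (rootPoly y) j).eval (Fin.append y x k)).det =
      (vandermonde (Fin.append y x)).det * ∏ j, (rootPoly x).eval (y j) := by
  rw [det_vandermonde_append, show ∀ p q r s : R, p * (q * r) * s = (s * p) * (q * r) by
      intros; ring, ← det_mul_column, ← det_mul_column, ← det_fromBlocks_zero₁₂ _ 0,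
    ← det_reindex_self finSumFinEquiv.symm]
  congr 1
  ext (i | i) (j | j)
  · simp [blockPoly, vandermonde_apply, mul_comm]
  · simp [blockPoly, eval_rootPoly_root]
  · simp [blockPoly, eval_rootPoly_root]
  · simp [blockPoly, vandermonde_apply, mul_comm]

theorem sylvesterDet_append [IsDomain R] {a b : ℕ} (y : Fin a → R) (x : Fin b → R)
    (h : Function.Injective (Fin.append y x)) :
    sylvesterDet (c := 0) x y (Fin.append y x) = ∏ j, ∏ i, (y j - x i) := by
  refine mul_left_cancel₀ (det_vandermonde_ne_zero_iff.2 h) ?_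
  rw [det_vandermonde_mul_sylvesterDet]
  refine (det_eval_blockPoly_append y x).trans ?_
  simp only [eval_rootPoly]

/-- The resultant of two polynomials with given roots. -/
theorem sylvesterDet_zero {a b : ℕ} (α : Fin b → ℂ) (β : Fin a → ℂ) (γ : Fin (a + b) → ℂ) :
    sylvesterDet (c := 0) α β γ = ∏ i, ∏ j, (β j - α i) := by
  have hv : Function.Injective (Fin.append (fun j => MvPolynomial.X (Sum.inl j))
      (fun j => MvPolynomial.X (Sum.inr j)) : Fin (a + b) → MvPolynomial (Fin a ⊕ Fin b) ℂ) := by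
    have : (Fin.append (fun j => MvPolynomial.X (Sum.inl j)) (fun j => MvPolynomial.X (Sum.inr j)) :
        Fin (a + b) → MvPolynomial (Fin a ⊕ Fin b) ℂ) = MvPolynomial.X ∘ finSumFinEquiv.symm := by
      funext k
      refine Fin.addCases (fun s => ?_) (fun r => ?_) k <;> simp
    rw [this]
    exact (MvPolynomial.X_injective).comp (Equiv.injective _)
  have h2 := congrArg (MvPolynomial.eval (Sum.elim β α)) (sylvesterDet_append _ _ hv)
  rw [map_sylvesterDet] at h2
  -- For c = 0 no column is built from P, so γ does not enter and may be chosen as the concatenation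
  -- of β and α, where the matrix of values is block diagonal.
  have h3 : sylvesterDet (c := 0) α β γ = sylvesterDet (c := 0) α β (Fin.append β α) := by
    unfold sylvesterDet
    congr 1
    ext i (j | j)
    · simp only [coeffMatrix, of_apply, Sum.elim_inl]
    · exact j.elim0
  have e1 : (MvPolynomial.eval (Sum.elim β α)) ∘ (fun j => MvPolynomial.X (Sum.inr j)) = α := by
    ext; simp
  have e2 : (MvPolynomial.eval (Sum.elim β α)) ∘ (fun j => MvPolynomial.X (Sum.inl j)) = β := by
    ext; simp
  have e3 : (MvPolynomial.eval (Sum.elim β α)) ∘ (Fin.append (fun j => MvPolynomial.X (Sum.inl j))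
      (fun j => MvPolynomial.X (Sum.inr j))) = Fin.append β α := by
    ext k
    refine Fin.addCases (fun s => ?_) (fun r => ?_) k <;> simp
  rw [e1, e2, e3] at h2
  rw [h3, Finset.prod_comm, h2]
  simp

end ThreeArch
end

/-! ### Degrees, homogeneity and the defining properties -/

noncomputable section

namespace ThreeArch

open Polynomial Matrix

section Degrees

variable {σ : Type*}

/-- All coefficients of `p` have degree at most `n` in the variable `v`. -/
def CoeffDegreeLE (v : σ) (n : ℕ) (p : (MvPolynomial σ ℂ)[X]) : Prop :=
  ∀ k, (p.coeff k).degreeOf v ≤ n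

theorem CoeffDegreeLE.mul {v : σ} {m n : ℕ} {p q : (MvPolynomial σ ℂ)[X]}
    (hp : CoeffDegreeLE v m p) (hq : CoeffDegreeLE v n q) : CoeffDegreeLE v (m + n) (p * q) := by
  intro k
  rw [coeff_mul]
  refine (MvPolynomial.degreeOf_sum_le v _ _).trans (Finset.sup_le fun i _ => ?_)
  exact (MvPolynomial.degreeOf_mul_le _ _ _).trans (add_le_add (hp _) (hq _))

theorem CoeffDegreeLE.prod {ι : Type*} {v : σ} {s : Finset ι} {n : ι → ℕ}
    {p : ι → (MvPolynomial σ ℂ)[X]} (h : ∀ i ∈ s, CoeffDegreeLE v (n i) (p i)) :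
    CoeffDegreeLE v (∑ i ∈ s, n i) (∏ i ∈ s, p i) := by
  classical
  induction s using Finset.induction_on with
  | empty =>
    intro k
    simp [coeff_one]
    split_ifs <;> simp
  | insert i s hi ih =>
    rw [Finset.sum_insert hi, Finset.prod_insert hi]
    exact (h i (Finset.mem_insert_self _ _)).mul
      (ih fun j hj => h j (Finset.mem_insert_of_mem hj))

theorem CoeffDegreeLE.X_pow_mul {v : σ} {n : ℕ} {p : (MvPolynomial σ ℂ)[X]}
    (hp : CoeffDegreeLE v n p) (r : ℕ) : CoeffDegreeLE v n (X ^ r * p) := by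
  intro k
  rw [coeff_X_pow_mul']
  split_ifs
  · exact hp _
  · simp

theorem coeffDegreeLE_X_sub_C [DecidableEq σ] (v w : σ) :
    CoeffDegreeLE v (if w = v then 1 else 0)
      (X - C (MvPolynomial.X w) : (MvPolynomial σ ℂ)[X]) := by
  intro k
  rw [coeff_sub, coeff_X, coeff_C]
  refine (MvPolynomial.degreeOf_sub_le _ _ _).trans (max_le ?_ ?_)
  · split_ifs <;> simp
  · by_cases hk : k = 0
    · rw [if_pos hk, MvPolynomial.degreeOf_X]
      simp [eq_comm]
    · simp [hk]

theorem coeffDegreeLE_rootPoly [DecidableEq σ] (v : σ) {n : ℕ} (w : Fin n → σ) (m : ℕ)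
    (h : ∑ i, (if w i = v then 1 else 0) ≤ m) :
    CoeffDegreeLE v m (rootPoly fun i => (MvPolynomial.X (w i) : MvPolynomial σ ℂ)) := fun k =>
  (CoeffDegreeLE.prod (fun i _ => coeffDegreeLE_X_sub_C v (w i)) k).trans h

theorem degreeOf_det_le {n : Type*} [Fintype n] [DecidableEq n] (v : σ)
    (M : Matrix n n (MvPolynomial σ ℂ)) (d : n → ℕ) (h : ∀ i j, (M i j).degreeOf v ≤ d j) :
    M.det.degreeOf v ≤ ∑ j, d j := by
  rw [det_apply]
  refine (MvPolynomial.degreeOf_sum_le v _ _).trans (Finset.sup_le fun τ _ => ?_)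
  rw [Units.smul_def, zsmul_eq_mul, ← map_intCast (MvPolynomial.C : ℂ →+* MvPolynomial σ ℂ)]
  refine (MvPolynomial.degreeOf_C_mul_le _ _ _).trans ?_
  exact (MvPolynomial.degreeOf_prod_le _ _ _).trans (Finset.sum_le_sum fun i _ => h _ _)

/-- The coefficient of `X ^ k` in `p` is homogeneous of degree `d - k`. -/
def CoeffHomogeneous (d : ℕ) (p : (MvPolynomial σ ℂ)[X]) : Prop :=
  ∀ k, p.coeff k = 0 ∨ ∃ e, e + k = d ∧ (p.coeff k).IsHomogeneous e

theorem CoeffHomogeneous.mul {d e : ℕ} {p q : (MvPolynomial σ ℂ)[X]}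
    (hp : CoeffHomogeneous d p) (hq : CoeffHomogeneous e q) : CoeffHomogeneous (d + e) (p * q) := by
  intro k
  rw [coeff_mul]
  by_cases hk : k ≤ d + e
  · right
    refine ⟨d + e - k, by omega, MvPolynomial.IsHomogeneous.sum _ _ _ fun x hx => ?_⟩
    rw [Finset.HasAntidiagonal.mem_antidiagonal] at hx
    rcases hp x.1 with h | ⟨e₁, h₁, h₁'⟩
    · rw [h, zero_mul]; exact MvPolynomial.isHomogeneous_zero _ _ _
    rcases hq x.2 with h | ⟨e₂, h₂, h₂'⟩
    · rw [h, mul_zero]; exact MvPolynomial.isHomogeneous_zero _ _ _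
    rw [show d + e - k = e₁ + e₂ by omega]
    exact h₁'.mul h₂'
  · left
    refine Finset.sum_eq_zero fun x hx => ?_
    rw [Finset.HasAntidiagonal.mem_antidiagonal] at hx
    rcases hp x.1 with h | ⟨e₁, h₁, h₁'⟩
    · rw [h, zero_mul]
    rcases hq x.2 with h | ⟨e₂, h₂, h₂'⟩
    · rw [h, mul_zero]
    omega

theorem coeffHomogeneous_X_pow (n : ℕ) :
    CoeffHomogeneous n (X ^ n : (MvPolynomial σ ℂ)[X]) := by
  intro k
  rw [coeff_X_pow]
  split_ifs with h
  · exact Or.inr ⟨0, by omega, MvPolynomial.isHomogeneous_one _ _⟩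
  · exact Or.inl rfl

theorem coeffHomogeneous_rootPoly {n : ℕ} (w : Fin n → σ) :
    CoeffHomogeneous n (rootPoly fun i => (MvPolynomial.X (w i) : MvPolynomial σ ℂ)) := by
  have key : ∀ s : Finset (Fin n), CoeffHomogeneous s.card
      (∏ i ∈ s, (X - C (MvPolynomial.X (w i) : MvPolynomial σ ℂ))) := by
    intro s
    induction s using Finset.induction_on with
    | empty => simpa using coeffHomogeneous_X_pow (σ := σ) 0
    | insert i s hi ih =>
      rw [Finset.card_insert_of_notMem hi, Finset.prod_insert hi, add_comm]
      refine CoeffHomogeneous.mul ?_ ih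
      intro k
      rcases k with _ | _ | k
      · refine Or.inr ⟨1, rfl, ?_⟩
        simpa using (MvPolynomial.isHomogeneous_X ℂ (w i)).neg
      · refine Or.inr ⟨0, rfl, ?_⟩
        simpa [coeff_C] using MvPolynomial.isHomogeneous_one σ ℂ
      · left
        simp [coeff_X]
  simpa [rootPoly] using key Finset.univ

/-- With weights `r` on the rows and `k` on the columns, every nonzero term of the Leibniz expansion
has the same degree: the sum of the column weights minus the sum of the row weights. -/
theorem isHomogeneous_det {n : Type*} [Fintype n] [DecidableEq n]
    (M : Matrix n n (MvPolynomial σ ℂ)) (r k : n → ℕ) (D : ℕ)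
    (h : ∀ i j, M i j = 0 ∨ ∃ e, e + r i = k j ∧ (M i j).IsHomogeneous e)
    (hD : D + ∑ i, r i = ∑ j, k j) : M.det.IsHomogeneous D := by
  rw [det_apply]
  refine MvPolynomial.IsHomogeneous.sum _ _ _ fun τ _ => ?_
  rw [Units.smul_def, zsmul_eq_mul, ← map_intCast (MvPolynomial.C : ℂ →+* MvPolynomial σ ℂ)]
  refine MvPolynomial.IsHomogeneous.C_mul ?_ _
  by_cases h0 : ∃ i, M (τ i) i = 0
  · obtain ⟨i, hi⟩ := h0
    rw [Finset.prod_eq_zero (f := fun i => M (τ i) i) (Finset.mem_univ i) hi]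
    exact MvPolynomial.isHomogeneous_zero _ _ _
  push Not at h0
  choose e he he' using fun i => (h (τ i) i).resolve_left (h0 i)
  have : D = ∑ i, e i := by
    have h1 : ∑ i, e i + ∑ i, r (τ i) = ∑ j, k j := by
      rw [← Finset.sum_add_distrib]; exact Finset.sum_congr rfl fun i _ => he i
    rw [Equiv.sum_comp τ r] at h1
    omega
  rw [this]
  exact MvPolynomial.IsHomogeneous.prod _ _ _ fun i _ => he' i

end Degrees

/-- The polynomial `Φ_{a,b,c}`. -/
def phi (a b c : ℕ) : MvPolynomial (Param a b c) ℂ :=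
  -- At c = 0 the determinant is a product of ab factors β_j - α_i instead of α_i - β_j, which costs
  -- (-1)^(ab). Each step in c produces a + b factors γ_k - α_i, where the recurrence asks for
  -- (-1)^b times the opposite factors; the discrepancy is (-1)^a per step.
  MvPolynomial.C ((-1) ^ (a * b + a * c)) *
    sylvesterDet (fun i => MvPolynomial.X (.alpha i)) (fun j => MvPolynomial.X (.beta j))
      (fun k => MvPolynomial.X (.gamma k))

theorem value_phi {a b c : ℕ} (α : Fin (b + c) → ℂ) (β : Fin (a + c) → ℂ) (γ : Fin (a + b) → ℂ) :
    value (phi a b c) α β γ = (-1) ^ (a * b + a * c) * sylvesterDet α β γ := by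
  unfold value phi
  rw [map_mul, MvPolynomial.eval_C, map_sylvesterDet]
  congr 2 <;> ext <;> simp [point]

/-- There are a columns built from A, b from Q and c from P. A given parameter occurs in only one of
these polynomials, and there linearly, which yields the three partial degree bounds. -/
theorem degreeOf_phi_le {a b c : ℕ} (v : Param a b c) (m₁ m₂ m₃ : ℕ)
    (h₁ : CoeffDegreeLE v m₁ (rootPoly fun i => MvPolynomial.X (Param.alpha i)))
    (h₂ : CoeffDegreeLE v m₂ (rootPoly fun i => MvPolynomial.X (Param.beta i)))
    (h₃ : CoeffDegreeLE v m₃ (rootPoly fun i => MvPolynomial.X (Param.gamma i))) :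
    (phi a b c).degreeOf v ≤ a * m₁ + b * m₂ + c * m₃ := by
  unfold phi
  refine (MvPolynomial.degreeOf_C_mul_le _ _ _).trans ?_
  refine (degreeOf_det_le v _ (Sum.elim (Fin.addCases (fun _ => m₁) fun _ => m₂) fun _ => m₃)
    ?_).trans (le_of_eq ?_)
  · rintro i (j | j)
    · simp only [coeffMatrix, of_apply, Sum.elim_inl]
      refine Fin.addCases (fun s => ?_) (fun r => ?_) j
      · simp only [blockPoly, Fin.addCases_left]
        exact h₁.X_pow_mul _ _
      · simp only [blockPoly, Fin.addCases_right]
        exact h₂.X_pow_mul _ _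
    · simp only [coeffMatrix, of_apply, Sum.elim_inr]
      exact h₃.X_pow_mul _ _
  · simp [Fin.sum_univ_add]

/-- If X also has degree one, then X^s A is homogeneous of degree s + b + c, and similarly for the
other columns; taking the coefficient of X^k lowers the degree by k. -/
theorem isHomogeneous_phi (a b c : ℕ) : (phi a b c).IsHomogeneous (a * b + b * c + c * a) := by
  unfold phi
  refine MvPolynomial.IsHomogeneous.C_mul ?_ _
  refine isHomogeneous_det _ (Sum.elim (fun k : Fin (a + b) => (k : ℕ)) fun r : Fin c => a + b + r)
    (Sum.elim (Fin.addCases (fun s : Fin a => s + (b + c)) fun r : Fin b => r + (a + c))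
      fun r => r + (a + b)) _ ?_ ?_
  · rintro i (j | j)
    · simp only [coeffMatrix, of_apply, Sum.elim_inl]
      refine Fin.addCases (fun s => ?_) (fun r => ?_) j
      · simp only [blockPoly, Fin.addCases_left]
        exact (coeffHomogeneous_X_pow _).mul (coeffHomogeneous_rootPoly _) _
      · simp only [blockPoly, Fin.addCases_right]
        exact (coeffHomogeneous_X_pow _).mul (coeffHomogeneous_rootPoly _) _
    · simp only [coeffMatrix, of_apply, Sum.elim_inr]
      exact (coeffHomogeneous_X_pow _).mul (coeffHomogeneous_rootPoly _) _
  · simp [Fin.sum_univ_add, Finset.sum_add_distrib]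
    ring

theorem isThreeArchFamily_phi : IsThreeArchFamily phi where
  homogeneous := isHomogeneous_phi
  symmetric a b c σ τ υ α β γ := by
    rw [value_phi, value_phi, sylvesterDet_comp_perm]
  degree_alpha a b c i := by
    classical
    refine (degreeOf_phi_le _ 1 0 0 ?_ ?_ ?_).trans (by simp) <;>
    · refine coeffDegreeLE_rootPoly _ _ _ ?_
      simp
  degree_beta a b c i := by
    classical
    refine (degreeOf_phi_le _ 0 1 0 ?_ ?_ ?_).trans (by simp) <;>
    · refine coeffDegreeLE_rootPoly _ _ _ ?_
      simp
  degree_gamma a b c i := by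
    classical
    refine (degreeOf_phi_le _ 0 0 1 ?_ ?_ ?_).trans (by simp) <;>
    · refine coeffDegreeLE_rootPoly _ _ _ ?_
      simp
  initial a b α β γ := by
    rw [value_phi, sylvesterDet_zero]
    simp only [mul_zero, add_zero]
    have : ∀ i j, α i - β j = (-1) * (β j - α i) := fun i j => by ring
    simp only [this, Finset.prod_mul_distrib, Finset.prod_const, Finset.card_univ, Fintype.card_fin,
      ← pow_mul]
  recurrence a b c α β γ i j h := by
    rw [value_phi, value_phi, sylvesterDet_succ α β γ i j h]
    have : ∀ k, α i - γ k = (-1) * (γ k - α i) := fun k => by ring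
    simp only [this, Finset.prod_mul_distrib, Finset.prod_const, Finset.card_univ, Fintype.card_fin]
    have h2 : ((-1 : ℂ) ^ b) * (-1) ^ b = 1 := by rw [← mul_pow]; simp
    linear_combination (-((-1 : ℂ) ^ (a * b + a * (c + 1)) *
      ((∏ k, (γ k - α i)) * sylvesterDet (α ∘ i.succAbove) (β ∘ j.succAbove) γ))) * h2

/-! ### Interpolation -/

theorem exists_polynomial_eval_update {σ : Type*} [DecidableEq σ] (p : MvPolynomial σ ℂ) (v : σ)
    (x : σ → ℂ) : ∃ r : ℂ[X], r.natDegree ≤ p.degreeOf v ∧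
      ∀ t, MvPolynomial.eval (Function.update x v t) p = r.eval t := by
  refine ⟨MvPolynomial.aeval (Function.update (fun i => C (x i)) v X) p, ?_, fun t => ?_⟩
  · rw [MvPolynomial.aeval_def, MvPolynomial.eval₂_eq]
    refine natDegree_sum_le_of_forall_le _ _ fun d hd => ?_
    refine (natDegree_C_mul_le _ _).trans ((natDegree_prod_le _ _).trans ?_)
    refine le_trans ?_ (MvPolynomial.monomial_le_degreeOf v hd)
    calc ∑ i ∈ d.support, (Function.update (fun i => C (x i)) v X i ^ d i).natDegree
        ≤ ∑ i ∈ d.support, (if i = v then d i else 0) := by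
          refine Finset.sum_le_sum fun i _ => ?_
          by_cases h : i = v
          · subst h; simp
          · rw [Function.update_of_ne h, ← C_pow, natDegree_C]; exact Nat.zero_le _
      _ ≤ d v := by
          rw [Finset.sum_ite_eq']
          split_ifs <;> simp
  · have h : (Polynomial.evalRingHom t).comp
        (MvPolynomial.aeval (Function.update (fun i => C (x i)) v X)).toRingHom =
        MvPolynomial.eval (Function.update x v t) := by
      ext i
      · simp
      · by_cases h : i = v
        · subst h; simp
        · simp [h]
    exact (RingHom.congr_fun h p).symm

theorem point_update_beta {a b c : ℕ} [DecidableEq (Param a b c)] (α : Fin (b + c) → ℂ)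
    (β : Fin (a + c) → ℂ) (γ : Fin (a + b) → ℂ) (j : Fin (a + c)) (t : ℂ) :
    point α (Function.update β j t) γ = Function.update (point α β γ) (.beta j) t := by
  ext v
  cases v with
  | alpha i => simp [point]
  | gamma i => simp [point]
  | beta i =>
    by_cases h : i = j
    · subst h; simp [point]
    · rw [Function.update_of_ne (by simpa using h)]
      simp [point, h]

theorem subsetSum_zero {a b : ℕ} (α : Fin b → ℂ) (β : Fin a → ℂ) (γ : Fin (a + b) → ℂ) :
    subsetSum (c := 0) α β γ = ∏ i, ∏ j, (α i - β j) := by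
  simp [subsetSum]

/-- If i is not in I, the numerator contains α_i - β_j = 0. The surviving subsets are {i} together
with a subset of the remaining indices. For each of the b indices x outside I, the factor α_x - β_j
= -(α_i - α_x) cancels the corresponding factor of the denominator, whence the sign (-1)^b. -/
theorem subsetSum_succ {a b c : ℕ} (α : Fin (b + c + 1) → ℂ) (β : Fin (a + c + 1) → ℂ)
    (γ : Fin (a + b) → ℂ) (i : Fin (b + c + 1)) (j : Fin (a + c + 1)) (hα : Function.Injective α)
    (h : β j = α i) :
    subsetSum (c := c + 1) α β γ = (-1) ^ b * (∏ k, (α i - γ k)) *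
      subsetSum (α ∘ i.succAbove) (β ∘ j.succAbove) γ := by
  unfold subsetSum
  rw [Finset.mul_sum]
  symm
  have hnot : ∀ I : Finset (Fin (b + c)), i ∉ I.map i.succAboveEmb := by
    intro I hi
    obtain ⟨x, _, hx⟩ := Finset.mem_map.1 hi
    exact Fin.succAbove_ne i x hx
  have hcompl : ∀ I : Finset (Fin (b + c)),
      (insert i (I.map i.succAboveEmb))ᶜ = Iᶜ.map i.succAboveEmb := by
    intro I
    ext x
    rcases Fin.eq_self_or_eq_succAbove i x with rfl | ⟨y, rfl⟩
    · simp
    · simp [Fin.succAbove_ne]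
  refine Finset.sum_of_injOn (fun I => insert i (I.map i.succAboveEmb)) ?_ ?_ ?_ ?_
  · intro I _ J _ hIJ
    have := congrArg (fun S => Sᶜ) hIJ
    simp only [hcompl] at this
    exact compl_injective (Finset.map_injective _ this)
  · intro I hI
    rw [Finset.mem_coe, Finset.mem_powersetCard_univ] at hI ⊢
    rw [Finset.card_insert_of_notMem (hnot I), Finset.card_map, hI]
  · intro I hI hI'
    have hi : i ∉ I := by
      intro hi
      refine hI' ⟨Finset.univ.filter fun x => i.succAbove x ∈ I, ?_, ?_⟩
      · have hI2 : insert i ((Finset.univ.filter fun x => i.succAbove x ∈ I).map i.succAboveEmb) = I := by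
          ext x
          rcases Fin.eq_self_or_eq_succAbove i x with rfl | ⟨y, rfl⟩
          · simpa using hi
          · simp [Fin.succAbove_ne]
        rw [Finset.mem_powersetCard_univ] at hI
        rw [← hI2, Finset.card_insert_of_notMem (hnot _), Finset.card_map] at hI
        simpa using hI
      · ext x
        rcases Fin.eq_self_or_eq_succAbove i x with rfl | ⟨y, rfl⟩
        · simpa using hi
        · simp [Fin.succAbove_ne]
    have hzero : ∏ x ∈ Iᶜ, ∏ l, (α x - β l) = 0 :=
      Finset.prod_eq_zero (Finset.mem_compl.2 hi)
        (Finset.prod_eq_zero (f := fun l => α i - β l) (Finset.mem_univ j) (by rw [h, sub_self]))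
    exact (congrArg (fun z => z * _ / _) hzero).trans (by rw [zero_mul, zero_div])
  · intro I hI
    rw [Finset.mem_powersetCard_univ] at hI
    have hcard : Iᶜ.card = b := by rw [Finset.card_compl, hI]; simp
    have hins := fun f : Fin (b + c + 1) → ℂ => Finset.prod_insert (f := f) (hnot I)
    rw [hcompl]
    erw [hins, hins]
    simp only [Finset.prod_map, Fin.succAboveEmb_apply, Function.comp]
    have e1 : ∀ x, ∏ l : Fin (a + (c + 1)), (α (i.succAbove x) - β l) =
        (-1) * (α i - α (i.succAbove x)) * ∏ l, (α (i.succAbove x) - β (j.succAbove l)) := by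
      intro x
      refine (Fin.prod_univ_succAbove (fun l => α (i.succAbove x) - β l) j).trans ?_
      rw [h]
      ring
    simp only [e1, Finset.prod_mul_distrib, Finset.prod_const, hcard]
    have h0 : ∏ x ∈ Iᶜ, (α i - α (i.succAbove x)) ≠ 0 :=
      Finset.prod_ne_zero_iff.2 fun x _ =>
        sub_ne_zero.2 fun hx => Fin.succAbove_ne i x (hα hx).symm
    rw [mul_div_assoc', ← mul_div_mul_left _ _ h0]
    congr 1
    ring

theorem exists_polynomial_subsetSum {a b c : ℕ} (α : Fin (b + c) → ℂ) (β : Fin (a + c) → ℂ)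
    (γ : Fin (a + b) → ℂ) (j : Fin (a + c)) : ∃ r : ℂ[X], r.natDegree ≤ b ∧
      ∀ t, subsetSum α (Function.update β j t) γ = r.eval t := by
  refine ⟨∑ I ∈ Finset.powersetCard c (Finset.univ : Finset (Fin (b + c))),
    C ((∏ i ∈ Iᶜ, ∏ l ∈ Finset.univ.erase j, (α i - β l)) * (∏ i ∈ I, ∏ k, (α i - γ k)) /
      (∏ i ∈ I, ∏ l ∈ Iᶜ, (α i - α l))) * ∏ i ∈ Iᶜ, (C (α i) - X), ?_, fun t => ?_⟩
  · refine natDegree_sum_le_of_forall_le _ _ fun I hI => ?_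
    rw [Finset.mem_powersetCard_univ] at hI
    have hcard : Iᶜ.card = b := by rw [Finset.card_compl, hI]; simp
    refine (natDegree_C_mul_le _ _).trans ((natDegree_prod_le _ _).trans ?_)
    refine (Finset.sum_le_card_nsmul _ _ 1 fun i _ => ?_).trans (by simp [hcard])
    exact (natDegree_sub_le _ _).trans (by simp)
  · simp only [subsetSum, eval_finsetSum, eval_mul, eval_C, eval_prod, eval_sub, eval_X]
    refine Finset.sum_congr rfl fun I _ => ?_
    have e : ∀ i, ∏ l, (α i - Function.update β j t l) =
        (∏ l ∈ Finset.univ.erase j, (α i - β l)) * (α i - t) := by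
      intro i
      rw [← Finset.prod_erase_mul _ _ (Finset.mem_univ j), Function.update_self]
      congr 1
      refine Finset.prod_congr rfl fun l hl => ?_
      rw [Function.update_of_ne (Finset.ne_of_mem_erase hl)]
    simp only [e, Finset.prod_mul_distrib]
    ring

/-- Induction on c. In the step, both sides are polynomials of degree at most b in the first β, and
at the b + c + 1 distinct points α_i both satisfy the same recurrence, so they agree there and hence
everywhere. -/
theorem IsThreeArchFamily.value_eq_subsetSum {Φ : ∀ a b c : ℕ, MvPolynomial (Param a b c) ℂ}
    (hΦ : IsThreeArchFamily Φ) (a b c : ℕ) (α : Fin (b + c) → ℂ) (β : Fin (a + c) → ℂ)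
    (γ : Fin (a + b) → ℂ) (hα : Function.Injective α) :
    value (Φ a b c) α β γ = subsetSum α β γ := by
  classical
  induction c with
  | zero => exact (hΦ.initial a b α β γ).trans (subsetSum_zero α β γ).symm
  | succ c ih =>
    obtain ⟨r, hr, hr'⟩ := exists_polynomial_eval_update (Φ a b (c + 1)) (.beta 0) (point α β γ)
    obtain ⟨s, hs, hs'⟩ := exists_polynomial_subsetSum α β γ 0
    have hrs : r = s := by
      refine eq_of_natDegree_lt_card_of_eval_eq r s hα (fun i => ?_) ?_
      · rw [← hr', ← hs', ← point_update_beta]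
        have hβ : Function.update β 0 (α i) 0 = α i := by simp
        refine (hΦ.recurrence a b c α _ γ i 0 hβ).trans ?_
        rw [ih _ _ (hα.comp Fin.succAbove_right_injective)]
        exact (subsetSum_succ α _ γ i 0 hα hβ).symm
      · have := hr.trans (hΦ.degree_beta a b (c + 1) 0)
        simp only [Fintype.card_fin]
        omega
    have e : β = Function.update β 0 (β 0) := by simp
    have h1 := hr' (β 0)
    have h2 := hs' (β 0)
    rw [← point_update_beta, ← e] at h1
    rw [← e] at h2
    rw [value, h1, h2, hrs]

/-- The defining properties determine the values at distinct α_i. Multiplication by the Vandermonde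
determinant of the variables α makes the remaining points harmless. -/
theorem IsThreeArchFamily.unique {Φ Ψ : ∀ a b c : ℕ, MvPolynomial (Param a b c) ℂ}
    (hΦ : IsThreeArchFamily Φ) (hΨ : IsThreeArchFamily Ψ) : Φ = Ψ := by
  funext a b c
  have h0 : (vandermonde fun i : Fin (b + c) =>
      (MvPolynomial.X (Param.alpha i) : MvPolynomial (Param a b c) ℂ)).det ≠ 0 :=
    det_vandermonde_ne_zero_iff.2 fun i j h => by
      simpa using MvPolynomial.X_injective h
  refine mul_left_cancel₀ h0 (MvPolynomial.funext fun x => ?_)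
  have hx : x = point (fun i => x (.alpha i)) (fun i => x (.beta i)) (fun i => x (.gamma i)) := by
    ext v; cases v <;> rfl
  rw [map_mul, map_mul]
  by_cases hα : Function.Injective fun i => x (.alpha i)
  · congr 1
    rw [hx]
    exact (hΦ.value_eq_subsetSum a b c _ _ _ hα).trans (hΨ.value_eq_subsetSum a b c _ _ _ hα).symm
  · have : (MvPolynomial.eval x) (vandermonde fun i : Fin (b + c) =>
      (MvPolynomial.X (Param.alpha i) : MvPolynomial (Param a b c) ℂ)).det = 0 := by
      rw [RingHom.map_det]
      have e : (MvPolynomial.eval x).mapMatrix (vandermonde fun i : Fin (b + c) =>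
        (MvPolynomial.X (Param.alpha i) : MvPolynomial (Param a b c) ℂ)) =
          vandermonde fun i => x (.alpha i) := by
        ext i j; simp [vandermonde_apply]
      rw [e]
      by_contra hne
      exact hα (det_vandermonde_ne_zero_iff.1 hne)
    rw [this, zero_mul, zero_mul]

end ThreeArch
end

noncomputable section

namespace ThreeArch

open Polynomial Matrix

/-- The exponents `0, …, a - 1, a + c, …, a + b + c - 1`. -/
def rectExp (a b c : ℕ) : Fin (a + b) → ℕ := Fin.addCases (fun s => s) fun r => a + c + r

/-- The alternant with exponents `rectExp a b c`. -/
def alternant {R : Type*} [CommRing R] (a b c : ℕ) (x : Fin (a + b) → R) : R :=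
  (of fun k j => x k ^ rectExp a b c j).det

/-! ### Coinciding roots -/

/-- In the homogeneous coordinates u = γ - β, w = α - γ, the 2 × 2 minors are u_j w_i - u_i w_j = (α
- β)(γ_j - γ_i), so each pair contributes one factor α - β. -/
theorem det_projVandermonde_sub (n : ℕ) (α β : ℂ) (γ : Fin n → ℂ) :
    (projVandermonde (fun k => γ k - β) (fun k => α - γ k)).det =
      (α - β) ^ (∑ i ∈ Finset.range n, i) * (vandermonde γ).det := by
  rw [det_projVandermonde, det_vandermonde]
  have h : ∀ i j, (γ j - β) * (α - γ i) - (γ i - β) * (α - γ j) = (α - β) * (γ j - γ i) := by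
    intros; ring
  simp only [h, Finset.prod_mul_distrib, Finset.prod_const, Fin.card_Ioi, Finset.prod_pow_eq_pow_sum]
  congr 2
  rw [← Fin.sum_univ_eq_sum_range (fun i => i) n, ← Equiv.sum_comp Fin.revPerm]
  refine Finset.sum_congr rfl fun i _ => ?_
  simp [Fin.val_rev]
  omega

/-- The coefficients of `(X - β) ^ s (α - X) ^ (n - 1 - s)`. -/
def binomialMatrix (n : ℕ) (α β : ℂ) : Matrix (Fin n) (Fin n) ℂ :=
  of fun i s => ((X - C β) ^ (s : ℕ) * (C α - X) ^ (s.rev : ℕ)).coeff i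

theorem vandermonde_mul_binomialMatrix {m n : ℕ} (α β : ℂ) (γ : Fin m → ℂ) (k : Fin m) (s : Fin n) :
    ∑ i : Fin n, γ k ^ (i : ℕ) * binomialMatrix n α β i s =
      (γ k - β) ^ (s : ℕ) * (α - γ k) ^ (s.rev : ℕ) := by
  have hd : ((X - C β) ^ (s : ℕ) * (C α - X) ^ (s.rev : ℕ)).natDegree < n := by
    refine lt_of_le_of_lt (natDegree_mul_le.trans (add_le_add (natDegree_pow_le_of_le s (m := 1) ?_)
      (natDegree_pow_le_of_le _ (m := 1) ?_))) ?_
    · exact (natDegree_sub_le _ _).trans (by simp)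
    · exact (natDegree_sub_le _ _).trans (by simp)
    · rw [Fin.val_rev]; omega
  have := eval_eq_sum_range' hd (γ k)
  rw [← Fin.sum_univ_eq_sum_range (fun i => _ * γ k ^ i) n] at this
  simp only [eval_mul, eval_pow, eval_sub, eval_X, eval_C] at this
  rw [this]
  exact Finset.sum_congr rfl fun i _ => mul_comm _ _

/-- Multiplying by the Vandermonde matrix of the distinct points 0, …, n - 1 gives the homogeneous
Vandermonde matrix at these points; the Vandermonde determinant then cancels. -/
theorem det_binomialMatrix (n : ℕ) (α β : ℂ) :
    (binomialMatrix n α β).det = (α - β) ^ (∑ i ∈ Finset.range n, i) := by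
  have hinj : Function.Injective fun i : Fin n => ((i : ℕ) : ℂ) :=
    Nat.cast_injective.comp Fin.val_injective
  refine mul_left_cancel₀ (det_vandermonde_ne_zero_iff.2 hinj) ?_
  rw [mul_comm _ ((α - β) ^ _), ← det_projVandermonde_sub, ← det_mul]
  congr 1
  ext k s
  rw [Matrix.mul_apply]
  exact vandermonde_mul_binomialMatrix α β (fun i : Fin n => ((i : ℕ) : ℂ)) k s

/-- Here A = (X - α)^(b + c) and Q = (X - β)^(a + c). The matrix `B` replaces the monomial
multipliers by (X - β)^s (α - X)^(a - 1 - s) on the A-columns and by the analogue with b on the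
Q-columns. With w = α - γ_k and γ_k - β = Γ_k w, each entry becomes, up to sign, w^(a + b + c - 1)
times Γ_k to an exponent of `rectExp`. For α = β the matrix `B` may be singular, but its determinant
is never divided by. -/
theorem det_vandermonde_mul_sylvesterDet_const {a b c : ℕ} (α β : ℂ) (γ Γ : Fin (a + b) → ℂ)
    (hγ : ∀ k, γ k ≠ α) (hΓ : ∀ k, Γ k = (γ k - β) / (α - γ k)) :
    (vandermonde Γ).det * sylvesterDet (c := c) (fun _ => α) (fun _ => β) γ =
      (-1) ^ (a * b + a * c) * ((α - β) ^ (a * b) * ∏ k, (α - γ k) ^ c) * alternant a b c Γ := by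
  have hw : ∀ k, α - γ k ≠ 0 := fun k => sub_ne_zero.2 (hγ k).symm
  have hu : ∀ k, γ k - β = Γ k * (α - γ k) := fun k => by rw [hΓ, div_mul_cancel₀ _ (hw k)]
  have h1 : (∏ k, (α - γ k) ^ (a + b - 1)) * (vandermonde Γ).det =
      (α - β) ^ (∑ i ∈ Finset.range (a + b), i) * (vandermonde γ).det := by
    rw [← det_projVandermonde_sub, ← det_mul_column]
    congr 1
    ext k j
    rw [of_apply, vandermonde_apply, projVandermonde_apply, hu, mul_pow, mul_assoc, ← pow_add,
      mul_comm]
    congr 2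
    rw [Fin.val_rev]; omega
  let B : Matrix (Fin (a + b)) (Fin (a + b)) ℂ :=
    reindex finSumFinEquiv finSumFinEquiv
      (fromBlocks (binomialMatrix a α β) 0 0 (binomialMatrix b α β))
  have hB : B.det = (α - β) ^ (∑ i ∈ Finset.range a, i + ∑ i ∈ Finset.range b, i) := by
    rw [det_reindex_self, det_fromBlocks_zero₂₁, det_binomialMatrix, det_binomialMatrix, pow_add]
  have h2 : (of fun k j => (blockPoly a b (rootPoly fun _ : Fin (b + c) => α)
      (rootPoly fun _ : Fin (a + c) => β) j).eval (γ k)).det * B.det =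
      (-1) ^ (a * b + a * c) * ((∏ k, (α - γ k) ^ (a + b + c - 1)) * alternant a b c Γ) := by
    have hsign : ∏ j : Fin (a + b), (Fin.addCases (fun _ => (-1) ^ (b + c)) (fun _ => 1) j : ℂ) =
        (-1) ^ (a * b + a * c) := by
      rw [Fin.prod_univ_add]
      simp [← pow_mul]
      ring
    rw [← det_mul, ← hsign, alternant, ← det_mul_column, ← det_mul_row]
    congr 1
    ext k j
    rw [Matrix.mul_apply, Fin.sum_univ_add]
    refine Fin.addCases (fun s => ?_) (fun r => ?_) j
    · have h := vandermonde_mul_binomialMatrix (n := a) α β γ k s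
      simp only [of_apply, blockPoly, Fin.addCases_left, Fin.addCases_right, eval_mul, eval_pow,
        eval_X, eval_rootPoly, Finset.prod_const, Finset.card_univ, Fintype.card_fin, B,
        reindex_apply, submatrix_apply, finSumFinEquiv_symm_apply_castAdd,
        finSumFinEquiv_symm_apply_natAdd, fromBlocks_apply₁₁, fromBlocks_apply₂₁, Matrix.zero_apply,
        mul_zero, Finset.sum_const_zero, add_zero, rectExp]
      rw [Finset.sum_congr rfl fun i _ => mul_right_comm _ _ _, ← Finset.sum_mul, h, hu,
        show γ k - α = (-1) * (α - γ k) by ring, mul_pow, mul_pow,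
        show a + b + c - 1 = s + s.rev + (b + c) by rw [Fin.val_rev]; omega, pow_add, pow_add]
      ring
    · have h := vandermonde_mul_binomialMatrix (n := b) α β γ k r
      simp only [of_apply, blockPoly, Fin.addCases_left, Fin.addCases_right, eval_mul, eval_pow,
        eval_X, eval_rootPoly, Finset.prod_const, Finset.card_univ, Fintype.card_fin, B,
        reindex_apply, submatrix_apply, finSumFinEquiv_symm_apply_castAdd,
        finSumFinEquiv_symm_apply_natAdd, fromBlocks_apply₁₂, fromBlocks_apply₂₂, Matrix.zero_apply,
        mul_zero, Finset.sum_const_zero, zero_add, rectExp]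
      rw [Finset.sum_congr rfl fun i _ => mul_right_comm _ _ _, ← Finset.sum_mul, h, hu,
        mul_pow, mul_pow,
        show a + b + c - 1 = r + r.rev + (a + c) by rw [Fin.val_rev]; omega, pow_add, pow_add]
      ring
  have h3 := det_vandermonde_mul_sylvesterDet (c := c) (fun _ => α) (fun _ => β) γ
  rw [← h3, hB] at h2
  -- The Vandermonde determinant of Γ contributes the power of α - β with exponent the sum over
  -- `range (a + b)`, while `B` accounts for the two smaller sums; the difference ab is the exponent
  -- in the constant.
  have hT : ∑ i ∈ Finset.range (a + b), i =
      ∑ i ∈ Finset.range a, i + ∑ i ∈ Finset.range b, i + a * b := by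
    rw [Finset.sum_range_add, Finset.sum_add_distrib]; simp; ring
  have hne : (∏ k, (α - γ k) ^ (a + b - 1)) ≠ 0 :=
    Finset.prod_ne_zero_iff.2 fun k _ => pow_ne_zero _ (hw k)
  refine mul_left_cancel₀ hne ?_
  have hsplit : (∏ k, (α - γ k) ^ (a + b + c - 1)) =
      (∏ k, (α - γ k) ^ (a + b - 1)) * ∏ k, (α - γ k) ^ c := by
    rw [← Finset.prod_mul_distrib]
    refine Finset.prod_congr rfl fun k _ => ?_
    rw [← pow_add]
    congr 1
    have := k.2
    omega
  rw [hsplit] at h2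
  rw [← mul_assoc, h1, hT]
  linear_combination (α - β) ^ (a * b) * h2

end ThreeArch
end

/-! ### Jacobi–Trudi determinants in elementary symmetric functions -/

noncomputable section

namespace ThreeArch

open Matrix

section JacobiTrudi

variable {R : Type*} [CommRing R]

/-- The elementary symmetric functions of `x 0, …, x (N - 1)`, indexed by the integers. -/
def elem (x : ℕ → R) : ℕ → ℤ → R
  | 0, n => if n = 0 then 1 else 0
  | N + 1, n => elem x N n + x N * elem x N (n - 1)

theorem elem_neg (x : ℕ → R) (N : ℕ) {n : ℤ} (hn : n < 0) : elem x N n = 0 := by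
  induction N generalizing n with
  | zero => simp [elem, hn.ne]
  | succ N ih => rw [elem, ih hn, ih (by omega)]; simp

/-- The Jacobi–Trudi determinant of the elementary symmetric functions. -/
def jacobiTrudi {c : ℕ} (x : ℕ → R) (N : ℕ) (ν : Fin c → ℤ) : R :=
  (of fun i j : Fin c => elem x N (ν i - i + j)).det

theorem jacobiTrudi_zero {c : ℕ} (x : ℕ → R) (ν : Fin c → ℤ) (h : Antitone ν) (h0 : ∀ i, 0 ≤ ν i) :
    jacobiTrudi x 0 ν = if ν = 0 then 1 else 0 := by
  split_ifs with hν
  · subst hν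
    refine (congrArg det ?_).trans (det_one (R := R) (n := Fin c))
    ext i j
    simp only [of_apply, elem, Matrix.one_apply, Fin.ext_iff, Pi.zero_apply]
    refine if_congr ?_ rfl rfl
    omega
  · rcases c with _ | c
    · exact absurd (Subsingleton.elim _ _) hν
    refine det_eq_zero_of_row_eq_zero 0 fun j => ?_
    have h1 : 0 < ν 0 := by
      refine lt_of_le_of_ne (h0 0) fun hz => hν (funext fun i => ?_)
      exact le_antisymm ((h (Fin.zero_le i)).trans hz.symm.le) (h0 i)
    simp only [of_apply, elem]
    rw [if_neg]
    simp only [Fin.val_zero, Nat.cast_zero]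
    omega

/-- The indicator function of a set of columns. -/
def ind {c : ℕ} (s : Finset (Fin c)) : Fin c → ℤ := fun i => if i ∈ s then 1 else 0

/-- Each row splits by the recursion e_n(x_0, …, x_N) = e_n + x_N e_(n - 1), and multilinearity
expands the determinant over the set `s` of rows in which the shifted summand is taken. This is the
branching rule. -/
theorem jacobiTrudi_succ {c : ℕ} (x : ℕ → R) (N : ℕ) (ν : Fin c → ℤ) :
    jacobiTrudi x (N + 1) ν = ∑ s : Finset (Fin c), x N ^ s.card * jacobiTrudi x N (ν - ind s) := by
  have h := (detRowAlternating (n := Fin c) (R := R)).toMultilinearMap.map_add_univ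
    (fun i j => x N * elem x N (ν i - 1 - i + j)) (fun i j => elem x N (ν i - i + j))
  refine (Eq.trans ?_ h).trans (Finset.sum_congr rfl fun s _ => ?_)
  · rw [jacobiTrudi]
    refine congrArg det ?_
    ext i j
    simp only [of_apply, elem, Pi.add_apply]
    rw [add_comm, show ν i - i + j - 1 = ν i - 1 - i + j by ring]
  · have h2 := det_mul_column (fun i => if i ∈ s then x N else 1)
      (of fun i j : Fin c => elem x N ((ν - ind s) i - i + j))
    rw [Finset.prod_ite_mem, Finset.univ_inter, Finset.prod_const] at h2
    rw [jacobiTrudi, ← h2]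
    refine congrArg det ?_
    ext i j
    simp only [Finset.piecewise, ind, of_apply, Pi.sub_apply]
    split_ifs with hi
    · rfl
    · simp

/-- Since `ν` is antitone and `s` removes at most one box per column, monotonicity can only fail at
adjacent columns of equal length of which the left one alone is shortened; the two rows of the
determinant then coincide. If monotonicity holds but a length is negative, the last row consists of
elementary functions of negative index. -/
theorem jacobiTrudi_eq_zero {c : ℕ} (x : ℕ → R) (N : ℕ) (ν : Fin c → ℤ) (h : Antitone ν)
    (s : Finset (Fin c)) (hs : ¬ (Antitone (ν - ind s) ∧ ∀ i, 0 ≤ (ν - ind s) i)) :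
    jacobiTrudi x N (ν - ind s) = 0 := by
  rcases c with _ | c
  · exact absurd ⟨fun i => i.elim0, fun i => i.elim0⟩ hs
  by_cases ha : Antitone (ν - ind s)
  · have : ∃ i, (ν - ind s) i < 0 := by
      by_contra hc
      push Not at hc
      exact hs ⟨ha, hc⟩
    obtain ⟨i, hi⟩ := this
    have hl := (ha (Fin.le_last i)).trans_lt hi
    refine det_eq_zero_of_row_eq_zero (Fin.last c) fun j => ?_
    rw [of_apply]
    refine elem_neg _ _ ?_
    have := j.2
    simp only [Fin.val_last]
    omega
  · rw [Fin.antitone_iff_succ_le] at ha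
    push Not at ha
    obtain ⟨i, hi⟩ := ha
    have h1 := h (Fin.castSucc_le_succ i)
    refine det_zero_of_row_eq (i := i.castSucc) (j := i.succ) (Fin.castSucc_lt_succ).ne ?_
    ext j
    simp only [of_apply, Pi.sub_apply, ind, Fin.val_castSucc, Fin.val_succ] at hi ⊢
    congr 2
    split_ifs at hi ⊢ <;> push_cast <;> omega

end JacobiTrudi

/-! ### Chains of horizontal strips -/

/-- The number of steps before `n` at which the column `j` grows. -/
def count {c N : ℕ} (S : Fin N → Finset (Fin c)) (n : ℕ) (j : Fin c) : ℕ :=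
  (Finset.univ.filter fun m : Fin N => (m : ℕ) < n ∧ j ∈ S m).card

theorem count_snoc_of_le {c N : ℕ} (S : Fin N → Finset (Fin c)) (s : Finset (Fin c)) {n : ℕ}
    (hn : n ≤ N) (j : Fin c) :
    count (Fin.snoc S s : Fin (N + 1) → Finset (Fin c)) n j = count S n j := by
  unfold count
  rw [Fin.univ_castSuccEmb, Finset.filter_cons]
  simp only [Fin.val_last, hn.not_gt, false_and, if_false]
  rw [Finset.filter_map, Finset.card_map]
  simp [Function.comp_def]

theorem count_snoc {c N : ℕ} (S : Fin N → Finset (Fin c)) (s : Finset (Fin c)) {n : ℕ}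
    (hn : N < n) (j : Fin c) :
    (count (Fin.snoc S s : Fin (N + 1) → Finset (Fin c)) n j : ℤ) = count S N j + ind s j := by
  unfold count ind
  rw [Fin.univ_castSuccEmb, Finset.filter_cons]
  have h : (Finset.univ.filter fun m : Fin N => (m : ℕ) < n ∧ j ∈ S m) =
      Finset.univ.filter fun m : Fin N => (m : ℕ) < N ∧ j ∈ S m :=
    Finset.filter_congr fun m _ => by simp [m.2, m.2.trans hn]
  split_ifs with h1 h2 h2
  · rw [Finset.card_cons, Finset.filter_map, Finset.card_map, ← h]
    simp [Function.comp_def]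
  · simp [h2] at h1
  · simp [h2, hn] at h1
  · rw [Finset.filter_map, Finset.card_map, ← h]
    simp [Function.comp_def]

/-- Chains of column length sequences that end at `ν`. -/
def IsChainTo {c N : ℕ} (S : Fin N → Finset (Fin c)) (ν : Fin c → ℤ) : Prop :=
  (∀ n, Antitone (count S n)) ∧ ∀ j, (count S N j : ℤ) = ν j

/-- The additional step changes the counts only beyond N, where they take their final value `ν`,
antitone by hypothesis. -/
theorem isChainTo_snoc {c N : ℕ} (S : Fin N → Finset (Fin c)) (s : Finset (Fin c))
    (ν : Fin c → ℤ) (hν : Antitone ν) :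
    IsChainTo (Fin.snoc S s : Fin (N + 1) → Finset (Fin c)) ν ↔ IsChainTo S (ν - ind s) := by
  constructor
  · rintro ⟨h1, h2⟩
    refine ⟨fun n => ?_, fun j => ?_⟩
    · rcases le_total n N with hn | hn
      · have := h1 n
        rwa [show count (Fin.snoc S s : Fin (N + 1) → Finset (Fin c)) n = count S n from
          funext fun j => count_snoc_of_le S s hn j] at this
      · have := h1 N
        rw [show count (Fin.snoc S s : Fin (N + 1) → Finset (Fin c)) N = count S N from
          funext fun j => count_snoc_of_le S s le_rfl j] at this
        rwa [show count S n = count S N from funext fun j => by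
          unfold count
          exact congrArg _ (Finset.filter_congr fun m _ => by simp [m.2, m.2.trans_le hn])]
    · have := h2 j
      rw [count_snoc S s (Nat.lt_succ_self N)] at this
      rw [Pi.sub_apply]
      omega
  · rintro ⟨h1, h2⟩
    have h3 : ∀ n, N < n → ∀ j,
        (count (Fin.snoc S s : Fin (N + 1) → Finset (Fin c)) n j : ℤ) = ν j := by
      intro n hn j
      rw [count_snoc S s hn, h2, Pi.sub_apply]
      ring
    refine ⟨fun n => ?_, fun j => h3 _ (Nat.lt_succ_self N) j⟩
    rcases le_or_gt n N with hn | hn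
    · rw [show count (Fin.snoc S s : Fin (N + 1) → Finset (Fin c)) n = count S n from
          funext fun j => count_snoc_of_le S s hn j]
      exact h1 n
    · intro i j hij
      have := hν hij
      rw [← h3 n hn, ← h3 n hn] at this
      exact_mod_cast this

-- Determinant and sum over chains satisfy the same recursion in the number of variables. The terms
-- of the branching rule that do not come from a partition vanish on the determinant side, and no
-- chain ends there on the other.
open Classical in
theorem jacobiTrudi_eq_sum_chains {R : Type*} [CommRing R] {c : ℕ} (x : ℕ → R) (N : ℕ)
    (ν : Fin c → ℤ) (h : Antitone ν) (h0 : ∀ i, 0 ≤ ν i) :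
    jacobiTrudi x N ν = ∑ S : Fin N → Finset (Fin c),
      if IsChainTo S ν then ∏ m : Fin N, x m ^ (S m).card else 0 := by
  induction N generalizing ν with
  | zero =>
    rw [jacobiTrudi_zero x ν h h0, Fintype.sum_unique]
    simp only [Finset.univ_eq_empty, Finset.prod_empty]
    refine if_congr ?_ rfl rfl
    simp only [IsChainTo, count, funext_iff, eq_comm, Finset.univ_eq_empty, Finset.filter_empty,
      Finset.card_empty, Nat.cast_zero, Pi.zero_apply]
    exact ⟨fun hν => ⟨fun n => antitone_const, hν⟩, fun hν => hν.2⟩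
  | succ N ih =>
    rw [jacobiTrudi_succ, ← (Fin.snocEquiv fun _ => Finset (Fin c)).sum_comp, Fintype.sum_prod_type]
    refine Finset.sum_congr rfl fun s _ => ?_
    have key : ∀ S : Fin N → Finset (Fin c),
        (if IsChainTo ((Fin.snocEquiv fun _ => Finset (Fin c)) (s, S)) ν then
          ∏ m : Fin (N + 1), x m ^ ((Fin.snocEquiv fun _ => Finset (Fin c)) (s, S) m).card else 0) =
        x N ^ s.card * if IsChainTo S (ν - ind s) then ∏ m : Fin N, x m ^ (S m).card else 0 := by
      intro S
      rw [mul_ite, mul_zero]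
      refine if_congr (isChainTo_snoc S s ν h) ?_ rfl
      rw [Fin.prod_univ_castSucc, mul_comm]
      simp [Fin.snocEquiv]
    rw [Finset.sum_congr rfl fun S _ => key S, ← Finset.mul_sum]
    congr 1
    by_cases hs : Antitone (ν - ind s) ∧ ∀ i, 0 ≤ (ν - ind s) i
    · exact ih _ hs.1 hs.2
    · rw [jacobiTrudi_eq_zero x N ν h s hs]
      refine (Finset.sum_eq_zero fun S _ => if_neg fun hS => hs ⟨fun i j hij => ?_, fun i => ?_⟩).symm
      · rw [← hS.2, ← hS.2]
        exact_mod_cast hS.1 N hij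
      · rw [← hS.2]
        positivity

/-! ### Tableaux of rectangular shape -/

theorem mem_rect {b c i j : ℕ} : (i, j) ∈ rect b c ↔ i < b ∧ j < c := by
  rw [← YoungDiagram.mem_cells]
  simp [rect]

/-- The column `j` of a tableau of rectangular shape. -/
def tableauEntry {b c N : ℕ} (T : Tableau (rect b c) N) (j : Fin c) (i : Fin b) : Fin N :=
  ⟨T.1 i j, T.2 ⟨(i, j), mem_rect.2 ⟨i.2, j.2⟩⟩⟩

theorem tableauEntry_strictMono {b c N : ℕ} (T : Tableau (rect b c) N) (j : Fin c) :
    StrictMono (tableauEntry T j) := fun i i' h => by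
  have : (i : ℕ) < i' := h
  exact T.1.col_strict this (mem_rect.2 ⟨i'.2, j.2⟩)

/-- The set of columns of `T` that contain the entry `m`. -/
def tableauChain {b c N : ℕ} (T : Tableau (rect b c) N) (m : Fin N) : Finset (Fin c) :=
  Finset.univ.filter fun j => ∃ i, tableauEntry T j i = m

theorem count_eq_card {b c N : ℕ} (S : Fin N → Finset (Fin c)) (j : Fin c) (f : Fin b → Fin N)
    (hf : Function.Injective f) (h : ∀ m, j ∈ S m ↔ ∃ i, f i = m) (n : ℕ) :
    count S n j = (Finset.univ.filter fun i => (f i : ℕ) < n).card := by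
  unfold count
  rw [← Finset.card_image_of_injective _ hf]
  congr 1
  ext m
  simp only [Finset.mem_filter, Finset.mem_univ, true_and, Finset.mem_image, h]
  constructor
  · rintro ⟨h1, i, rfl⟩
    exact ⟨i, h1, rfl⟩
  · rintro ⟨i, h1, rfl⟩
    exact ⟨h1, i, rfl⟩

theorem mem_tableauChain {b c N : ℕ} (T : Tableau (rect b c) N) (j : Fin c) (m : Fin N) :
    j ∈ tableauChain T m ↔ ∃ i, tableauEntry T j i = m := by
  simp [tableauChain]

/-- The count of column j before step n is the number of its entries below n. Weakly increasing rows
make this number decrease from left to right. -/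
theorem isChainTo_tableauChain {b c N : ℕ} (T : Tableau (rect b c) N) :
    IsChainTo (tableauChain T) fun _ => (b : ℤ) := by
  have hc := fun j => count_eq_card (tableauChain T) j (tableauEntry T j)
    (tableauEntry_strictMono T j).injective (mem_tableauChain T j)
  constructor
  · intro n j j' hj
    rw [hc, hc]
    refine Finset.card_le_card fun i hi => ?_
    simp only [Finset.mem_filter, Finset.mem_univ, true_and] at hi ⊢
    exact lt_of_le_of_lt (T.1.row_weak_of_le hj (mem_rect.2 ⟨i.2, j'.2⟩)) hi
  · intro j
    rw [hc]
    simp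

/-- A strictly increasing column is determined by the set of its entries. -/
theorem tableauChain_injective {b c N : ℕ} :
    Function.Injective (tableauChain : Tableau (rect b c) N → Fin N → Finset (Fin c)) := by
  intro T T' h
  have key : ∀ j, tableauEntry T j = tableauEntry T' j := by
    intro j
    refine ((tableauEntry_strictMono T j).range_inj (tableauEntry_strictMono T' j)).1 ?_
    ext m
    rw [Set.mem_range, Set.mem_range, ← mem_tableauChain, ← mem_tableauChain, h]
  refine Subtype.ext (SemistandardYoungTableau.ext fun i j => ?_)
  by_cases hij : (i, j) ∈ rect b c
  · obtain ⟨hi, hj⟩ := mem_rect.1 hij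
    exact congrArg Fin.val (congrFun (key ⟨j, hj⟩) ⟨i, hi⟩)
  · rw [T.1.zeros hij, T'.1.zeros hij]

/-- Column j is the increasing enumeration of the steps at which it grows; there are b of them by
the condition on the end of the chain. -/
theorem exists_tableauChain_eq {b c N : ℕ} (S : Fin N → Finset (Fin c))
    (hS : IsChainTo S fun _ => (b : ℤ)) : ∃ T : Tableau (rect b c) N, tableauChain T = S := by
  have hcard : ∀ j, (Finset.univ.filter fun m => j ∈ S m).card = b := by
    intro j
    have := hS.2 j
    simpa [count] using this
  let e : Fin c → Fin b → Fin N := fun j => (Finset.univ.filter fun m => j ∈ S m).orderEmbOfFin (hcard j)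
  have he : ∀ j, StrictMono (e j) := fun j => OrderEmbedding.strictMono _
  have hmem : ∀ j m, j ∈ S m ↔ ∃ i, e j i = m := by
    intro j m
    have := Finset.range_orderEmbOfFin (Finset.univ.filter fun m => j ∈ S m) (hcard j)
    have h2 := Set.ext_iff.1 this m
    simp only [Set.mem_range, Finset.coe_filter, Finset.mem_univ, true_and] at h2
    exact h2.symm
  have hc := fun j => count_eq_card S j (e j) (he j).injective (hmem j)
  have hrow : ∀ j j', j ≤ j' → ∀ i, e j i ≤ e j' i := by
    intro j j' hj i
    by_contra hlt
    push Not at hlt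
    -- If the row decreased at i from column j to column j', then just after the step `e j' i`
    -- column j' would have length at least i + 1 and column j length at most i, against the
    -- antitone counts.
    have h1 := hS.1 ((e j' i : ℕ) + 1) hj
    rw [hc, hc] at h1
    have h2 : (i : ℕ) + 1 ≤ (Finset.univ.filter fun l => (e j' l : ℕ) < (e j' i : ℕ) + 1).card := by
      rw [← Fin.card_Iic i]
      refine Finset.card_le_card fun l hl => ?_
      have := (he j').monotone (Finset.mem_Iic.1 hl)
      simp only [Finset.mem_filter, Finset.mem_univ, true_and]
      exact Nat.lt_succ_of_le this
    have h3 : (Finset.univ.filter fun l => (e j l : ℕ) < (e j' i : ℕ) + 1).card ≤ i := by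
      rw [← Fin.card_Iio i]
      refine Finset.card_le_card fun l hl => ?_
      simp only [Finset.mem_filter, Finset.mem_univ, true_and] at hl
      rw [Finset.mem_Iio, ← (he j).lt_iff_lt]
      exact lt_of_le_of_lt (Nat.le_of_lt_succ hl) hlt
    omega
  let T : SemistandardYoungTableau (rect b c) :=
    { entry := fun i j => if h : i < b ∧ j < c then e ⟨j, h.2⟩ ⟨i, h.1⟩ else 0
      row_weak' := by
        intro i j1 j2 hj hcell
        obtain ⟨hi, hj2⟩ := mem_rect.1 hcell
        rw [dif_pos ⟨hi, hj.trans hj2⟩, dif_pos ⟨hi, hj2⟩]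
        exact hrow _ _ hj.le _
      col_strict' := by
        intro i1 i2 j hi hcell
        obtain ⟨hi2, hj⟩ := mem_rect.1 hcell
        rw [dif_pos ⟨hi.trans hi2, hj⟩, dif_pos ⟨hi2, hj⟩]
        exact he _ (show (⟨i1, hi.trans hi2⟩ : Fin b) < ⟨i2, hi2⟩ from hi)
      zeros' := by
        intro i j hcell
        rw [dif_neg fun h => hcell (mem_rect.2 h)] }
  have hT : ∀ i j (h : i < b ∧ j < c), T i j = e ⟨j, h.2⟩ ⟨i, h.1⟩ := fun i j h => dif_pos h
  refine ⟨⟨T, fun p => ?_⟩, ?_⟩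
  · rw [hT _ _ (mem_rect.1 p.2)]
    exact Fin.is_lt _
  · funext m
    ext j
    rw [mem_tableauChain, hmem]
    refine exists_congr fun i => ?_
    rw [Fin.ext_iff, Fin.ext_iff]
    simp only [tableauEntry]
    rw [hT _ _ ⟨i.2, j.2⟩]

theorem prod_tableau {b c N : ℕ} (T : Tableau (rect b c) N) (x : Fin N → ℂ) :
    ∏ p : (rect b c).cells, x ⟨T.1 p.1.1 p.1.2, T.2 p⟩ =
      ∏ m, x m ^ (tableauChain T m).card := by
  have h1 : ∏ p : (rect b c).cells, x ⟨T.1 p.1.1 p.1.2, T.2 p⟩ =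
      ∏ q : Fin c × Fin b, x (tableauEntry T q.1 q.2) := by
    symm
    refine Fintype.prod_bijective
      (fun q : Fin c × Fin b => (⟨(q.2, q.1), mem_rect.2 ⟨q.2.2, q.1.2⟩⟩ : (rect b c).cells))
      ⟨fun q q' h => ?_, fun p => ?_⟩ _ _ fun q => rfl
    · simp only [Subtype.mk.injEq, Prod.mk.injEq] at h
      exact Prod.ext (Fin.ext h.2) (Fin.ext h.1)
    · obtain ⟨⟨i, j⟩, hp⟩ := p
      obtain ⟨hi, hj⟩ := mem_rect.1 hp
      exact ⟨(⟨j, hj⟩, ⟨i, hi⟩), rfl⟩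
  rw [h1, Fintype.prod_prod_type]
  have h2 : ∀ j, ∏ i, x (tableauEntry T j i) =
      ∏ m, if j ∈ tableauChain T m then x m else 1 := by
    intro j
    rw [← Finset.prod_filter, ← Finset.prod_image (f := x)
      fun i _ i' _ h => (tableauEntry_strictMono T j).injective h]
    refine Finset.prod_congr ?_ fun _ _ => rfl
    ext m
    simp [mem_tableauChain]
  simp only [h2]
  rw [Finset.prod_comm]
  refine Finset.prod_congr rfl fun m _ => ?_
  rw [Finset.prod_ite_mem, Finset.univ_inter, Finset.prod_const]

/-- The extension of a finite sequence by zeros. -/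
def extend {R : Type*} [CommRing R] {N : ℕ} (x : Fin N → R) (n : ℕ) : R :=
  if h : n < N then x ⟨n, h⟩ else 0

theorem extend_apply {R : Type*} [CommRing R] {N : ℕ} (x : Fin N → R) (m : Fin N) :
    extend x m = x m := dif_pos m.2

theorem schur_rect {b c N : ℕ} (x : Fin N → ℂ) :
    schur (rect b c) x = jacobiTrudi (extend x) N fun _ : Fin c => (b : ℤ) := by
  classical
  rw [jacobiTrudi_eq_sum_chains _ _ _ antitone_const fun _ => by positivity, ← Finset.sum_filter]
  unfold schur
  have : Fintype (Tableau (rect b c) N) := Fintype.ofFinite _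
  rw [finsum_eq_sum_of_fintype]
  refine Finset.sum_bij (fun T _ => tableauChain T) ?_ ?_ ?_ ?_
  · intro T _
    exact Finset.mem_filter.2 ⟨Finset.mem_univ _, isChainTo_tableauChain T⟩
  · intro T _ T' _ h
    exact tableauChain_injective h
  · intro S hS
    obtain ⟨T, hT⟩ := exists_tableauChain_eq S (Finset.mem_filter.1 hS).2
    exact ⟨T, Finset.mem_univ _, hT⟩
  · intro T _
    rw [prod_tableau]
    simp only [extend_apply]

end ThreeArch
end

/-! ### The bialternant formula for rectangles -/

noncomputable section

namespace ThreeArch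

open Polynomial Matrix

theorem elem_of_lt {R : Type*} [CommRing R] (x : ℕ → R) (N : ℕ) {n : ℤ} (hn : N < n) :
    elem x N n = 0 := by
  induction N generalizing n with
  | zero => simp only [elem]; rw [if_neg]; push_cast at hn; omega
  | succ N ih =>
    push_cast at hn
    rw [elem, ih (by omega), ih (by omega)]; simp

theorem coeff_prod_range_X_sub_C {R : Type*} [CommRing R] (x : ℕ → R) (N k : ℕ) :
    (∏ i ∈ Finset.range N, (X - C (x i))).coeff k = (-1) ^ (N + k) * elem x N (N - k) := by
  induction N generalizing k with
  | zero =>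
    simp only [Finset.range_zero, Finset.prod_empty, coeff_one, elem]
    rcases k with _ | k
    · simp
    · rw [if_neg (by omega), if_neg (by omega)]; simp
  | succ N ih =>
    rw [Finset.prod_range_succ, mul_sub, coeff_sub, coeff_mul_C, elem]
    rcases k with _ | k
    · rw [coeff_mul_X_zero, ih, elem_of_lt x N (n := ((N + 1 : ℕ) : ℤ) - (0 : ℕ)) (by push_cast; omega)]
      rw [show ((N + 1 : ℕ) : ℤ) - (0 : ℕ) - 1 = (N : ℤ) - (0 : ℕ) by push_cast; ring]
      ring
    · rw [coeff_mul_X, ih, ih,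
        show ((N + 1 : ℕ) : ℤ) - (k + 1 : ℕ) - 1 = (N : ℤ) - (k + 1 : ℕ) by push_cast; ring,
        show ((N + 1 : ℕ) : ℤ) - (k + 1 : ℕ) = (N : ℤ) - k by push_cast; ring]
      ring

theorem coeff_rootPoly {R : Type*} [CommRing R] {N : ℕ} (x : Fin N → R) (k : ℕ) :
    (rootPoly x).coeff k = (-1) ^ (N + k) * elem (extend x) N (N - k) := by
  rw [← coeff_prod_range_X_sub_C, ← Fin.prod_univ_eq_prod_range (fun i => X - C (extend x i))]
  simp only [extend_apply, rootPoly]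

theorem rectExp_lt {a b c : ℕ} (j : Fin (a + b)) : rectExp a b c j < a + b + c := by
  refine Fin.addCases (fun s => ?_) (fun r => ?_) j <;> simp [rectExp] <;> omega

theorem rectExp_strictMono (a b c : ℕ) : StrictMono (rectExp a b c) := by
  intro i j
  refine Fin.addCases (fun s => ?_) (fun r => ?_) i <;>
    refine Fin.addCases (fun s' => ?_) (fun r' => ?_) j <;>
    simp only [rectExp, Fin.lt_def, Fin.addCases_left, Fin.addCases_right, Fin.val_castAdd,
      Fin.val_natAdd] <;> omega

/-- The positions of the exponents `rectExp a b c`, followed by the `c` exponents left out. -/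
def rectPerm (a b c : ℕ) : Equiv.Perm (Fin (a + b) ⊕ Fin c) :=
  (Equiv.ofBijective (Sum.elim (fun j => (⟨rectExp a b c j, rectExp_lt j⟩ : Fin (a + b + c)))
    fun r : Fin c => ⟨a + r, by omega⟩) (by
      rw [Fintype.bijective_iff_injective_and_card]
      refine ⟨?_, by simp⟩
      have hne : ∀ (j : Fin (a + b)) (r : Fin c), rectExp a b c j ≠ a + r := by
        intro j r
        refine Fin.addCases (fun s => ?_) (fun r => ?_) j <;> simp [rectExp] <;> omega
      rintro (j | r) (j' | r') h
      · simpa using (rectExp_strictMono a b c).injective (congrArg Fin.val h)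
      · exact absurd (congrArg Fin.val h) (hne j r')
      · exact absurd (congrArg Fin.val h).symm (hne j' r)
      · simpa [Fin.ext_iff] using h)).trans finSumFinEquiv.symm

theorem index_rectPerm {a b c : ℕ} (i : Fin (a + b) ⊕ Fin c) :
    Sum.elim (fun k : Fin (a + b) => (k : ℕ)) (fun r : Fin c => a + b + r) (rectPerm a b c i) =
      Sum.elim (rectExp a b c) (fun r : Fin c => a + r) i := by
  have h : ∀ j : Fin (a + b) ⊕ Fin c,
      Sum.elim (fun k : Fin (a + b) => (k : ℕ)) (fun r : Fin c => a + b + r) j =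
        (finSumFinEquiv j : ℕ) := by
    rintro (j | r) <;> simp
  rw [h, rectPerm, Equiv.trans_apply, Equiv.apply_symm_apply]
  rcases i with j | r <;> rfl

/-- The coefficient identity is applied to the monomials with exponents `rectExp`. After the rows of
these exponents are moved to the front, the coefficient matrix is block triangular with an identity
block. The other diagonal block consists of coefficients of P at a + r' - r, which by Vieta are
elementary functions of index b - r' + r up to signs that split into row and column factors. -/
theorem det_vandermonde_mul_jacobiTrudi_sign (a b c : ℕ) {R : Type*} [CommRing R]
    (x : Fin (a + b) → R) :
    (vandermonde x).det * ((((Equiv.Perm.sign (rectPerm a b c) * (-1) ^ (b * c) : ℤˣ) : ℤ) : R) *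
      jacobiTrudi (extend x) (a + b) fun _ : Fin c => (b : ℤ)) = alternant a b c x := by
  have h := det_vandermonde_mul_det_coeffMatrix (c := c) (fun j => X ^ rectExp a b c j)
    (fun j => lt_of_le_of_lt (degree_X_pow_le _) (by exact_mod_cast rectExp_lt j)) x
  simp only [eval_pow, eval_X] at h
  rw [alternant, ← h]
  congr 1
  have h2 := det_permute (rectPerm a b c)
    (coeffMatrix c (fun j => X ^ rectExp a b c j) (rootPoly x))
  have h3 : (coeffMatrix c (fun j => X ^ rectExp a b c j) (rootPoly x)).submatrix
      (rectPerm a b c) id = fromBlocks 1 (of fun j (r : Fin c) =>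
        (X ^ (r : ℕ) * rootPoly x).coeff (rectExp a b c j)) 0
        (of fun r' r : Fin c => (X ^ (r : ℕ) * rootPoly x).coeff (a + r')) := by
    ext i j
    simp only [coeffMatrix, submatrix_apply, of_apply, index_rectPerm, id]
    rcases i with i | i <;> rcases j with j | j
    · simp [coeff_X_pow, Matrix.one_apply, (rectExp_strictMono a b c).injective.eq_iff]
    · simp
    · simp only [Sum.elim_inr, Sum.elim_inl, fromBlocks_apply₂₁, coeff_X_pow, Matrix.zero_apply]
      rw [if_neg]
      refine Fin.addCases (fun s => ?_) (fun r => ?_) j <;> simp [rectExp] <;> omega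
    · simp
  have h4 : (of fun r' r : Fin c => (X ^ (r : ℕ) * rootPoly x).coeff (a + r')).det =
      (-1) ^ (b * c) * jacobiTrudi (extend x) (a + b) fun _ : Fin c => (b : ℤ) := by
    have h5 : (of fun r' r : Fin c => (X ^ (r : ℕ) * rootPoly x).coeff (a + r')) =
        of fun r' r : Fin c => ((-1) ^ b * (-1) ^ (r' : ℕ)) * (of fun r' r : Fin c => (-1) ^ (r : ℕ) *
          (of fun i j : Fin c => elem (extend x) (a + b) ((b : ℤ) - i + j)) r' r) r' r := by
      ext r' r
      simp only [of_apply, coeff_X_pow_mul', coeff_rootPoly]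
      split_ifs with hr
      · rw [show ((a + b : ℕ) : ℤ) - (a + r' - r : ℕ) = (b : ℤ) - r' + r by
            rw [Nat.cast_sub hr]; push_cast; ring]
        have e : ((-1 : R) ^ (a + b + (a + r' - r))) = (-1) ^ b * (-1) ^ (r' : ℕ) * (-1) ^ (r : ℕ) := by
          have e1 : ((-1 : R) ^ (a + b + (a + r' - r))) * ((-1) ^ (r : ℕ) * (-1) ^ (r : ℕ)) =
              (-1) ^ b * (-1) ^ (r' : ℕ) * (-1) ^ (r : ℕ) := by
            rw [← mul_assoc, ← pow_add, show a + b + (a + r' - r) + r = 2 * a + (b + r') by omega,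
              pow_add, pow_mul, neg_one_sq, one_pow, one_mul, pow_add]
          rwa [← mul_pow, neg_one_mul, neg_neg, one_pow, mul_one] at e1
        rw [e]; ring
      · rw [elem_of_lt _ _ (by push_cast; omega)]; simp
    rw [h5, det_mul_column, det_mul_row, jacobiTrudi, Finset.prod_mul_distrib, Finset.prod_const,
      Finset.card_univ, Fintype.card_fin, ← pow_mul, mul_assoc, ← mul_assoc (∏ i : Fin c, _),
      ← Finset.prod_mul_distrib]
    simp [← mul_pow]
  rw [h3, det_fromBlocks_zero₂₁, det_one, one_mul, h4] at h2
  have h6 : (((Equiv.Perm.sign (rectPerm a b c) : ℤˣ) : ℤ) : R) *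
      ((Equiv.Perm.sign (rectPerm a b c) : ℤˣ) : ℤ) = 1 := by
    rw [← Int.cast_mul, ← Units.val_mul, Int.units_mul_self]; simp
  push_cast
  linear_combination (((Equiv.Perm.sign (rectPerm a b c) : ℤˣ) : ℤ) : R) * h2 +
    (coeffMatrix c (fun j => X ^ rectExp a b c j) (rootPoly x)).det * h6

/-- The sign is found by positivity at x_k = 2^k rather than by counting inversions. There the
Vandermonde determinant is positive, the alternant is a transposed Vandermonde determinant in
increasing powers of 2, and the Jacobi–Trudi determinant is nonnegative as a sum over chains. -/
theorem sign_rectPerm (a b c : ℕ) : Equiv.Perm.sign (rectPerm a b c) * (-1) ^ (b * c) = 1 := by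
  classical
  refine (Int.units_eq_one_or _).resolve_right fun hneg => ?_
  have h := det_vandermonde_mul_jacobiTrudi_sign a b c fun k : Fin (a + b) => (2 : ℝ) ^ (k : ℕ)
  rw [hneg] at h
  have hpos : ∀ {n : ℕ} (f : Fin n → ℕ), StrictMono f →
      0 < (vandermonde fun k => (2 : ℝ) ^ f k).det := by
    intro n f hf
    rw [det_vandermonde]
    refine Finset.prod_pos fun i _ => Finset.prod_pos fun j hj => sub_pos.2 ?_
    exact pow_lt_pow_right₀ one_lt_two (hf (Finset.mem_Ioi.1 hj))
  have h1 := hpos (n := a + b) (fun k => k) fun _ _ h => h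
  have h2 : 0 < alternant a b c fun k : Fin (a + b) => (2 : ℝ) ^ (k : ℕ) := by
    have := hpos _ (rectExp_strictMono a b c)
    rw [← det_transpose] at this
    refine this.trans_eq (congrArg det ?_)
    ext k j
    simp [← pow_mul, mul_comm]
  have h3 : 0 ≤ jacobiTrudi (extend fun k : Fin (a + b) => (2 : ℝ) ^ (k : ℕ)) (a + b)
      fun _ : Fin c => (b : ℤ) := by
    rw [jacobiTrudi_eq_sum_chains _ _ _ antitone_const fun _ => by positivity]
    refine Finset.sum_nonneg fun S _ => ?_
    split_ifs
    · refine Finset.prod_nonneg fun m _ => pow_nonneg ?_ _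
      rw [extend_apply]; positivity
    · rfl
  push_cast at h
  nlinarith [mul_nonneg h1.le h3]

/-- The bialternant formula for rectangular shapes. -/
theorem det_vandermonde_mul_jacobiTrudi (a b c : ℕ) {R : Type*} [CommRing R]
    (x : Fin (a + b) → R) :
    (vandermonde x).det * jacobiTrudi (extend x) (a + b) (fun _ : Fin c => (b : ℤ)) =
      alternant a b c x := by
  have h := det_vandermonde_mul_jacobiTrudi_sign a b c x
  rw [sign_rectPerm] at h
  simpa using h

end ThreeArch
end

/-! ### From distinct γ to arbitrary γ by continuity -/

noncomputable section

namespace ThreeArch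

open Matrix Filter Topology

theorem continuous_schur (μ : YoungDiagram) {N : ℕ} :
    Continuous fun x : Fin N → ℂ => schur μ x := by
  have : Fintype (Tableau μ N) := Fintype.ofFinite _
  simp only [schur, finsum_eq_sum_of_fintype]
  fun_prop

theorem eventually_add_mul_ne_zero (u v : ℂ) (h : u ≠ 0 ∨ v ≠ 0) :
    ∀ᶠ t in 𝓝[≠] (0 : ℂ), u + t * v ≠ 0 := by
  by_cases hu : u = 0
  · filter_upwards [self_mem_nhdsWithin] with t ht
    rw [hu, zero_add]
    exact mul_ne_zero ht (h.resolve_left (not_not.2 hu))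
  · have hc : ContinuousAt (fun t : ℂ => u + t * v) 0 := by fun_prop
    exact (hc.eventually_ne (by simpa using hu)).filter_mono nhdsWithin_le_nhds

theorem value_phi_const_of_injective {a b c : ℕ} (α β : ℂ) (γ : Fin (a + b) → ℂ)
    (hγ : ∀ k, γ k ≠ α) (hinj : Function.Injective γ) (hαβ : α - β ≠ 0) :
    value (phi a b c) (fun _ => α) (fun _ => β) γ =
      ((α - β) ^ (a * b) * ∏ k, (α - γ k) ^ c) *
        schur (rect b c) fun k => (γ k - β) / (α - γ k) := by
  have hw : ∀ k, α - γ k ≠ 0 := fun k => sub_ne_zero.2 (hγ k).symm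
  have hΓ : Function.Injective fun k => (γ k - β) / (α - γ k) := by
    intro k l h
    simp only [div_eq_div_iff (hw k) (hw l)] at h
    refine hinj (sub_eq_zero.1 ((mul_eq_zero.1 ?_).resolve_left hαβ))
    linear_combination h
  refine mul_left_cancel₀ (det_vandermonde_ne_zero_iff.2 hΓ) ?_
  have h1 := det_vandermonde_mul_sylvesterDet_const (c := c) α β γ _ hγ fun _ => rfl
  have h2 := det_vandermonde_mul_jacobiTrudi a b c fun k => (γ k - β) / (α - γ k)
  rw [value_phi, schur_rect]
  have h3 : ((-1 : ℂ) ^ (a * b + a * c)) * (-1) ^ (a * b + a * c) = 1 := by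
    rw [← mul_pow]; simp
  linear_combination (-1) ^ (a * b + a * c) * h1 -
    ((α - β) ^ (a * b) * ∏ k, (α - γ k) ^ c) * h2 + ((α - β) ^ (a * b) * ∏ k, (α - γ k) ^ c) *
    alternant a b c (fun k => (γ k - β) / (α - γ k)) * h3

/-- The generic case divides by the Vandermonde determinant of Γ. Moving γ_k to γ_k + tk and β to β
+ t makes the γ_k distinct and α ≠ β for all small t ≠ 0, and both sides are continuous at t = 0. -/
theorem value_phi_const {a b c : ℕ} (α β : ℂ) (γ Γ : Fin (a + b) → ℂ)
    (hγ : ∀ k, γ k ≠ α) (hΓ : ∀ k, Γ k = (γ k - β) / (α - γ k)) :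
    value (phi a b c) (fun _ => α) (fun _ => β) γ =
      ((α - β) ^ (a * b) * ∏ k, (α - γ k) ^ c) * schur (rect b c) Γ := by
  have hw : ∀ k, α - γ k ≠ 0 := fun k => sub_ne_zero.2 (hγ k).symm
  let δ : ℂ → Fin (a + b) → ℂ := fun t k => γ k + t * (k : ℕ)
  let f : ℂ → ℂ := fun t => value (phi a b c) (fun _ => α) (fun _ => β + t) (δ t)
  let g : ℂ → ℂ := fun t => ((α - (β + t)) ^ (a * b) * ∏ k, (α - δ t k) ^ c) *
    schur (rect b c) fun k => (δ t k - (β + t)) / (α - δ t k)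
  have hf : ContinuousAt f 0 := by
    have hp : Continuous fun t => point (c := c) (fun _ => α) (fun _ => β + t) (δ t) := by
      refine continuous_pi fun v => ?_
      cases v <;> simp only [point, δ] <;> fun_prop
    exact ((MvPolynomial.continuous_eval (phi a b c)).comp hp).continuousAt
  have hg : ContinuousAt g 0 := by
    have h1 : ContinuousAt (fun t k => (δ t k - (β + t)) / (α - δ t k)) 0 := by
      refine continuousAt_pi.2 fun k => ?_
      refine ContinuousAt.div (by simp only [δ]; fun_prop) (by simp only [δ]; fun_prop) ?_
      simpa [δ] using hw k
    have h2 : ContinuousAt (fun t => (α - (β + t)) ^ (a * b) * ∏ k, (α - δ t k) ^ c) 0 := by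
      simp only [δ]; fun_prop
    exact h2.mul (ContinuousAt.comp (g := fun x => schur (rect b c) x)
      (continuous_schur (rect b c)).continuousAt h1)
  have hev : f =ᶠ[𝓝[≠] 0] g := by
    have e1 : ∀ᶠ t in 𝓝[≠] (0 : ℂ), ∀ k, (α - γ k) + t * (-(k : ℕ)) ≠ 0 :=
      eventually_all.2 fun k => eventually_add_mul_ne_zero _ _ (Or.inl (hw k))
    have e2 : ∀ᶠ t in 𝓝[≠] (0 : ℂ), ∀ k l : Fin (a + b), k ≠ l →
        (γ k - γ l) + t * ((k : ℕ) - (l : ℕ) : ℂ) ≠ 0 := by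
      refine eventually_all.2 fun k => eventually_all.2 fun l => ?_
      by_cases hkl : k = l
      · exact Eventually.of_forall fun t h => absurd hkl h
      · refine (eventually_add_mul_ne_zero _ _ (Or.inr ?_)).mono fun t ht _ => ht
        rw [sub_ne_zero]
        exact fun h => hkl (Fin.ext (Nat.cast_injective h))
    have e3 := eventually_add_mul_ne_zero (α - β) (-1) (Or.inr (by simp))
    filter_upwards [e1, e2, e3] with t h1 h2 h3
    refine value_phi_const_of_injective α (β + t) (δ t) (fun k hk => h1 k ?_) ?_ ?_
    · rw [← hk]; simp only [δ]; ring
    · intro k l hkl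
      by_contra hne
      refine h2 k l hne ?_
      simp only [δ] at hkl
      linear_combination hkl
    · convert h3 using 1; ring
  have := tendsto_nhds_unique ((hf.tendsto.mono_left nhdsWithin_le_nhds).congr' hev)
    (hg.tendsto.mono_left nhdsWithin_le_nhds)
  have hδ : δ 0 = γ := by ext k; simp [δ]
  have hΓ' : Γ = fun k => (γ k - β) / (α - γ k) := funext hΓ
  simp only [f, g, hδ, add_zero] at this
  rw [this, hΓ']

end ThreeArch
end

/-! ### Euler operators and the characterization of rectangular Schur functions -/

noncomputable section

namespace ThreeArch

open Matrix

theorem map_jacobiTrudi {R S : Type*} [CommRing R] [CommRing S] (f : R →+* S) {c : ℕ} (x : ℕ → R)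
    (N : ℕ) (ν : Fin c → ℤ) : f (jacobiTrudi x N ν) = jacobiTrudi (f ∘ x) N ν := by
  have h : ∀ N n, f (elem x N n) = elem (f ∘ x) N n := by
    intro N
    induction N with
    | zero => intro n; simp only [elem]; split_ifs <;> simp
    | succ N ih => intro n; simp [elem, ih]
  rw [jacobiTrudi, RingHom.map_det, jacobiTrudi]
  congr 1
  ext i j
  simp [h]

section Euler

open MvPolynomial

variable {σ : Type*} {A : Type*} [CommRing A]

/-- The Euler derivation `x_k ∂/∂x_k`. -/
def euler (k : σ) : Derivation A (MvPolynomial σ A) (MvPolynomial σ A) := (X k : MvPolynomial σ A) • pderiv k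

theorem euler_apply (k : σ) (p : MvPolynomial σ A) : euler k p = X k * pderiv k p := rfl

theorem euler_monomial (k : σ) (m : σ →₀ ℕ) (r : A) :
    euler k (monomial m r) = (m k : A) • monomial m r := by
  rw [euler_apply, X_mul_pderiv_monomial, Nat.cast_smul_eq_nsmul]

theorem coeff_euler (k : σ) (p : MvPolynomial σ A) (m : σ →₀ ℕ) :
    (euler k p).coeff m = m k * p.coeff m := by
  classical
  induction p using MvPolynomial.induction_on' with
  | monomial n r =>
    rw [euler_monomial, coeff_smul, coeff_monomial, smul_eq_mul]
    split_ifs with h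
    · rw [h]
    · simp
  | add p q hp hq => rw [map_add, coeff_add, hp, hq, coeff_add, mul_add]

end Euler

section Alternant

open MvPolynomial

variable {N : ℕ}

theorem coeff_det_X_pow (m : Fin N → ℕ) (n : Fin N →₀ ℕ) :
    (of fun k j => (X k : MvPolynomial (Fin N) ℂ) ^ m j).det.coeff n =
      ∑ σ : Equiv.Perm (Fin N), if ∀ j, n (σ j) = m j then (((Equiv.Perm.sign σ : ℤˣ) : ℤ) : ℂ)
        else 0 := by
  rw [det_apply, coeff_sum]
  refine Finset.sum_congr rfl fun σ _ => ?_
  have h : ∏ i, (of fun k j => (X k : MvPolynomial (Fin N) ℂ) ^ m j) (σ i) i =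
      monomial (Finsupp.equivFunOnFinite.symm fun k => m (σ.symm k)) 1 := by
    rw [monomial_eq, Finsupp.prod_fintype _ _ fun i => by simp, map_one, one_mul]
    refine Eq.trans ?_ (Equiv.prod_comp σ _)
    simp
  rw [h, Units.smul_def, zsmul_eq_mul, ← map_intCast (C : ℂ →+* MvPolynomial (Fin N) ℂ), coeff_C_mul,
    coeff_monomial, mul_ite, mul_one, mul_zero]
  refine if_congr ?_ rfl rfl
  constructor
  · rintro rfl j; simp
  · intro hj
    ext k
    simp [← hj]

theorem exists_perm_of_coeff_det_ne_zero {m : Fin N → ℕ} {n : Fin N →₀ ℕ}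
    (h : (of fun k j => (X k : MvPolynomial (Fin N) ℂ) ^ m j).det.coeff n ≠ 0) :
    ∃ σ : Equiv.Perm (Fin N), ∀ j, n (σ j) = m j := by
  rw [coeff_det_X_pow] at h
  obtain ⟨σ, _, hσ⟩ := Finset.exists_ne_zero_of_sum_ne_zero h
  exact ⟨σ, by by_contra hc; exact hσ (if_neg hc)⟩

theorem coeff_det_X_pow_of_perm {m : Fin N → ℕ} (hm : Function.Injective m) {n : Fin N →₀ ℕ}
    (σ : Equiv.Perm (Fin N)) (h : ∀ j, n (σ j) = m j) :
    (of fun k j => (X k : MvPolynomial (Fin N) ℂ) ^ m j).det.coeff n =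
      ((Equiv.Perm.sign σ : ℤˣ) : ℤ) := by
  rw [coeff_det_X_pow, Finset.sum_eq_single σ, if_pos h]
  · intro τ _ hτ
    refine if_neg fun hτ' => hτ (Equiv.ext fun j => ?_)
    have : n (σ (σ.symm (τ j))) = m (σ.symm (τ j)) := h _
    rw [Equiv.apply_symm_apply, hτ'] at this
    rw [hm this, Equiv.apply_symm_apply, ← hm this]
  · simp

/-- The Vandermonde determinant in the variables. -/
def vdm (N : ℕ) : MvPolynomial (Fin N) ℂ := (vandermonde X).det

theorem eval_vdm (x : Fin N → ℂ) : eval x (vdm N) = (vandermonde x).det := by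
  rw [vdm, RingHom.map_det]
  congr 1
  ext i j; simp

/-- Monomials are eigenvectors of the Euler operators, with their exponents as eigenvalues, and
every monomial of the Vandermonde determinant has exponents a permutation of 0, …, N - 1. -/
theorem euler_vdm_sum : ∑ k, euler k (vdm N) = C (∑ i : Fin N, (i : ℂ)) * vdm N := by
  ext n
  rw [coeff_sum, coeff_C_mul]
  simp only [coeff_euler]
  rw [← Finset.sum_mul]
  by_cases h : (vdm N).coeff n = 0
  · rw [h, mul_zero, mul_zero]
  · obtain ⟨σ, hσ⟩ := exists_perm_of_coeff_det_ne_zero h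
    rw [← Equiv.sum_comp σ]
    simp only [hσ]

theorem euler_euler_vdm_sum :
    ∑ k, euler k (euler k (vdm N)) = C (∑ i : Fin N, (i : ℂ) ^ 2) * vdm N := by
  ext n
  rw [coeff_sum, coeff_C_mul]
  simp only [coeff_euler, ← mul_assoc]
  rw [← Finset.sum_mul]
  by_cases h : (vdm N).coeff n = 0
  · rw [h, mul_zero, mul_zero]
  · obtain ⟨σ, hσ⟩ := exists_perm_of_coeff_det_ne_zero h
    rw [← Equiv.sum_comp σ]
    simp only [hσ, sq]

theorem eval_euler_prod {ι : Type*} (k : Fin N) (x : Fin N → ℂ) (s : Finset ι)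
    (f : ι → MvPolynomial (Fin N) ℂ) (hf : ∀ i ∈ s, eval x (f i) ≠ 0) :
    eval x (euler k (∏ i ∈ s, f i)) =
      eval x (∏ i ∈ s, f i) * ∑ i ∈ s, eval x (euler k (f i)) / eval x (f i) := by
  classical
  induction s using Finset.induction_on with
  | empty => simp
  | insert i s hi ih =>
    rw [Finset.prod_insert hi, Derivation.leibniz, Finset.sum_insert hi]
    simp only [smul_eq_mul, map_add, map_mul]
    rw [ih fun j hj => hf j (Finset.mem_insert_of_mem hj)]
    have := hf i (Finset.mem_insert_self _ _)
    field_simp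
    ring

/-- Logarithmic derivative of the product formula: a pair contributes only if it contains k, and
both orders of the pair give the same expression x_k / (x_k - x_l). -/
theorem eval_euler_vdm (k : Fin N) (x : Fin N → ℂ) (hx : Function.Injective x) :
    eval x (euler k (vdm N)) =
      eval x (vdm N) * ∑ l ∈ Finset.univ.erase k, x k / (x k - x l) := by
  have h : vdm N = ∏ p ∈ Finset.univ.sigma fun i : Fin N => Finset.Ioi i,
      ((X p.2 : MvPolynomial (Fin N) ℂ) - X p.1) := by
    rw [vdm, det_vandermonde, Finset.prod_sigma]
  have hne : ∀ i j, i ≠ j → x i - x j ≠ 0 := fun i j hij => sub_ne_zero.2 fun h => hij (hx h)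
  have h2 := eval_euler_prod k x (Finset.univ.sigma fun i : Fin N => Finset.Ioi i)
    (fun p => (X p.2 : MvPolynomial (Fin N) ℂ) - X p.1) (by
      rintro ⟨i, j⟩ hp
      simp only [Finset.mem_sigma, Finset.mem_univ, Finset.mem_Ioi, true_and] at hp
      simpa using hne j i hp.ne')
  rw [← h] at h2
  rw [h2]
  congr 1
  rw [Finset.sum_sigma]
  have h3 : ∀ j : Fin N, eval x (euler k (X j : MvPolynomial (Fin N) ℂ)) =
      if j = k then x k else 0 := by
    intro j
    simp only [euler_apply, pderiv_X, Pi.single_apply, map_mul, eval_X]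
    split_ifs <;> simp_all
  simp only [h3, map_sub, eval_X, sub_div, Finset.sum_sub_distrib]
  have h4 : ∑ i : Fin N, ∑ j ∈ Finset.Ioi i, (if j = k then x k else 0) / (x j - x i) =
      ∑ i ∈ Finset.Iio k, x k / (x k - x i) := by
    have : ∀ i : Fin N, ∑ j ∈ Finset.Ioi i, (if j = k then x k else 0) / (x j - x i) =
        if i < k then x k / (x k - x i) else 0 := by
      intro i
      simp only [ite_div, zero_div, Finset.sum_ite_eq', Finset.mem_Ioi]
    rw [Finset.sum_congr rfl fun i _ => this i, ← Finset.sum_filter]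
    exact Finset.sum_congr (by ext; simp) fun _ _ => rfl
  have h5 : ∑ i : Fin N, ∑ j ∈ Finset.Ioi i, (if i = k then x k else 0) / (x j - x i) =
      - ∑ j ∈ Finset.Ioi k, x k / (x k - x j) := by
    rw [Finset.sum_eq_single k]
    · rw [← Finset.sum_neg_distrib]
      refine Finset.sum_congr rfl fun j _ => ?_
      rw [if_pos rfl, ← neg_sub (x k) (x j), div_neg]
    · intro i _ hik
      exact Finset.sum_eq_zero fun j _ => by rw [if_neg hik, zero_div]
    · simp
  rw [h4, h5, sub_neg_eq_add, ← Finset.sum_union]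
  · refine Finset.sum_congr ?_ fun _ _ => rfl
    ext l
    simp [lt_or_lt_iff_ne]
  · rw [Finset.disjoint_left]
    intro l h1 h2
    exact lt_asymm (Finset.mem_Iio.1 h1) (Finset.mem_Ioi.1 h2)

/-! ### Antisymmetric eigenfunctions -/

theorem rename_vdm (σ : Equiv.Perm (Fin N)) :
    rename σ (vdm N) = C (((Equiv.Perm.sign σ : ℤˣ) : ℤ) : ℂ) * vdm N := by
  have h := det_permute σ (vandermonde (X : Fin N → MvPolynomial (Fin N) ℂ))
  rw [map_intCast, vdm, ← h, AlgHom.map_det]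
  congr 1
  ext i j
  simp

theorem coeff_of_antisymmetric {P : MvPolynomial (Fin N) ℂ}
    (hP : ∀ σ : Equiv.Perm (Fin N), rename σ P = C (((Equiv.Perm.sign σ : ℤˣ) : ℤ) : ℂ) * P)
    (σ : Equiv.Perm (Fin N)) (n m : Fin N →₀ ℕ) (h : ∀ j, n (σ j) = m j) :
    P.coeff n = ((Equiv.Perm.sign σ : ℤˣ) : ℤ) * P.coeff m := by
  have hn : n = m.mapDomain σ := by
    ext k
    obtain ⟨j, rfl⟩ := σ.surjective k
    rw [Finsupp.mapDomain_apply σ.injective, h]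
  have h1 := coeff_rename_mapDomain σ σ.injective P m
  rw [hP, coeff_C_mul, ← hn] at h1
  have h2 : ((((Equiv.Perm.sign σ : ℤˣ) : ℤ) : ℂ)) * ((Equiv.Perm.sign σ : ℤˣ) : ℤ) = 1 := by
    rw [← Int.cast_mul, ← Units.val_mul, Int.units_mul_self]; simp
  linear_combination P.coeff n * (-h2) + (((Equiv.Perm.sign σ : ℤˣ) : ℤ) : ℂ) * h1

/-- The exponents `rectExp a b c` are determined by their sum and their sum of squares. -/
theorem exists_perm_eq_rectExp {a b c : ℕ} (n : Fin (a + b) → ℕ) (hn : Function.Injective n)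
    (hlt : ∀ k, n k < a + b + c) (h1 : ∑ k, (n k : ℤ) = ∑ k, (rectExp a b c k : ℤ))
    (h2 : ∑ k, (n k : ℤ) ^ 2 = ∑ k, (rectExp a b c k : ℤ) ^ 2) :
    ∃ σ : Equiv.Perm (Fin (a + b)), ∀ j, n (σ j) = rectExp a b c j := by
  set m := rectExp a b c with hm
  have hmi : Function.Injective m := (rectExp_strictMono a b c).injective
  let S := Finset.univ.image n
  let M := Finset.univ.image m
  -- A quadratic that is nonpositive on the gap a, …, a + c - 1 and, when c ≥ 1, positive at all
  -- other naturals. Its sum depends only on the number of exponents, their sum and their sum of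
  -- squares, so it agrees on `S` and `M`. Elements of `S \ M` lie in the gap and elements of `M \
  -- S` outside it, so both differences are empty.
  let h : ℕ → ℤ := fun y => ((y : ℤ) - a) * (y - (a + c - 1))
  have hS : ∑ y ∈ S, h y = ∑ y ∈ M, h y := by
    rw [Finset.sum_image fun i _ j _ e => hn e, Finset.sum_image fun i _ j _ e => hmi e]
    have e : ∀ y : ℕ, h y = (y : ℤ) ^ 2 - (2 * a + c - 1) * y + a * (a + c - 1) := by
      intro y; simp only [h]; ring
    simp only [e, Finset.sum_add_distrib, Finset.sum_sub_distrib, ← Finset.mul_sum, h1, h2]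
  have hcard : S.card = M.card := by
    rw [Finset.card_image_of_injective _ hn, Finset.card_image_of_injective _ hmi]
  have hM : ∀ y ∈ M, y < a ∨ a + c ≤ y := by
    intro y hy
    obtain ⟨j, _, rfl⟩ := Finset.mem_image.1 hy
    refine Fin.addCases (fun s => ?_) (fun r => ?_) j
    · left; simp [hm, rectExp]
    · right; simp [hm, rectExp]
  have hSM : ∀ y ∈ S \ M, a ≤ y ∧ y < a + c := by
    intro y hy
    obtain ⟨hyS, hyM⟩ := Finset.mem_sdiff.1 hy
    obtain ⟨k, _, rfl⟩ := Finset.mem_image.1 hyS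
    by_contra hc
    apply hyM
    rw [Finset.mem_image]
    have := hlt k
    by_cases hk : n k < a
    · exact ⟨Fin.castAdd b ⟨n k, hk⟩, Finset.mem_univ _, by rw [hm, rectExp, Fin.addCases_left]⟩
    · refine ⟨Fin.natAdd a ⟨n k - (a + c), by omega⟩, Finset.mem_univ _, ?_⟩
      rw [hm, rectExp, Fin.addCases_right]
      dsimp only
      omega
  have hMS : M ⊆ S := by
    by_contra hc
    have hne : (M \ S).Nonempty := Finset.sdiff_nonempty.2 hc
    have hcard2 : (S \ M).card = (M \ S).card := by
      have e1 := Finset.card_sdiff_add_card_inter S M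
      have e2 := Finset.card_sdiff_add_card_inter M S
      rw [Finset.inter_comm] at e2
      omega
    have hne2 : (S \ M).Nonempty := by
      rw [← Finset.card_pos, hcard2, Finset.card_pos]; exact hne
    obtain ⟨y0, hy0⟩ := hne2
    have hc1 : 1 ≤ c := by have := hSM y0 hy0; omega
    have e1 : ∑ y ∈ S \ M, h y = ∑ y ∈ M \ S, h y := by
      have f1 := Finset.sum_inter_add_sum_sdiff S M h
      have f2 := Finset.sum_inter_add_sum_sdiff M S h
      rw [Finset.inter_comm] at f2
      omega
    have e2 : ∑ y ∈ S \ M, h y ≤ 0 := by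
      refine Finset.sum_nonpos fun y hy => ?_
      have := hSM y hy
      exact mul_nonpos_of_nonneg_of_nonpos (by omega) (by omega)
    have e3 : 0 < ∑ y ∈ M \ S, h y := by
      refine Finset.sum_pos (fun y hy => ?_) hne
      rcases hM y (Finset.mem_sdiff.1 hy).1 with hlt | hge
      · exact mul_pos_of_neg_of_neg (by omega) (by omega)
      · exact mul_pos (by omega) (by omega)
    omega
  have hex : ∀ j, ∃ k, n k = m j := by
    intro j
    have := hMS (Finset.mem_image_of_mem m (Finset.mem_univ j))
    obtain ⟨k, _, hk⟩ := Finset.mem_image.1 this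
    exact ⟨k, hk⟩
  choose f hf using hex
  have hfi : Function.Injective f := fun i j e => hmi (by rw [← hf, ← hf, e])
  exact ⟨Equiv.ofBijective f (Finite.injective_iff_bijective.1 hfi), hf⟩

/-- The first and second order equations that characterize Schur functions of rectangular shape. -/
structure IsRectCharacter (a b c : ℕ) (χ : MvPolynomial (Fin (a + b)) ℂ) : Prop where
  symm : ∀ σ : Equiv.Perm (Fin (a + b)), rename σ χ = χ
  degree : ∀ n ∈ χ.support, ∀ k, n k ≤ c
  euler_sum : ∑ k, euler k χ = C ((b * c : ℕ) : ℂ) * χ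
  casimir : ∀ x : Fin (a + b) → ℂ, (∀ k, x k ≠ 0) → Function.Injective x →
    ∑ k, eval x (euler k (euler k χ)) +
      ∑ k, ∑ l ∈ Finset.univ.erase k, (x l + x k) / (x k - x l) * eval x (euler k χ) =
    ((b * c * (a + c) : ℕ) : ℂ) * eval x χ
  norm : eval (Fin.addCases (fun _ => 0) (fun _ => 1)) χ = 1

theorem sum_rectExp (a b c : ℕ) :
    ∑ k, (rectExp a b c k : ℂ) = ∑ i : Fin (a + b), (i : ℂ) + b * c := by
  rw [Fin.sum_univ_add, Fin.sum_univ_add]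
  simp [rectExp, Finset.sum_add_distrib]
  ring

theorem sum_rectExp_sq (a b c : ℕ) :
    ∑ k, (rectExp a b c k : ℂ) ^ 2 =
      ∑ i : Fin (a + b), (i : ℂ) ^ 2 + b * c * (a + c) + ((a + b : ℂ) - 1) * (b * c) := by
  have h : (∑ i : Fin b, (i : ℂ)) * 2 = b * (b - 1) := by
    rw [Fin.sum_univ_eq_sum_range (fun i => (i : ℂ)) b]
    clear a c
    induction b with
    | zero => simp
    | succ b ih => rw [Finset.sum_range_succ, add_mul, ih]; push_cast; ring
  rw [Fin.sum_univ_add, Fin.sum_univ_add]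
  simp only [rectExp, Fin.addCases_left, Fin.addCases_right, Fin.val_castAdd, Fin.val_natAdd,
    Nat.cast_add, add_sq, Finset.sum_add_distrib, ← Finset.mul_sum, Finset.sum_const,
    Finset.card_univ, Fintype.card_fin, nsmul_eq_mul]
  linear_combination (c : ℂ) * h

theorem IsRectCharacter.euler_vdm_mul {a b c : ℕ} {χ : MvPolynomial (Fin (a + b)) ℂ}
    (h : IsRectCharacter a b c χ) :
    ∑ k, euler k (vdm (a + b) * χ) =
      C (∑ k, (rectExp a b c k : ℂ)) * (vdm (a + b) * χ) := by
  simp only [Derivation.leibniz, Finset.sum_add_distrib, smul_eq_mul, ← Finset.mul_sum]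
  rw [h.euler_sum, euler_vdm_sum, sum_rectExp]
  simp only [map_add, map_mul, map_natCast, Nat.cast_mul]
  ring

/-- Conjugation by the Vandermonde determinant absorbs the first order terms of the Casimir
equation: the cross term of the second derivative of a product has coefficients 2 x_k / (x_k - x_l)
= (x_l + x_k) / (x_k - x_l) + 1. What is left is an operator diagonal on monomials. -/
theorem IsRectCharacter.euler_euler_vdm_mul {a b c : ℕ} {χ : MvPolynomial (Fin (a + b)) ℂ}
    (h : IsRectCharacter a b c χ) :
    ∑ k, euler k (euler k (vdm (a + b) * χ)) =
      C (∑ k, (rectExp a b c k : ℂ) ^ 2) * (vdm (a + b) * χ) := by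
  have hV : vdm (a + b) ≠ 0 := det_vandermonde_X_ne_zero _
  -- The extra Vandermonde factor makes the identity trivial at points with repeated coordinates,
  -- where the Casimir equation says nothing; coordinates equal to zero are avoided by testing on an
  -- infinite set.
  refine mul_right_cancel₀ hV ?_
  refine funext_set (fun _ => {0}ᶜ) (fun _ => ?_) fun x hx => ?_
  · exact (Set.finite_singleton (0 : ℂ)).infinite_compl
  rw [map_mul, map_mul]
  by_cases hinj : Function.Injective x
  swap
  · have : eval x (vdm (a + b)) = 0 := by
      rw [eval_vdm]
      by_contra hne
      exact hinj (det_vandermonde_ne_zero_iff.1 hne)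
    rw [this, mul_zero, mul_zero]
  congr 1
  have hpde := h.casimir x (fun k => hx k (Set.mem_univ k)) hinj
  have e1 : ∀ k, eval x (euler k (euler k (vdm (a + b) * χ))) =
      eval x (vdm (a + b)) * (eval x (euler k (euler k χ)) +
        ∑ l ∈ Finset.univ.erase k, (x l + x k) / (x k - x l) * eval x (euler k χ)) +
      eval x (vdm (a + b)) * ((a + b : ℂ) - 1) * eval x (euler k χ) +
      eval x (euler k (euler k (vdm (a + b)))) * eval x χ := by
    intro k
    have e2 : ∑ l ∈ Finset.univ.erase k, (x l + x k) / (x k - x l) =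
        2 * (∑ l ∈ Finset.univ.erase k, x k / (x k - x l)) - ((a + b : ℂ) - 1) := by
      rw [Finset.mul_sum, eq_sub_iff_add_eq, show ((a + b : ℂ) - 1) =
        ∑ l ∈ Finset.univ.erase k, 1 by
          rw [Finset.sum_const, Finset.card_erase_of_mem (Finset.mem_univ k), Finset.card_univ,
            Fintype.card_fin, nsmul_eq_mul, mul_one, Nat.cast_sub (by have := k.2; omega)]
          push_cast; ring, ← Finset.sum_add_distrib]
      refine Finset.sum_congr rfl fun l hl => ?_
      have hne : x k - x l ≠ 0 :=
        sub_ne_zero.2 fun e => (Finset.ne_of_mem_erase hl) (hinj e).symm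
      field_simp
      ring
    rw [← Finset.sum_mul, e2]
    have e3 := eval_euler_vdm k x hinj
    simp only [Derivation.leibniz, map_add, smul_eq_mul, map_mul]
    rw [e3]
    ring
  rw [map_sum, Finset.sum_congr rfl fun k _ => e1 k, Finset.sum_add_distrib,
    Finset.sum_add_distrib, ← Finset.mul_sum, ← Finset.mul_sum, ← Finset.sum_mul,
    Finset.sum_add_distrib, hpde, ← map_sum, ← map_sum, h.euler_sum, euler_euler_vdm_sum,
    sum_rectExp_sq]
  simp only [map_mul, eval_C]
  push_cast
  ring

/-- The product is antisymmetric, so its exponents are distinct within each monomial. They are below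
a + b + c, as the Vandermonde determinant contributes at most a + b - 1 and χ at most c, and the two
eigenvalue equations fix their sum and sum of squares. Hence they are a permutation of `rectExp`,
and antisymmetry leaves a single free coefficient. -/
theorem IsRectCharacter.vdm_mul_eq {a b c : ℕ} {χ : MvPolynomial (Fin (a + b)) ℂ}
    (h : IsRectCharacter a b c χ) :
    ∃ κ : ℂ, vdm (a + b) * χ = C κ * alternant a b c X := by
  set P := vdm (a + b) * χ with hPdef
  have hanti : ∀ σ : Equiv.Perm (Fin (a + b)),
      rename σ P = C (((Equiv.Perm.sign σ : ℤˣ) : ℤ) : ℂ) * P := by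
    intro σ
    rw [hPdef, map_mul, rename_vdm, h.symm, mul_assoc]
  have hperm : ∀ n, P.coeff n ≠ 0 →
      ∃ σ : Equiv.Perm (Fin (a + b)), ∀ j, n (σ j) = rectExp a b c j := by
    intro n hn
    refine exists_perm_eq_rectExp n (fun i j hij => ?_) (fun k => ?_) ?_ ?_
    · by_contra hne
      have := coeff_of_antisymmetric hanti (Equiv.swap i j) n n fun l => by
        rcases eq_or_ne l i with rfl | hi
        · rw [Equiv.swap_apply_left, hij]
        rcases eq_or_ne l j with rfl | hj
        · rw [Equiv.swap_apply_right, hij]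
        rw [Equiv.swap_apply_of_ne_of_ne hi hj]
      rw [Equiv.Perm.sign_swap hne] at this
      push_cast at this
      apply hn
      linear_combination this / 2
    · rw [hPdef, coeff_mul] at hn
      obtain ⟨⟨u, v⟩, huv, hne⟩ := Finset.exists_ne_zero_of_sum_ne_zero hn
      rw [Finset.HasAntidiagonal.mem_antidiagonal] at huv
      obtain ⟨σ, hσ⟩ := exists_perm_of_coeff_det_ne_zero (left_ne_zero_of_mul hne)
      have h1 : u (σ (σ.symm k)) = (σ.symm k : ℕ) := hσ (σ.symm k)
      rw [Equiv.apply_symm_apply] at h1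
      have h2 := h.degree v (mem_support_iff.2 (right_ne_zero_of_mul hne)) k
      have h3 := (σ.symm k).2
      have h4 : u k + v k = n k := by rw [← huv]; rfl
      omega
    · have h1 := congrArg (coeff n) h.euler_vdm_mul
      rw [coeff_sum, coeff_C_mul] at h1
      simp only [coeff_euler] at h1
      rw [← Finset.sum_mul] at h1
      have := mul_right_cancel₀ hn h1
      exact_mod_cast this
    · have h1 := congrArg (coeff n) h.euler_euler_vdm_mul
      rw [coeff_sum, coeff_C_mul] at h1
      simp only [coeff_euler, ← mul_assoc, ← sq] at h1
      rw [← Finset.sum_mul] at h1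
      have := mul_right_cancel₀ hn h1
      exact_mod_cast this
  refine ⟨P.coeff (Finsupp.equivFunOnFinite.symm (rectExp a b c)), ?_⟩
  ext n
  rw [coeff_C_mul, alternant]
  by_cases hex : ∃ σ : Equiv.Perm (Fin (a + b)), ∀ j, n (σ j) = rectExp a b c j
  · obtain ⟨σ, hσ⟩ := hex
    rw [coeff_det_X_pow_of_perm (rectExp_strictMono a b c).injective σ hσ,
      coeff_of_antisymmetric hanti σ n (Finsupp.equivFunOnFinite.symm (rectExp a b c)) (by simpa),
      mul_comm]
  · have h1 : P.coeff n = 0 := by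
      by_contra hne
      exact hex (hperm n hne)
    have h2 : (of fun k j => (X k : MvPolynomial (Fin (a + b)) ℂ) ^ rectExp a b c j).det.coeff n
        = 0 := by
      by_contra hne
      exact hex (exists_perm_of_coeff_det_ne_zero hne)
    rw [h1, h2, mul_zero]

end Alternant

theorem elem_zero_one (a r : ℕ) (x : ℕ → ℂ) (h0 : ∀ i < a, x i = 0)
    (h1 : ∀ i, a ≤ i → i < a + r → x i = 1) (n : ℤ) :
    ((r : ℤ) < n → elem x (a + r) n = 0) ∧ elem x (a + r) r = 1 := by
  induction r generalizing n with
  | zero =>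
    have key : ∀ N ≤ a, ∀ n, elem x N n = if n = 0 then 1 else 0 := by
      intro N hN
      induction N with
      | zero => intro n; rfl
      | succ N ih => intro n; rw [elem, ih (by omega), h0 N (by omega)]; simp
    rw [add_zero, key a le_rfl, key a le_rfl]
    refine ⟨fun hn => if_neg (by push_cast at hn; omega), by simp⟩
  | succ r ih =>
    have ih' := ih fun i hi hi' => h1 i hi (by omega)
    rw [← add_assoc, elem, elem, h1 (a + r) (by omega) (by omega)]
    refine ⟨fun hn => ?_, ?_⟩
    · push_cast at hn
      rw [(ih' n).1 (by omega), (ih' (n - 1)).1 (by omega)]; simp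
    · push_cast
      rw [(ih' (r + 1)).1 (by omega), add_sub_cancel_right, (ih' 0).2]; simp

/-- With b variables equal to 1 and the others 0, e_b = 1 and e_n = 0 for n > b, so the matrix is
lower unitriangular. -/
theorem jacobiTrudi_zero_one (a b c : ℕ) :
    jacobiTrudi (extend (Fin.addCases (fun _ => 0) fun _ => 1 : Fin (a + b) → ℂ)) (a + b)
      (fun _ : Fin c => (b : ℤ)) = 1 := by
  have h := elem_zero_one a b (extend (Fin.addCases (fun _ => 0) fun _ => 1 : Fin (a + b) → ℂ))
    (fun i hi => by
      have := extend_apply (Fin.addCases (fun _ => 0) fun _ => 1 : Fin (a + b) → ℂ)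
        (Fin.castAdd b ⟨i, hi⟩)
      rwa [Fin.addCases_left] at this)
    (fun i hi hi' => by
      have := extend_apply (Fin.addCases (fun _ => 0) fun _ => 1 : Fin (a + b) → ℂ)
        (Fin.natAdd a ⟨i - a, by omega⟩)
      rwa [Fin.addCases_right, Fin.val_natAdd, Nat.add_sub_cancel' hi] at this)
  rw [jacobiTrudi, det_of_isLowerTriangular]
  · refine Finset.prod_eq_one fun i _ => ?_
    rw [of_apply, sub_add_cancel]
    exact (h 0).2
  · intro i j hij
    have : (i : ℕ) < j := hij
    rw [of_apply]
    exact (h _).1 (by omega)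

/-- A polynomial with the characteristic properties is the Schur function. -/
theorem IsRectCharacter.eval_eq_schur {a b c : ℕ} {χ : MvPolynomial (Fin (a + b)) ℂ}
    (h : IsRectCharacter a b c χ) (x : Fin (a + b) → ℂ) :
    MvPolynomial.eval x χ = schur (rect b c) x := by
  obtain ⟨κ, hκ⟩ := h.vdm_mul_eq
  rw [← det_vandermonde_mul_jacobiTrudi, mul_left_comm] at hκ
  have h1 := mul_left_cancel₀ (det_vandermonde_X_ne_zero (a + b)) hκ
  have hev : ∀ x : Fin (a + b) → ℂ, MvPolynomial.eval x χ =
      κ * jacobiTrudi (extend x) (a + b) fun _ : Fin c => (b : ℤ) := by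
    intro x
    rw [h1, map_mul, MvPolynomial.eval_C, map_jacobiTrudi]
    congr 2
    funext n
    simp only [extend, Function.comp]
    split_ifs <;> simp
  -- The normalization is imposed at the point (0, …, 0, 1, …, 1), where the Jacobi–Trudi
  -- determinant is 1; this determines the constant `κ`.
  have h2 := h.norm
  rw [hev, jacobiTrudi_zero_one, mul_one] at h2
  rw [hev, h2, one_mul, schur_rect]

end ThreeArch
end

/-! ### Derivations of determinants and adjugates -/

noncomputable section

namespace ThreeArch

open Matrix

section Derivation

variable {R T : Type*} [CommRing R] [CommRing T] [Algebra R T] {n : Type*} [Fintype n]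
  [DecidableEq n]

theorem derivation_prod (D : Derivation R T T) {ι : Type*} [DecidableEq ι] (s : Finset ι)
    (f : ι → T) : D (∏ i ∈ s, f i) = ∑ i ∈ s, (∏ j ∈ s.erase i, f j) * D (f i) := by
  induction s using Finset.induction_on with
  | empty => simp
  | insert i s hi ih =>
    rw [Finset.prod_insert hi, Derivation.leibniz, ih, Finset.sum_insert hi,
      Finset.erase_insert hi, smul_eq_mul, smul_eq_mul, add_comm, Finset.mul_sum]
    congr 1
    refine Finset.sum_congr rfl fun j hj => ?_
    have hij : i ≠ j := fun h => hi (h ▸ hj)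
    rw [Finset.erase_insert_of_ne hij, Finset.prod_insert, mul_assoc]
    exact fun h => hi (Finset.mem_of_mem_erase h)

/-- Jacobi's formula. -/
theorem derivation_det (D : Derivation R T T) (M : Matrix n n T) :
    D M.det = (M.adjugate * M.map D).trace := by
  have h2 : (M.adjugate * M.map D).trace = ∑ i, (M.updateCol i fun j => D (M j i)).det := by
    refine Finset.sum_congr rfl fun i _ => ?_
    rw [← cramer_apply, cramer_eq_adjugate_mulVec]
    rfl
  rw [h2, det_apply, map_sum]
  simp only [det_apply]
  rw [Finset.sum_comm]
  refine Finset.sum_congr rfl fun σ _ => ?_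
  rw [Units.smul_def, map_zsmul, derivation_prod, Finset.smul_sum]
  refine Finset.sum_congr rfl fun i _ => ?_
  rw [← Finset.prod_erase_mul _ _ (Finset.mem_univ i), updateCol_self]
  congr 2
  exact Finset.prod_congr rfl fun k hk => (updateCol_ne (Finset.ne_of_mem_erase hk)).symm

/-- The derivative of the inverse with denominators cleared: differentiate M · adj M = det M · 1 and
multiply by adj M from the left. -/
theorem det_smul_derivation_adjugate (D : Derivation R T T) (M : Matrix n n T) :
    M.det • M.adjugate.map D = D M.det • M.adjugate - M.adjugate * M.map D * M.adjugate := by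
  have hmul : ∀ A B : Matrix n n T, (A * B).map D = A.map D * B + A * B.map D := by
    intro A B
    ext i j
    simp only [map_apply, Matrix.add_apply, Matrix.mul_apply, map_sum, Derivation.leibniz, smul_eq_mul,
      Finset.sum_add_distrib]
    rw [add_comm]
    congr 1
    exact Finset.sum_congr rfl fun k _ => mul_comm _ _
  have h := congrArg (fun A : Matrix n n T => A.map D) (mul_adjugate M)
  rw [hmul] at h
  have h2 : (M.det • (1 : Matrix n n T)).map D = D M.det • 1 := by
    ext i j
    by_cases hij : i = j
    · subst hij; simp
    · simp [hij]
  rw [h2] at h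
  have h3 := congrArg (fun A => M.adjugate * A) h
  simp only [mul_add, ← mul_assoc, adjugate_mul, smul_mul, one_mul, Matrix.mul_smul, mul_one] at h3
  rw [← h3]
  simp [mul_assoc]

end Derivation

/-! ### Haar integration -/

/-- The chain rule in the form that connects algebra and analysis: a curve that is tangent at s to a
polynomial vector field on the coordinates is tangent to it on all polynomials. The algebra `A` is
later both ℂ and the continuous functions on U(c). -/
theorem hasDerivAt_aeval {σ A : Type*} [NormedCommRing A] [NormedAlgebra ℂ A]
    (D : Derivation ℂ (MvPolynomial σ ℂ) (MvPolynomial σ ℂ)) (g : σ → ℝ → A) (s : ℝ)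
    (hg : ∀ i, HasDerivAt (g i) (MvPolynomial.aeval (fun j => g j s) (D (MvPolynomial.X i))) s)
    (p : MvPolynomial σ ℂ) :
    HasDerivAt (fun t => MvPolynomial.aeval (fun i => g i t) p)
      (MvPolynomial.aeval (fun i => g i s) (D p)) s := by
  induction p using MvPolynomial.induction_on with
  | C r =>
    have : D (MvPolynomial.C r) = 0 := D.map_algebraMap r
    simpa [this] using hasDerivAt_const s (algebraMap ℂ A r)
  | add p q hp hq => simpa using hp.fun_add hq
  | mul_X p i hp =>
    have h := hp.fun_mul (hg i)
    simp only [map_mul, MvPolynomial.aeval_X, Derivation.leibniz, smul_eq_mul, map_add]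
    convert h using 1
    ring

section Haar

variable {c : ℕ}

instance : MeasureTheory.IsProbabilityMeasure (unitaryHaar c) :=
  ⟨MeasureTheory.Measure.haarMeasure_self (K₀ := ⊤)⟩

instance : (unitaryHaar c).IsMulLeftInvariant := by
  unfold unitaryHaar; infer_instance

theorem exp_mem_unitaryGroup (Z : Matrix (Fin c) (Fin c) ℂ) (hZ : star Z = -Z) :
    NormedSpace.exp Z ∈ Matrix.unitaryGroup (Fin c) ℂ := by
  rw [mem_unitaryGroup_iff, star_eq_conjTranspose, ← Matrix.exp_conjTranspose,
    ← star_eq_conjTranspose, hZ, ← Matrix.exp_add_of_commute _ _ (Commute.refl Z).neg_right,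
    add_neg_cancel, NormedSpace.exp_zero]

open scoped Matrix.Norms.Operator in
theorem exists_unitary_curve (Z : Matrix (Fin c) (Fin c) ℂ) (hZ : star Z = -Z) :
    ∃ g : ℝ → U c, g 0 = 1 ∧
      ∀ i j, HasDerivAt (fun s => (g s : Matrix (Fin c) (Fin c) ℂ) i j) (Z i j) 0 := by
  refine ⟨fun s => ⟨NormedSpace.exp (s • Z), exp_mem_unitaryGroup _ ?_⟩,
    ?_, fun i j => ?_⟩
  · rw [star_smul, hZ, smul_neg]; simp
  · apply Subtype.ext
    simp
  · have h := hasDerivAt_exp_smul_const' (𝕂 := ℝ) Z 0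
    have h2 := ((Matrix.entryLinearMap ℝ ℂ i j).toContinuousLinearMap).hasFDerivAt.comp_hasDerivAt 0 h
    rw [zero_smul, NormedSpace.exp_zero, mul_one] at h2
    exact h2

/-- The matrix entries as continuous functions on `U(c)`. -/
def entry (ij : Fin c × Fin c) : C(U c, ℂ) :=
  ⟨fun Ω => (Ω : Matrix (Fin c) (Fin c) ℂ) ij.1 ij.2,
    (continuous_subtype_val.matrix_elem _ _)⟩

/-- The function `Ω ↦ (det Ω⁻¹)^b` on `U(c)`. -/
def invDetPow (b : ℕ) : C(U c, ℂ) :=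
  ⟨fun Ω => Matrix.det ((Ω⁻¹ : U c) : Matrix (Fin c) (Fin c) ℂ) ^ b,
    ((continuous_subtype_val.comp continuous_inv).matrix_det).pow b⟩

/-- Integration against `(det Ω⁻¹)^b`. -/
def haarFunctional (b : ℕ) : C(U c, ℂ) →L[ℂ] ℂ :=
  LinearMap.mkContinuous
    { toFun := fun f => ∫ Ω, f Ω * invDetPow b Ω ∂unitaryHaar c
      map_add' := fun f g => by
        simp only [ContinuousMap.add_apply, add_mul]
        exact MeasureTheory.integral_add
          (((f * invDetPow b).continuous).integrable_of_hasCompactSupport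
            (HasCompactSupport.of_compactSpace _))
          (((g * invDetPow b).continuous).integrable_of_hasCompactSupport
            (HasCompactSupport.of_compactSpace _))
      map_smul' := fun r f => by
        simp only [ContinuousMap.smul_apply, smul_eq_mul, mul_assoc, RingHom.id_apply]
        exact MeasureTheory.integral_const_mul r _ } ‖(invDetPow b : C(U c, ℂ))‖ (fun f => by
      have h : ∀ Ω, ‖f Ω * invDetPow b Ω‖ ≤ ‖(invDetPow b : C(U c, ℂ))‖ * ‖f‖ := fun Ω => by
        rw [norm_mul, mul_comm]
        gcongr
        · exact ContinuousMap.norm_coe_le_norm _ _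
        · exact ContinuousMap.norm_coe_le_norm _ _
      have := MeasureTheory.norm_integral_le_of_norm_le_const (μ := unitaryHaar c)
        (Filter.Eventually.of_forall h)
      simpa using this)

theorem haarFunctional_apply (b : ℕ) (f : C(U c, ℂ)) :
    haarFunctional b f = ∫ Ω, f Ω * invDetPow b Ω ∂unitaryHaar c := rfl

theorem aeval_entry_apply (p : MvPolynomial (Fin c × Fin c) ℂ) (g : Fin c × Fin c → C(U c, ℂ))
    (Ω : U c) : MvPolynomial.aeval g p Ω = MvPolynomial.eval (fun ij => g ij Ω) p := by
  induction p using MvPolynomial.induction_on with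
  | C r => simp [Algebra.algebraMap_eq_smul_one]
  | add p q hp hq => simp [hp, hq]
  | mul_X p i hp => simp [hp]

/-- The integral of a polynomial in the matrix entries against `(det Ω⁻¹)^b`. -/
def haarCoeff (b : ℕ) : MvPolynomial (Fin c × Fin c) ℂ →ₗ[ℂ] ℂ :=
  (haarFunctional b).toLinearMap ∘ₗ (MvPolynomial.aeval entry).toLinearMap

theorem haarCoeff_apply (b : ℕ) (p : MvPolynomial (Fin c × Fin c) ℂ) :
    haarCoeff b p = ∫ Ω : U c, MvPolynomial.eval
      (fun ij => (Ω : Matrix (Fin c) (Fin c) ℂ) ij.1 ij.2) p *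
        Matrix.det ((Ω⁻¹ : U c) : Matrix (Fin c) (Fin c) ℂ) ^ b ∂unitaryHaar c := by
  change haarFunctional b (MvPolynomial.aeval entry p) = _
  rw [haarFunctional_apply]
  simp only [aeval_entry_apply]
  rfl

/-- The derivation of the ring of polynomials in the entries of the generic matrix `X` with
`X ↦ Z X`. -/
def lieDeriv (Z : Matrix (Fin c) (Fin c) ℂ) :
    Derivation ℂ (MvPolynomial (Fin c × Fin c) ℂ) (MvPolynomial (Fin c × Fin c) ℂ) :=
  MvPolynomial.mkDerivation ℂ fun ij => ∑ k, MvPolynomial.C (Z ij.1 k) * MvPolynomial.X (k, ij.2)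

theorem lieDeriv_X (Z : Matrix (Fin c) (Fin c) ℂ) (ij : Fin c × Fin c) :
    lieDeriv Z (MvPolynomial.X ij) =
      ∑ k, MvPolynomial.C (Z ij.1 k) * MvPolynomial.X (k, ij.2) :=
  MvPolynomial.mkDerivation_X _ _ _

/-- The generic matrix. -/
def genMat (c : ℕ) : Matrix (Fin c) (Fin c) (MvPolynomial (Fin c × Fin c) ℂ) :=
  of fun i j => MvPolynomial.X (i, j)

theorem map_lieDeriv_genMat (Z : Matrix (Fin c) (Fin c) ℂ) :
    (genMat c).map (lieDeriv Z) = Z.map MvPolynomial.C * genMat c := by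
  ext1 i j
  simp [genMat, lieDeriv_X, Matrix.mul_apply]

theorem lieDeriv_add (Z W : Matrix (Fin c) (Fin c) ℂ) :
    lieDeriv (Z + W) = lieDeriv Z + lieDeriv W := by
  apply MvPolynomial.derivation_ext
  intro i
  simp [lieDeriv_X, add_mul, Finset.sum_add_distrib]

theorem lieDeriv_smul (r : ℂ) (Z : Matrix (Fin c) (Fin c) ℂ) :
    lieDeriv (r • Z) = r • lieDeriv Z := by
  apply MvPolynomial.derivation_ext
  intro i
  simp [lieDeriv_X, Finset.smul_sum, MvPolynomial.smul_eq_C_mul, mul_assoc]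

/-- Left invariance of the Haar measure, together with det(MΩ)⁻¹ = det M⁻¹ det Ω⁻¹ in the weight. -/
theorem haarFunctional_translate (b : ℕ) (M : U c) (f f' : C(U c, ℂ))
    (h : ∀ Ω, f' Ω = f (M * Ω)) :
    haarFunctional b f' = (M : Matrix (Fin c) (Fin c) ℂ).det ^ b * haarFunctional b f := by
  rw [haarFunctional_apply, haarFunctional_apply,
    ← MeasureTheory.integral_mul_left_eq_self (fun Ω => f Ω * invDetPow b Ω) M,
    ← MeasureTheory.integral_const_mul]
  congr 1
  funext Ω
  rw [h]
  have h1 : (M : Matrix (Fin c) (Fin c) ℂ).det *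
      Matrix.det ((M⁻¹ : U c) : Matrix (Fin c) (Fin c) ℂ) = 1 := by
    rw [← Matrix.det_mul, ← Matrix.UnitaryGroup.mul_val, mul_inv_cancel]; simp
  have h2 : invDetPow b Ω = (M : Matrix (Fin c) (Fin c) ℂ).det ^ b * invDetPow b (M * Ω) := by
    simp only [invDetPow, ContinuousMap.coe_mk]
    rw [_root_.mul_inv_rev, Matrix.UnitaryGroup.mul_val, Matrix.det_mul, ← mul_pow, mul_left_comm,
      h1, mul_one]
  rw [h2]
  ring

/-- Integration by parts. Translation by a unitary curve through 1 with velocity Z multiplies the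
integral by det^b along the curve; comparing derivatives at 0 gives the factor b tr Z. -/
theorem haarCoeff_lieDeriv_of_skew (b : ℕ) (Z : Matrix (Fin c) (Fin c) ℂ) (hZ : star Z = -Z)
    (p : MvPolynomial (Fin c × Fin c) ℂ) :
    haarCoeff b (lieDeriv Z p) = b * Z.trace * haarCoeff b p := by
  obtain ⟨g, hg0, hg⟩ := exists_unitary_curve Z hZ
  let G : Fin c × Fin c → ℝ → C(U c, ℂ) := fun ij s =>
    ∑ k, (g s : Matrix (Fin c) (Fin c) ℂ) ij.1 k • entry (k, ij.2)
  have hG0 : (fun ij => G ij 0) = entry := by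
    funext ij
    simp [G, hg0, Matrix.one_apply]
  have hG : ∀ ij, HasDerivAt (G ij)
      (MvPolynomial.aeval (fun j => G j 0) (lieDeriv Z (MvPolynomial.X ij))) 0 := by
    intro ij
    rw [hG0, lieDeriv_X]
    simp only [map_sum, map_mul, MvPolynomial.aeval_X, MvPolynomial.algHom_C,
      Algebra.algebraMap_eq_smul_one, smul_mul_assoc, one_mul]
    exact HasDerivAt.fun_sum fun k _ => (hg _ _).smul_const _
  -- Differentiation under the integral is immediate here, since the integral is a continuous linear
  -- functional on C(U(c)) and the curve is differentiable in that space.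
  have h1 := ((haarFunctional (c := c) b).restrictScalars ℝ).hasFDerivAt.comp_hasDerivAt 0
    (hasDerivAt_aeval (lieDeriv Z) G 0 hG p)
  have h2 : ∀ s, haarFunctional b (MvPolynomial.aeval (fun ij => G ij s) p) =
      (g s : Matrix (Fin c) (Fin c) ℂ).det ^ b * haarCoeff b p := by
    intro s
    refine haarFunctional_translate b (g s) (MvPolynomial.aeval entry p) _ fun Ω => ?_
    rw [aeval_entry_apply, aeval_entry_apply]
    congr 2
    funext ij
    simp [G, entry, Matrix.mul_apply]
  have h3 := hasDerivAt_aeval (A := ℂ) (lieDeriv Z)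
    (fun ij s => (g s : Matrix (Fin c) (Fin c) ℂ) ij.1 ij.2) 0 (fun ij => by
      rw [lieDeriv_X]
      simpa [hg0, Matrix.one_apply] using hg ij.1 ij.2) ((genMat c).det ^ b)
  have hdet : ∀ M : Matrix (Fin c) (Fin c) ℂ,
      MvPolynomial.aeval (fun ij : Fin c × Fin c => M ij.1 ij.2) (genMat c).det = M.det := by
    intro M
    rw [AlgHom.map_det]
    congr 1
    ext i j
    simp [genMat]
  have h4 : lieDeriv Z (genMat c).det = MvPolynomial.C Z.trace * (genMat c).det := by
    rw [derivation_det, map_lieDeriv_genMat, ← mul_assoc, trace_mul_comm, ← mul_assoc,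
      mul_adjugate]
    simp [Matrix.trace, mul_comm, Finset.mul_sum]
  rw [Derivation.leibniz_pow, h4] at h3
  simp only [map_pow, hdet, smul_eq_mul, map_mul, nsmul_eq_mul, map_natCast,
    MvPolynomial.algHom_C, hg0, Matrix.UnitaryGroup.one_val, det_one, one_pow, mul_one, one_mul] at h3
  have h5 := h3.mul_const (haarCoeff b p)
  have h6 := (h1.congr_of_eventuallyEq (f₁ := fun s => _) (Filter.Eventually.of_forall fun s => (h2 s).symm)).unique h5
  simp only [hG0] at h6
  exact h6

/-- Both sides are complex linear in Z, and every matrix is a complex combination of two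
skew-Hermitian ones. This complexification makes the elementary matrices available. -/
theorem haarCoeff_lieDeriv (b : ℕ) (Z : Matrix (Fin c) (Fin c) ℂ)
    (p : MvPolynomial (Fin c × Fin c) ℂ) :
    haarCoeff b (lieDeriv Z p) = b * Z.trace * haarCoeff b p := by
  have hA := haarCoeff_lieDeriv_of_skew b ((1 / 2 : ℂ) • (Z - star Z)) (by
    rw [star_smul, star_sub, star_star, ← smul_neg, neg_sub]; simp) p
  have hB := haarCoeff_lieDeriv_of_skew b ((-Complex.I / 2 : ℂ) • (Z + star Z)) (by
    rw [star_smul, star_add, star_star, ← neg_smul, add_comm]; simp [neg_div]) p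
  have hZ : Z = (1 / 2 : ℂ) • (Z - star Z) + Complex.I • ((-Complex.I / 2 : ℂ) • (Z + star Z)) := by
    rw [smul_smul, show Complex.I * (-Complex.I / 2) = 1 / 2 by
      rw [mul_div_assoc', mul_neg, Complex.I_mul_I, neg_neg], ← smul_add, sub_add_add_cancel, ← two_smul ℂ Z, smul_smul]
    norm_num
  conv_lhs => rw [hZ]
  conv_rhs => rw [hZ]
  rw [lieDeriv_add, lieDeriv_smul Complex.I, Derivation.add_apply, Derivation.smul_apply, map_add,
    map_smul, hA, hB, trace_add, trace_smul Complex.I, smul_eq_mul, smul_eq_mul]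
  ring

end Haar

end ThreeArch
end

/-! ### Differential equations for the unitary integral -/

noncomputable section

namespace ThreeArch

open Matrix

section Resolvent

variable {T : Type*} [CommRing T] {n : Type*} [Fintype n] [DecidableEq n]

/-- The matrix `det(1 + tX) · tX(1 + tX)⁻¹`. -/
def resolvent (X : Matrix n n T) (t : T) : Matrix n n T :=
  (1 + t • X).det • 1 - (1 + t • X).adjugate

theorem adjugate_eq_sub_resolvent (X : Matrix n n T) (t : T) :
    (1 + t • X).adjugate = (1 + t • X).det • 1 - resolvent X t := by
  rw [resolvent, sub_sub_cancel]

theorem smul_mul_adjugate_eq_resolvent (X : Matrix n n T) (t : T) :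
    t • X * (1 + t • X).adjugate = resolvent X t := by
  rw [resolvent, ← mul_adjugate, add_mul, one_mul, add_sub_cancel_left]

theorem adjugate_mul_smul_eq_resolvent (X : Matrix n n T) (t : T) :
    (1 + t • X).adjugate * t • X = resolvent X t := by
  rw [resolvent, ← adjugate_mul, mul_add, mul_one, add_sub_cancel_left]

/-- The resolvent identity: for r_t = tX(1 + tX)⁻¹ partial fractions give (t - s) r_s r_t = t r_s -
s r_t, and the determinants clear the denominators. -/
theorem resolvent_mul_resolvent (X : Matrix n n T) (s t : T) :
    (t - s) • (resolvent X s * resolvent X t) =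
      (t * (1 + t • X).det) • resolvent X s - (s * (1 + s • X).det) • resolvent X t := by
  have h1 : (t * (1 + t • X).det) • resolvent X s =
      t • (resolvent X s * ((1 + t • X) * (1 + t • X).adjugate)) := by
    rw [mul_adjugate, Matrix.mul_smul, mul_one, smul_smul]
  have h2 : (s * (1 + s • X).det) • resolvent X t =
      s • ((1 + s • X).adjugate * (1 + s • X) * resolvent X t) := by
    rw [adjugate_mul, Matrix.smul_mul, one_mul, smul_smul]
  rw [h1, h2, ← adjugate_mul_smul_eq_resolvent X s, ← smul_mul_adjugate_eq_resolvent X t]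
  simp only [mul_add, add_mul, mul_one, one_mul, Matrix.mul_smul, Matrix.smul_mul, smul_add,
    smul_smul, ← mul_assoc]
  module

theorem det_smul_derivation_resolvent {R : Type*} [CommRing R] [Algebra R T]
    (D : Derivation R T T) (X : Matrix n n T) (t : T) :
    (1 + t • X).det • (resolvent X t).map D = D (1 + t • X).det • resolvent X t +
      (1 + t • X).adjugate * (1 + t • X).map D * (1 + t • X).adjugate := by
  have h : (resolvent X t).map D = D (1 + t • X).det • 1 - (1 + t • X).adjugate.map D := by
    ext i j
    by_cases hij : i = j
    · subst hij; simp [resolvent]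
    · simp [resolvent, hij]
  rw [h, smul_sub, det_smul_derivation_adjugate, resolvent]
  module

end Resolvent

section CoeffMap

open MvPolynomial

variable {σ : Type*} {c : ℕ}

theorem coeff_map_linear {S : Type*} [CommRing S] (L : S →+ ℂ) (p : MvPolynomial σ S)
    (m : σ →₀ ℕ) : coeff m (AddMonoidAlgebra.map L p : MvPolynomial σ ℂ) = L (coeff m p) := rfl

/-- Euler operators in t multiply coefficients by natural numbers and hence commute with any linear
functional applied to the coefficients. In particular they pass under the Haar integral. -/
theorem euler_map_linear {S : Type*} [CommRing S] [Algebra ℂ S] (L : S →ₗ[ℂ] ℂ) (k : σ)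
    (p : MvPolynomial σ S) :
    euler k (AddMonoidAlgebra.map L.toAddMonoidHom p : MvPolynomial σ ℂ) =
      AddMonoidAlgebra.map L.toAddMonoidHom (euler k p) := by
  ext m
  rw [coeff_euler, coeff_map_linear, coeff_map_linear, coeff_euler, ← nsmul_eq_mul,
    ← nsmul_eq_mul, map_nsmul]

theorem eval_map_linear {S : Type*} [CommRing S] [Algebra ℂ S] (L : S →ₗ[ℂ] ℂ) (x : σ → ℂ)
    (p : MvPolynomial σ S) :
    eval x (AddMonoidAlgebra.map L.toAddMonoidHom p : MvPolynomial σ ℂ) =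
      L (eval (fun k => algebraMap ℂ S (x k)) p) := by
  induction p using MvPolynomial.induction_on' with
  | monomial m s =>
    have : (AddMonoidAlgebra.map L.toAddMonoidHom (monomial m s) : MvPolynomial σ ℂ) =
        monomial m (L s) := by
      classical
      ext m'
      rw [coeff_map_linear, coeff_monomial, coeff_monomial]
      split_ifs <;> simp
    rw [this, eval_monomial, eval_monomial]
    simp only [← map_pow, Finsupp.prod, ← map_prod]
    rw [mul_comm s, ← Algebra.smul_def, map_smul, smul_eq_mul, mul_comm]
  | add p q hp hq =>
    have : (AddMonoidAlgebra.map L.toAddMonoidHom (p + q) : MvPolynomial σ ℂ) =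
        AddMonoidAlgebra.map L.toAddMonoidHom p + AddMonoidAlgebra.map L.toAddMonoidHom q := by
      ext m
      simp only [coeff_map_linear, coeff_add, map_add]
    rw [this, map_add, hp, hq, map_add, map_add]

end CoeffMap

section Product

open MvPolynomial

variable {m c : ℕ}

/-- `det(1 + t_k X)` as a polynomial in the variables `t` with coefficients polynomials in the
entries of the generic matrix `X`. -/
def detFactor (c : ℕ) {m : ℕ} (k : Fin m) :
    MvPolynomial (Fin m) (MvPolynomial (Fin c × Fin c) ℂ) :=
  (1 + (X k : MvPolynomial (Fin m) (MvPolynomial (Fin c × Fin c) ℂ)) • (genMat c).map C).det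

/-- The product of the `det(1 + t_k X)`. -/
def detProduct (m c : ℕ) : MvPolynomial (Fin m) (MvPolynomial (Fin c × Fin c) ℂ) :=
  ∏ k, detFactor c k

theorem euler_map_C (k : Fin m) (A : Matrix (Fin c) (Fin c) (MvPolynomial (Fin c × Fin c) ℂ)) (l : Fin m) :
    (1 + (X l : MvPolynomial (Fin m) (MvPolynomial (Fin c × Fin c) ℂ)) • A.map C).map (euler k) =
      if k = l then (X l : MvPolynomial (Fin m) (MvPolynomial (Fin c × Fin c) ℂ)) • A.map C else 0 := by
  have h1 : ∀ i j, euler k ((1 : Matrix (Fin c) (Fin c)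
      (MvPolynomial (Fin m) (MvPolynomial (Fin c × Fin c) ℂ))) i j) = 0 := by
    intro i j
    rw [Matrix.one_apply]; split_ifs <;> simp
  have h2 : ∀ s : MvPolynomial (Fin c × Fin c) ℂ, euler k (C s : MvPolynomial (Fin m) (MvPolynomial (Fin c × Fin c) ℂ)) = 0 :=
    fun s => (euler k).map_algebraMap s
  ext1 i j
  simp only [map_apply, Matrix.add_apply, Matrix.smul_apply, map_add, h1, zero_add,
    smul_eq_mul, Derivation.leibniz, h2, zero_add]
  rw [euler_apply, pderiv_X]
  split_ifs with h
  · subst h; simp [mul_comm]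
  · simp [Ne.symm h]

theorem euler_detFactor (k l : Fin m) :
    euler k (detFactor c l) = if k = l then (resolvent ((genMat c).map C) (X l)).trace else 0 := by
  rw [detFactor, derivation_det, euler_map_C]
  split_ifs
  · rw [adjugate_mul_smul_eq_resolvent]
  · simp

/-- For r = tX(1 + tX)⁻¹ the Euler operator in t sends r to r - r² and det(1 + tX) to det(1 + tX) tr
r; the formula is the product rule for the resolvent det(1 + tX) r. -/
theorem detFactor_mul_euler_trace (k l : Fin m) :
    detFactor c l * euler k (resolvent ((genMat c).map C) (X l)).trace =
      if k = l then (resolvent ((genMat c).map C) (X l)).trace ^ 2 +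
        detFactor c l * (resolvent ((genMat c).map C) (X l)).trace -
        (resolvent ((genMat c).map C) (X l) * resolvent ((genMat c).map C) (X l)).trace else 0 := by
  have h := congrArg Matrix.trace
    (det_smul_derivation_resolvent (euler k) ((genMat c).map C) (X l))
  have h2 : ((resolvent ((genMat c).map C) (X l)).map (euler k)).trace =
      euler k (resolvent ((genMat c).map C) (X l)).trace := by
    simp [Matrix.trace]
  rw [Matrix.trace_smul, h2, smul_eq_mul] at h
  refine h.trans ?_
  have h3 := euler_detFactor (c := c) k l
  rw [detFactor] at h3 ⊢
  rw [h3, euler_map_C]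
  split_ifs
  · rw [adjugate_mul_smul_eq_resolvent, adjugate_eq_sub_resolvent, Matrix.trace_add,
      Matrix.trace_smul, mul_sub, Matrix.trace_sub, Matrix.mul_smul, mul_one, Matrix.trace_smul]
    simp only [smul_eq_mul]
    ring
  · simp

theorem euler_detProduct (k : Fin m) :
    euler k (detProduct m c) = (∏ l ∈ Finset.univ.erase k, detFactor c l) *
      (resolvent ((genMat c).map C) (X k)).trace := by
  rw [detProduct, derivation_prod, Finset.sum_eq_single k]
  · rw [euler_detFactor, if_pos rfl]
  · intro l _ hl
    rw [euler_detFactor, if_neg hl.symm, mul_zero]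
  · simp

theorem euler_euler_detProduct (k : Fin m) :
    euler k (euler k (detProduct m c)) = (∏ l ∈ Finset.univ.erase k, detFactor c l) *
      euler k (resolvent ((genMat c).map C) (X k)).trace := by
  rw [euler_detProduct, Derivation.leibniz, derivation_prod, Finset.sum_eq_zero, smul_zero,
    add_zero, smul_eq_mul]
  intro l hl
  rw [euler_detFactor, if_neg (Finset.ne_of_mem_erase hl).symm, mul_zero]

theorem rename_detProduct (σ : Equiv.Perm (Fin m)) :
    rename σ (detProduct m c) = detProduct m c := by
  rw [detProduct, map_prod]
  refine Eq.trans ?_ (Equiv.prod_comp σ _)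
  refine Finset.prod_congr rfl fun k _ => ?_
  rw [detFactor, AlgHom.map_det, detFactor]
  congr 1
  ext1 i j
  simp [Matrix.one_apply, apply_ite (rename σ)]

theorem degreeOf_detProduct_le (k : Fin m) : degreeOf k (detProduct m c) ≤ c := by
  classical
  have key : ∀ l : Fin m, degreeOf k (detFactor c l) ≤ if k = l then c else 0 := by
    intro l
    set q : Polynomial (MvPolynomial (Fin c × Fin c) ℂ) :=
      det ((Polynomial.X : Polynomial (MvPolynomial (Fin c × Fin c) ℂ)) •
        (genMat c).map Polynomial.C + (1 : Matrix (Fin c) (Fin c) _).map Polynomial.C) with hq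
    have h1 : detFactor c l = Polynomial.aeval (X l) q := by
      rw [hq, AlgHom.map_det, detFactor]
      congr 1
      ext1 i j
      simp [Matrix.one_apply, apply_ite, add_comm, MvPolynomial.algebraMap_eq]
      exact mul_comm _ _
    have h2 : q.natDegree ≤ c :=
      (Polynomial.natDegree_det_X_add_C_le (genMat c) 1).trans_eq (Fintype.card_fin c)
    rw [h1, Polynomial.aeval_eq_sum_range]
    refine (degreeOf_sum_le _ _ _).trans (Finset.sup_le fun i hi => ?_)
    rw [MvPolynomial.smul_eq_C_mul]
    refine (degreeOf_C_mul_le _ _ _).trans ((degreeOf_pow_le _ _ _).trans ?_)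
    have hi' : i ≤ c := by rw [Finset.mem_range] at hi; omega
    rw [degreeOf_X]
    split_ifs <;> simp_all
  refine (degreeOf_prod_le _ _ _).trans ((Finset.sum_le_sum fun l _ => key l).trans ?_)
  simp

end Product

section Casimir

open MvPolynomial

variable {m c : ℕ}

theorem map_resolvent {S T : Type*} [CommRing S] [CommRing T] (f : S →+* T) {n : Type*} [Fintype n]
    [DecidableEq n] (Y : Matrix n n S) (t : S) :
    (resolvent Y t).map f = resolvent (Y.map f) (f t) := by
  have h : (1 + t • Y).map f = 1 + f t • Y.map f := by
    ext i j
    simp [Matrix.one_apply, apply_ite f]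
  rw [resolvent, resolvent, ← h]
  simp only [← RingHom.mapMatrix_apply]
  rw [← RingHom.map_det, ← RingHom.map_adjugate, map_sub]
  congr 1
  ext i j
  simp [Matrix.one_apply, apply_ite f]

/-- `det(1 + tX)` for the generic matrix `X` and a scalar `t`. -/
def genDet (c : ℕ) (t : ℂ) : MvPolynomial (Fin c × Fin c) ℂ := (1 + (C t : MvPolynomial (Fin c × Fin c) ℂ) • genMat c).det

/-- The resolvent of the generic matrix at a scalar. -/
def genRes (c : ℕ) (t : ℂ) : Matrix (Fin c) (Fin c) (MvPolynomial (Fin c × Fin c) ℂ) :=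
  resolvent (genMat c) (C t)

theorem genDet_ne_zero (t : ℂ) : genDet c t ≠ 0 := by
  intro h
  have h2 := congrArg (eval 0) h
  rw [genDet, RingHom.map_det, map_zero] at h2
  have : (eval 0).mapMatrix (1 + (C t : MvPolynomial (Fin c × Fin c) ℂ) • genMat c) = 1 := by
    ext i j
    simp [genMat, Matrix.one_apply, apply_ite]
  rw [this, det_one] at h2
  exact one_ne_zero h2

theorem eval_detFactor (x : Fin m → ℂ) (k : Fin m) :
    eval (fun l => algebraMap ℂ (MvPolynomial (Fin c × Fin c) ℂ) (x l)) (detFactor c k) =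
      genDet c (x k) := by
  rw [detFactor, RingHom.map_det, genDet]
  congr 1
  ext1 i j
  simp [Matrix.one_apply, apply_ite, MvPolynomial.algebraMap_eq]

theorem eval_trace_resolvent (x : Fin m → ℂ) (k : Fin m) :
    eval (fun l => algebraMap ℂ (MvPolynomial (Fin c × Fin c) ℂ) (x l))
      (resolvent ((genMat c).map C) (X k)).trace = (genRes c (x k)).trace := by
  have h := map_resolvent (eval (fun l => algebraMap ℂ (MvPolynomial (Fin c × Fin c) ℂ) (x l)))
    ((genMat c).map C) (X k)
  rw [eval_X, Matrix.map_map] at h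
  have h2 : (genMat c).map (eval (fun l => algebraMap ℂ (MvPolynomial (Fin c × Fin c) ℂ) (x l)) ∘ C)
      = genMat c := by ext1 i j; simp
  rw [h2] at h
  rw [genRes, show (C (x k) : MvPolynomial (Fin c × Fin c) ℂ) = algebraMap ℂ _ (x k) from rfl, ← h]
  simp [Matrix.trace]

theorem eval_trace_resolvent_mul (x : Fin m → ℂ) (k : Fin m) :
    eval (fun l => algebraMap ℂ (MvPolynomial (Fin c × Fin c) ℂ) (x l))
      (resolvent ((genMat c).map C) (X k) * resolvent ((genMat c).map C) (X k)).trace =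
      (genRes c (x k) * genRes c (x k)).trace := by
  have h := map_resolvent (eval (fun l => algebraMap ℂ (MvPolynomial (Fin c × Fin c) ℂ) (x l)))
    ((genMat c).map C) (X k)
  rw [eval_X, Matrix.map_map] at h
  have h2 : (genMat c).map (eval (fun l => algebraMap ℂ (MvPolynomial (Fin c × Fin c) ℂ) (x l)) ∘ C)
      = genMat c := by ext1 i j; simp
  rw [h2] at h
  rw [genRes, show (C (x k) : MvPolynomial (Fin c × Fin c) ℂ) = algebraMap ℂ _ (x k) from rfl, ← h, ← Matrix.map_mul]
  simp [Matrix.trace, Matrix.mul_apply]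

theorem map_lieDeriv_one_add (Z : Matrix (Fin c) (Fin c) ℂ) (t : ℂ) :
    (1 + (C t : MvPolynomial (Fin c × Fin c) ℂ) • genMat c).map (lieDeriv Z) = Z.map C * ((C t : MvPolynomial (Fin c × Fin c) ℂ) • genMat c) := by
  have h1 : ∀ i j, lieDeriv Z ((1 : Matrix (Fin c) (Fin c)
      (MvPolynomial (Fin c × Fin c) ℂ)) i j) = 0 := by
    intro i j
    rw [Matrix.one_apply]; split_ifs <;> simp
  rw [Matrix.mul_smul, ← map_lieDeriv_genMat]
  ext1 i j
  simp only [map_apply, Matrix.add_apply, Matrix.smul_apply, map_add, h1, zero_add, smul_eq_mul,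
    ← MvPolynomial.smul_eq_C_mul, Derivation.map_smul]

theorem lieDeriv_genDet (Z : Matrix (Fin c) (Fin c) ℂ) (t : ℂ) :
    lieDeriv Z (genDet c t) = (Z.map C * genRes c t).trace := by
  rw [genDet, derivation_det, map_lieDeriv_one_add, trace_mul_comm, mul_assoc,
    smul_mul_adjugate_eq_resolvent, genRes]

theorem lieDeriv_prod_genDet (Z : Matrix (Fin c) (Fin c) ℂ) (x : Fin m → ℂ)
    (s : Finset (Fin m)) : lieDeriv Z (∏ k ∈ s, genDet c (x k)) =
      ∑ k ∈ s, (∏ l ∈ s.erase k, genDet c (x l)) * (Z.map C * genRes c (x k)).trace := by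
  rw [derivation_prod]
  simp only [lieDeriv_genDet]

theorem genDet_smul_lieDeriv_genRes (Z : Matrix (Fin c) (Fin c) ℂ) (t : ℂ) :
    genDet c t • (genRes c t).map (lieDeriv Z) =
      (Z.map C * genRes c t).trace • genRes c t +
        (genDet c t • 1 - genRes c t) * (Z.map C * genRes c t) := by
  have h := det_smul_derivation_resolvent (lieDeriv Z) (genMat c) (C t)
  rw [map_lieDeriv_one_add, ← genDet, ← genRes, lieDeriv_genDet, mul_assoc _ (_ * _), mul_assoc _ ((C t : MvPolynomial (Fin c × Fin c) ℂ) • _),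
    smul_mul_adjugate_eq_resolvent, adjugate_eq_sub_resolvent, ← genDet, ← genRes] at h
  exact h

theorem sum_trace_single (A : Matrix (Fin c) (Fin c) (MvPolynomial (Fin c × Fin c) ℂ))
    (i j : Fin c) : ((Matrix.single i j (1 : ℂ)).map C * A).trace = A j i := by
  have : (Matrix.single i j (1 : ℂ)).map (C : ℂ →+* MvPolynomial (Fin c × Fin c) ℂ) =
      Matrix.single i j 1 := by
    ext1 k l
    simp [Matrix.single, apply_ite]
  rw [this, Matrix.trace_single_mul]
  simp

/-- The divergence of the resolvent as a matrix of functions on the group. The terms tr R² and (tr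
R)² occur with signs opposite to those in the second Euler derivative. -/
theorem genDet_mul_sum_lieDeriv (t : ℂ) :
    genDet c t * ∑ i, ∑ j, lieDeriv (Matrix.single i j 1) (genRes c t i j) =
      (genRes c t * genRes c t).trace + c * genDet c t * (genRes c t).trace -
        (genRes c t).trace ^ 2 := by
  have h : ∀ i j, genDet c t * lieDeriv (Matrix.single i j 1) (genRes c t i j) =
      genRes c t i j * genRes c t j i + (genDet c t - genRes c t i i) * genRes c t j j := by
    intro i j
    have h1 := congrFun (congrFun (genDet_smul_lieDeriv_genRes (Matrix.single i j 1) t) i) j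
    rw [Matrix.smul_apply, map_apply, smul_eq_mul] at h1
    rw [h1, Matrix.add_apply, Matrix.smul_apply, sum_trace_single, smul_eq_mul, mul_comm]
    congr 1
    have h2 : (Matrix.single i j (1 : ℂ)).map (C : ℂ →+* MvPolynomial (Fin c × Fin c) ℂ) =
        Matrix.single i j 1 := by
      ext1 k l
      simp [Matrix.single, apply_ite]
    rw [h2, ← mul_assoc, Matrix.mul_apply, Finset.sum_eq_single j]
    · rw [Matrix.mul_single_apply_same]; simp
    · intro k _ hk
      rw [Matrix.mul_single_apply_of_ne _ _ _ _ _ hk, zero_mul]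
    · simp
  rw [Finset.mul_sum]
  simp only [Finset.mul_sum, h, Finset.sum_add_distrib, sub_mul, Finset.sum_sub_distrib]
  have e1 : ∑ i, ∑ j, genRes c t i j * genRes c t j i = (genRes c t * genRes c t).trace := by
    simp [Matrix.trace, Matrix.mul_apply]
  have e2 : ∑ i, ∑ j, genRes c t i i * genRes c t j j = (genRes c t).trace ^ 2 := by
    rw [sq, Matrix.trace, Finset.sum_mul_sum]; rfl
  rw [e1, e2]
  simp [Matrix.trace, ← Finset.mul_sum]
  ring

/-- The integral of `∏_k det(1 + t_k Ω)` against `(det Ω⁻¹)^b`, as a polynomial. -/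
def haarChar (b m c : ℕ) : MvPolynomial (Fin m) ℂ :=
  AddMonoidAlgebra.map (haarCoeff (c := c) b).toAddMonoidHom (detProduct m c)

theorem eval_haarChar (b : ℕ) (x : Fin m → ℂ) :
    eval x (haarChar b m c) = haarCoeff b (∏ k, genDet c (x k)) := by
  rw [haarChar, eval_map_linear, detProduct, map_prod]
  simp only [eval_detFactor]

theorem eval_euler_haarChar (b : ℕ) (x : Fin m → ℂ) (k : Fin m) :
    eval x (euler k (haarChar b m c)) =
      haarCoeff b ((∏ l ∈ Finset.univ.erase k, genDet c (x l)) * (genRes c (x k)).trace) := by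
  rw [haarChar, euler_map_linear, eval_map_linear, euler_detProduct, map_mul, map_prod,
    eval_trace_resolvent]
  simp only [eval_detFactor]

/-- When the divergence of the resolvent is added to the second Euler derivative, the terms
quadratic in the resolvent cancel and a multiple c + 1 of the first derivative remains. -/
theorem eval_euler_euler_haarChar (b : ℕ) (x : Fin m → ℂ) (k : Fin m) :
    eval x (euler k (euler k (haarChar b m c))) =
      haarCoeff b ((∏ l ∈ Finset.univ.erase k, genDet c (x l)) *
        (((c + 1 : ℕ) : MvPolynomial (Fin c × Fin c) ℂ) * (genRes c (x k)).trace -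
        ∑ i, ∑ j, lieDeriv (Matrix.single i j 1) (genRes c (x k) i j))) := by
  rw [haarChar, euler_map_linear, euler_map_linear, eval_map_linear, euler_euler_detProduct,
    map_mul, map_prod]
  simp only [eval_detFactor]
  congr 2
  have h := congrArg (eval (fun l => algebraMap ℂ (MvPolynomial (Fin c × Fin c) ℂ) (x l)))
    (detFactor_mul_euler_trace (c := c) k k)
  rw [if_pos rfl] at h
  simp only [map_mul, map_sub, map_add, map_pow, eval_detFactor, eval_trace_resolvent,
    eval_trace_resolvent_mul] at h
  refine mul_left_cancel₀ (genDet_ne_zero (x k)) ?_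
  rw [h, mul_sub, genDet_mul_sum_lieDeriv]
  push_cast
  ring

/-- Integration by parts with Z = 1, the generator of scalings: on the product of the det(1 + t_k
X), scaling X amounts to scaling all t_k, and b tr 1 = bc. -/
theorem sum_euler_haarChar (b : ℕ) :
    ∑ k, euler k (haarChar b m c) = C ((b * c : ℕ) : ℂ) * haarChar b m c := by
  refine MvPolynomial.funext fun x => ?_
  rw [map_sum, map_mul, eval_C, eval_haarChar]
  simp only [eval_euler_haarChar]
  have h := haarCoeff_lieDeriv b 1 (∏ k, genDet c (x k))
  rw [lieDeriv_prod_genDet, map_sum] at h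
  have h1 : (1 : Matrix (Fin c) (Fin c) ℂ).map (C : ℂ →+* MvPolynomial (Fin c × Fin c) ℂ) = 1 :=
    Matrix.map_one C (map_zero _) (map_one _)
  simp only [h1, one_mul] at h
  rw [h]
  simp

/-- Integration by parts in the direction of the elementary matrix E_ij is applied to the (i, j)
entry of the k-th resolvent times the other determinants, and summed over i, j. The traces of E_ij
leave only i = j. The derivative of the resolvent gives the second Euler derivative, and that of the
l-th determinant gives the trace of a product of two resolvents, which the resolvent identity
reduces to first derivatives. -/
theorem casimir_haarChar (b : ℕ) (x : Fin m → ℂ) (hx : Function.Injective x) (k : Fin m) :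
    b * eval x (euler k (haarChar b m c)) =
      (c + 1) * eval x (euler k (haarChar b m c)) - eval x (euler k (euler k (haarChar b m c))) +
      ∑ l ∈ Finset.univ.erase k, (x l / (x l - x k) * eval x (euler k (haarChar b m c)) -
        x k / (x l - x k) * eval x (euler l (haarChar b m c))) := by
  set F := ∏ l ∈ Finset.univ.erase k, genDet c (x l) with hF
  have h1 : ∑ i, ∑ j, haarCoeff b (lieDeriv (Matrix.single i j 1) (F * genRes c (x k) i j)) =
      b * eval x (euler k (haarChar b m c)) := by
    simp only [haarCoeff_lieDeriv, eval_euler_haarChar]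
    rw [← hF, Matrix.trace, Finset.mul_sum, map_sum, Finset.mul_sum]
    refine Finset.sum_congr rfl fun i _ => ?_
    rw [Finset.sum_eq_single i]
    · simp
    · intro j _ hj
      rw [Matrix.trace_single_eq_of_ne _ _ _ hj.symm]; simp
    · simp
  rw [← h1]
  have h2 : ∀ i j, lieDeriv (Matrix.single i j 1) (F * genRes c (x k) i j) =
      F * lieDeriv (Matrix.single i j 1) (genRes c (x k) i j) +
      ∑ l ∈ Finset.univ.erase k, (∏ l' ∈ (Finset.univ.erase k).erase l, genDet c (x l')) *
        (genRes c (x k) i j * genRes c (x l) j i) := by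
    intro i j
    rw [Derivation.leibniz, smul_eq_mul, smul_eq_mul, hF, lieDeriv_prod_genDet, Finset.mul_sum]
    refine congrArg₂ (· + ·) rfl (Finset.sum_congr rfl fun l _ => ?_)
    rw [sum_trace_single]
    ring
  have h3 : ∑ i, ∑ j, lieDeriv (Matrix.single i j 1) (F * genRes c (x k) i j) =
      F * ∑ i, ∑ j, lieDeriv (Matrix.single i j 1) (genRes c (x k) i j) +
      ∑ l ∈ Finset.univ.erase k, (∏ l' ∈ (Finset.univ.erase k).erase l, genDet c (x l')) *
        (genRes c (x k) * genRes c (x l)).trace := by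
    simp only [h2, Finset.sum_add_distrib, Finset.mul_sum]
    congr 1
    simp only [Matrix.trace, diag_apply, Matrix.mul_apply, Finset.mul_sum]
    exact (Finset.sum_congr rfl fun i _ => Finset.sum_comm).trans Finset.sum_comm
  simp only [← map_sum]
  rw [h3, map_add, map_sum]
  have h4 : haarCoeff b (F * ∑ i, ∑ j, lieDeriv (Matrix.single i j 1) (genRes c (x k) i j)) =
      (c + 1) * eval x (euler k (haarChar b m c)) -
        eval x (euler k (euler k (haarChar b m c))) := by
    rw [eval_euler_euler_haarChar, eval_euler_haarChar, ← hF, mul_sub, map_sub, mul_left_comm,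
      ← nsmul_eq_mul (c + 1), map_nsmul, nsmul_eq_mul]
    push_cast
    ring
  rw [h4]
  congr 1
  refine Finset.sum_congr rfl fun l hl => ?_
  have hlk : l ≠ k := Finset.ne_of_mem_erase hl
  have hne : x l - x k ≠ 0 := sub_ne_zero.2 fun e => hlk (hx e)
  have h5 := congrArg Matrix.trace (resolvent_mul_resolvent (genMat c) (C (x k)) (C (x l)))
  rw [← genRes, ← genRes, ← genDet, ← genDet, Matrix.trace_smul, Matrix.trace_sub,
    Matrix.trace_smul, Matrix.trace_smul, ← C_sub] at h5
  simp only [smul_eq_mul] at h5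
  have h6 : ∏ l' ∈ Finset.univ.erase k, genDet c (x l') = (∏ l' ∈ (Finset.univ.erase k).erase l, genDet c (x l')) * genDet c (x l) :=
    (Finset.prod_erase_mul _ _ hl).symm
  have h7 : ∏ l' ∈ Finset.univ.erase l, genDet c (x l') = (∏ l' ∈ (Finset.univ.erase k).erase l, genDet c (x l')) * genDet c (x k) := by
    rw [Finset.erase_right_comm]
    exact (Finset.prod_erase_mul _ _ (Finset.mem_erase.2 ⟨hlk.symm, Finset.mem_univ k⟩)).symm
  rw [eval_euler_haarChar, eval_euler_haarChar, h6, h7]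
  set P := ∏ l' ∈ (Finset.univ.erase k).erase l, genDet c (x l')
  have h8 : (x l - x k) * haarCoeff b (P * (genRes c (x k) * genRes c (x l)).trace) =
      x l * haarCoeff b (P * genDet c (x l) * (genRes c (x k)).trace) -
      x k * haarCoeff b (P * genDet c (x k) * (genRes c (x l)).trace) := by
    have hs : ∀ (r : ℂ) (p : MvPolynomial (Fin c × Fin c) ℂ),
        r * haarCoeff b p = haarCoeff b (r • p) := fun r p => by rw [map_smul, smul_eq_mul]
    rw [hs, hs, hs, ← map_sub]
    congr 1
    simp only [MvPolynomial.smul_eq_C_mul]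
    linear_combination P * h5
  field_simp
  linear_combination h8

theorem haarCoeff_det_pow (b : ℕ) : haarCoeff b ((genMat c).det ^ b) = 1 := by
  rw [haarCoeff_apply]
  have : ∀ Ω : U c, eval (fun ij => (Ω : Matrix (Fin c) (Fin c) ℂ) ij.1 ij.2)
      ((genMat c).det ^ b) *
        Matrix.det ((Ω⁻¹ : U c) : Matrix (Fin c) (Fin c) ℂ) ^ b = 1 := by
    intro Ω
    have h1 : eval (fun ij => (Ω : Matrix (Fin c) (Fin c) ℂ) ij.1 ij.2) (genMat c).det =
        (Ω : Matrix (Fin c) (Fin c) ℂ).det := by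
      rw [RingHom.map_det]
      congr 1
      ext1 i j
      simp [genMat]
    rw [map_pow, h1, ← mul_pow, ← Matrix.det_mul, ← Matrix.UnitaryGroup.mul_val, mul_inv_cancel]
    simp
  simp only [this]
  simp

/-- Let r(u) be the integral of det(u + Ω)^b against the weight. Since det(u + X)^b is homogeneous
of degree bc in u and X together, and integration by parts evaluates scaling in X also as bc, the
Euler derivative of r vanishes. So r is constant, and r(1) = r(0) = 1. -/
theorem haarCoeff_genDet_one_pow (b : ℕ) : haarCoeff b (genDet c 1 ^ b) = 1 := by
  set M : Matrix (Fin c) (Fin c) (MvPolynomial Unit (MvPolynomial (Fin c × Fin c) ℂ)) :=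
    (X () : MvPolynomial Unit (MvPolynomial (Fin c × Fin c) ℂ)) • 1 + (genMat c).map C with hM
  set r : MvPolynomial Unit ℂ :=
    AddMonoidAlgebra.map (haarCoeff (c := c) b).toAddMonoidHom (M.det ^ b) with hr
  have hMu : ∀ u : Unit → ℂ,
      M.map (eval fun l => algebraMap ℂ (MvPolynomial (Fin c × Fin c) ℂ) (u l)) =
      (C (u ()) : MvPolynomial (Fin c × Fin c) ℂ) • 1 + genMat c := by
    intro u
    ext1 i j
    simp [hM, Matrix.one_apply, apply_ite, MvPolynomial.algebraMap_eq]
  have hdet : ∀ u : Unit → ℂ,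
      eval (fun l => algebraMap ℂ (MvPolynomial (Fin c × Fin c) ℂ) (u l)) M.det =
      ((C (u ()) : MvPolynomial (Fin c × Fin c) ℂ) • 1 + genMat c).det := by
    intro u
    rw [RingHom.map_det, RingHom.mapMatrix_apply, hMu]
  have heuler : euler () M.det = X () * M.adjugate.trace := by
    have : M.map (euler ()) =
        (X () : MvPolynomial Unit (MvPolynomial (Fin c × Fin c) ℂ)) • 1 := by
      have h2 : ∀ s : MvPolynomial (Fin c × Fin c) ℂ,
          euler () (C s : MvPolynomial Unit (MvPolynomial (Fin c × Fin c) ℂ)) = 0 :=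
        fun s => (euler ()).map_algebraMap s
      ext1 i j
      simp only [hM, map_apply, Matrix.add_apply, Matrix.smul_apply, map_add, h2, add_zero,
        smul_eq_mul, Matrix.one_apply]
      split_ifs
      · simp [euler_apply]
      · simp
    rw [derivation_det, this, Matrix.mul_smul, mul_one, Matrix.trace_smul, smul_eq_mul]
  have h0 : euler () r = 0 := by
    refine MvPolynomial.funext fun u => ?_
    rw [map_zero, hr, euler_map_linear, eval_map_linear, Derivation.leibniz_pow, heuler]
    set A := (C (u ()) : MvPolynomial (Fin c × Fin c) ℂ) • (1 : Matrix (Fin c) (Fin c) _) +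
      genMat c with hA
    have h1 := haarCoeff_lieDeriv b 1 (A.det ^ b)
    have h3 : A.map (lieDeriv 1) = genMat c := by
      ext1 i j
      have e1 : ∀ z : ℂ, lieDeriv (1 : Matrix (Fin c) (Fin c) ℂ) (C z) = 0 :=
        fun z => (lieDeriv 1).map_algebraMap z
      simp only [hA, map_apply, Matrix.add_apply, Matrix.smul_apply, map_add, smul_eq_mul,
        Matrix.one_apply, mul_ite, mul_one, mul_zero, apply_ite (lieDeriv _), e1, map_zero,
        ite_self, zero_add, genMat, of_apply, lieDeriv_X]
      simp
    rw [Derivation.leibniz_pow, derivation_det, h3] at h1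
    have h4 : (A.adjugate * genMat c).trace =
        (c : MvPolynomial (Fin c × Fin c) ℂ) * A.det - C (u ()) * A.adjugate.trace := by
      have h5 := congrArg Matrix.trace (adjugate_mul A)
      rw [Matrix.trace_smul, Matrix.trace_one, smul_eq_mul, Fintype.card_fin] at h5
      nth_rewrite 2 [hA] at h5
      rw [mul_add, Matrix.trace_add, Matrix.mul_smul, mul_one, Matrix.trace_smul,
        smul_eq_mul] at h5
      linear_combination h5
    rw [h4] at h1
    have h6 : eval (fun l => algebraMap ℂ (MvPolynomial (Fin c × Fin c) ℂ) (u l))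
        M.adjugate.trace = A.adjugate.trace := by
      have h7 := RingHom.map_adjugate
        (eval (fun l => algebraMap ℂ (MvPolynomial (Fin c × Fin c) ℂ) (u l))) M
      rw [RingHom.mapMatrix_apply, RingHom.mapMatrix_apply, hMu, ← hA] at h7
      rw [← h7]
      simp [Matrix.trace]
    simp only [smul_eq_mul, nsmul_eq_mul, map_mul, map_pow, map_natCast, hdet, eval_X, h6, ← hA]
    rw [show algebraMap ℂ (MvPolynomial (Fin c × Fin c) ℂ) (u ()) = C (u ()) from rfl]
    rcases Nat.eq_zero_or_pos b with rfl | hb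
    · simp
    · obtain ⟨b', rfl⟩ := Nat.exists_eq_add_of_le' hb
      rw [Nat.add_sub_cancel] at h1 ⊢
      simp only [smul_eq_mul, nsmul_eq_mul] at h1
      have h8 : ((b' + 1 : ℕ) : MvPolynomial (Fin c × Fin c) ℂ) * (A.det ^ b' *
          ((c : MvPolynomial (Fin c × Fin c) ℂ) * A.det - C (u ()) * A.adjugate.trace)) =
          ((b' + 1) * c : ℕ) • A.det ^ (b' + 1) -
          ((b' + 1 : ℕ) : MvPolynomial (Fin c × Fin c) ℂ) * (A.det ^ b' *
            (C (u ()) * A.adjugate.trace)) := by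
        rw [nsmul_eq_mul]; push_cast; ring
      rw [h8, map_sub, map_nsmul, Matrix.trace_one, nsmul_eq_mul, Fintype.card_fin] at h1
      push_cast at h1 ⊢
      linear_combination -h1
  have hr0 : r = C (coeff 0 r) := by
    ext m
    rw [coeff_C]
    split_ifs with hm
    · rw [hm]
    · have h1 := congrArg (coeff m) h0
      rw [coeff_euler, coeff_zero] at h1
      refine (mul_eq_zero.1 h1).resolve_left ?_
      intro h2
      exact hm (Finsupp.ext fun _ => by simpa using (Nat.cast_eq_zero.1 h2).symm)
  have h1 : eval (fun _ => 1) r = eval (fun _ => 0) r := by rw [hr0, eval_C, eval_C]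
  rw [hr, eval_map_linear, eval_map_linear, RingHom.map_pow, RingHom.map_pow, hdet, hdet] at h1
  rw [C_0, zero_smul, zero_add, haarCoeff_det_pow, C_1, one_smul] at h1
  rw [genDet, C_1, one_smul]
  exact h1

theorem isRectCharacter_haarChar (a b c : ℕ) : IsRectCharacter a b c (haarChar b (a + b) c) where
  symm σ := by
    ext m
    have h1 : m = (m.mapDomain σ.symm).mapDomain σ := by
      rw [← Finsupp.mapDomain_comp]; simp
    rw [h1, coeff_rename_mapDomain σ σ.injective, haarChar, coeff_map_linear, coeff_map_linear]
    conv_rhs => rw [← rename_detProduct σ, coeff_rename_mapDomain σ σ.injective]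
  degree n hn k := by
    refine (degreeOf_le_iff.1 (degreeOf_detProduct_le (c := c) k)) n ?_
    rw [mem_support_iff] at hn ⊢
    intro h
    apply hn
    rw [haarChar, coeff_map_linear, h, map_zero]
  euler_sum := sum_euler_haarChar b
  casimir x _ hx := by
    have hk := fun k => casimir_haarChar (c := c) b x hx k
    have hs := congrArg (eval x) (sum_euler_haarChar (m := a + b) (c := c) b)
    rw [map_sum, map_mul, eval_C] at hs
    set E : Fin (a + b) → ℂ := fun k => eval x (euler k (haarChar b (a + b) c)) with hE
    have e1 : ∀ k, eval x (euler k (euler k (haarChar b (a + b) c))) =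
        ((c : ℂ) + 1 - b) * E k + ∑ l ∈ Finset.univ.erase k, x l / (x l - x k) * E k -
          ∑ l ∈ Finset.univ.erase k, x k / (x l - x k) * E l := by
      intro k
      have := hk k
      rw [Finset.sum_sub_distrib] at this
      linear_combination this
    have e2 : ∑ k, ∑ l ∈ Finset.univ.erase k, x k / (x l - x k) * E l =
        ∑ k, ∑ l ∈ Finset.univ.erase k, x l / (x k - x l) * E k :=
      Finset.sum_comm' (by simp [eq_comm])
    rw [Finset.sum_congr rfl fun k _ => e1 k, Finset.sum_sub_distrib, e2,
      Finset.sum_add_distrib, ← Finset.mul_sum, hs]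
    -- For each pair the three coefficients of `E k` add up to 1, so the sums give a + b - 1 times
    -- the first order sum; with c + 1 - b from the integral equation the total factor is a + c.
    have e3 : ∑ k, ∑ l ∈ Finset.univ.erase k, x l / (x l - x k) * E k -
        ∑ k, ∑ l ∈ Finset.univ.erase k, x l / (x k - x l) * E k +
        ∑ k, ∑ l ∈ Finset.univ.erase k, (x l + x k) / (x k - x l) * E k =
        ((a + b : ℂ) - 1) * ∑ k, E k := by
      rw [← Finset.sum_sub_distrib, ← Finset.sum_add_distrib, Finset.mul_sum]
      refine Finset.sum_congr rfl fun k _ => ?_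
      rw [← Finset.sum_sub_distrib, ← Finset.sum_add_distrib]
      have : ((a + b : ℂ) - 1) * E k = ∑ l ∈ Finset.univ.erase k, E k := by
        rw [Finset.sum_const, Finset.card_erase_of_mem (Finset.mem_univ k), Finset.card_univ,
            Fintype.card_fin, nsmul_eq_mul, Nat.cast_sub (by have := k.2; omega)]
        push_cast; ring
      rw [this]
      refine Finset.sum_congr rfl fun l hl => ?_
      have h1 : x k - x l ≠ 0 := sub_ne_zero.2 fun e => Finset.ne_of_mem_erase hl (hx e).symm
      have h2 : x l - x k ≠ 0 := sub_ne_zero.2 fun e => Finset.ne_of_mem_erase hl (hx e)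
      rw [← neg_sub (x k) (x l), div_neg]
      field_simp
      ring
    rw [hs] at e3
    push_cast at e3 ⊢
    linear_combination e3
  norm := by
    rw [eval_haarChar, Fin.prod_univ_add]
    simp only [Fin.addCases_left, Fin.addCases_right]
    have h0 : genDet c 0 = 1 := by rw [genDet, C_0, zero_smul, add_zero, det_one]
    rw [h0, Finset.prod_const_one, one_mul, Finset.prod_const, Finset.card_univ, Fintype.card_fin,
      haarCoeff_genDet_one_pow]

/-- The integral over the unitary group as a Schur function. -/
theorem integral_unitary_eq_schur (a b c : ℕ) (Γ : Fin (a + b) → ℂ) :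
    ∫ Ω : U c, Matrix.det (1 + Matrix.diagonal Γ ⊗ₖ (Ω : Matrix (Fin c) (Fin c) ℂ)) *
      Matrix.det ((Ω⁻¹ : U c) : Matrix (Fin c) (Fin c) ℂ) ^ b ∂(unitaryHaar c) =
    schur (rect b c) Γ := by
  rw [← (isRectCharacter_haarChar a b c).eval_eq_schur, eval_haarChar, haarCoeff_apply]
  congr 1
  funext Ω
  congr 1
  -- As Γ is diagonal, exchanging the tensor factors exhibits blocks 1 + Γ_k Ω, and the determinant
  -- becomes the product in the generating polynomial.
  have h1 : (1 + Matrix.diagonal Γ ⊗ₖ (Ω : Matrix (Fin c) (Fin c) ℂ)) =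
      Matrix.reindex (Equiv.prodComm _ _) (Equiv.prodComm _ _)
        (blockDiagonal fun k => 1 + Γ k • (Ω : Matrix (Fin c) (Fin c) ℂ)) := by
    ext ⟨k, i⟩ ⟨l, j⟩
    by_cases hkl : k = l
    · subst hkl
      simp [Matrix.one_apply, blockDiagonal_apply]
    · simp [blockDiagonal_apply, hkl]
  rw [h1, Matrix.det_reindex_self, Matrix.det_blockDiagonal, map_prod]
  refine Finset.prod_congr rfl fun k _ => ?_
  rw [genDet, RingHom.map_det]
  congr 1
  ext1 i j
  simp [genMat, Matrix.one_apply, apply_ite]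

end Casimir

end ThreeArch
end

noncomputable section

namespace ThreeArch

open Matrix MvPolynomial

/-! ### Polynomial representations with a cyclic highest weight vector -/

section HighestRep

variable {N d : ℕ}

/-- The entries of a matrix, as a point. -/
def ent (M : Matrix (Fin N) (Fin N) ℂ) : Fin N × Fin N → ℂ := fun ij => M ij.1 ij.2

/-- The value of a matrix of polynomials in the entries of the generic matrix. -/
def ev (R : Matrix (Fin d) (Fin d) (MvPolynomial (Fin N × Fin N) ℂ))
    (M : Matrix (Fin N) (Fin N) ℂ) : Matrix (Fin d) (Fin d) ℂ := R.map (eval (ent M))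

theorem ev_apply (R : Matrix (Fin d) (Fin d) (MvPolynomial (Fin N × Fin N) ℂ))
    (M : Matrix (Fin N) (Fin N) ℂ) (i j : Fin d) : ev R M i j = eval (ent M) (R i j) := rfl

/-- A polynomial representation of the monoid of matrices, with a cyclic vector on which the upper
triangular matrices act through the weight `lam`. -/
structure IsHighestRep (R : Matrix (Fin d) (Fin d) (MvPolynomial (Fin N × Fin N) ℂ))
    (v : Fin d → ℂ) (lam : Fin N → ℕ) : Prop where
  mul : ∀ M M', ev R (M * M') = ev R M * ev R M'
  one : ev R 1 = 1
  highest : ∀ M : Matrix (Fin N) (Fin N) ℂ, M.det ≠ 0 → M.BlockTriangular id →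
    ev R M *ᵥ v = (∏ i, M i i ^ lam i) • v
  cyclic : ∀ A : Matrix (Fin d) (Fin d) ℂ, (∀ M, M.det ≠ 0 → A *ᵥ (ev R M *ᵥ v) = 0) → A = 0

theorem eq_of_eval_ent {p q : MvPolynomial (Fin N × Fin N) ℂ}
    (h : ∀ M, eval (ent M) p = eval (ent M) q) : p = q :=
  MvPolynomial.funext fun x => h (of fun i j => x (i, j))

/-- Zariski density of the set r ≠ 0. With r the determinant, identities on the general linear group
extend to all matrices, singular ones included. -/
theorem eq_of_eval_ent_of_ne {p q r : MvPolynomial (Fin N × Fin N) ℂ} (hr : r ≠ 0)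
    (h : ∀ M, eval (ent M) r ≠ 0 → eval (ent M) p = eval (ent M) q) : p = q := by
  refine mul_right_cancel₀ hr (eq_of_eval_ent fun M => ?_)
  rw [map_mul, map_mul]
  by_cases hM : eval (ent M) r = 0
  · rw [hM, mul_zero, mul_zero]
  · rw [h M hM]

theorem eval_ent_det (M : Matrix (Fin N) (Fin N) ℂ) : eval (ent M) (genMat N).det = M.det := by
  rw [RingHom.map_det]
  congr 1
  ext1 i j
  simp [genMat, ent]

theorem det_genMat_ne_zero : (genMat N).det ≠ 0 := by
  intro h
  have := eval_ent_det (1 : Matrix (Fin N) (Fin N) ℂ)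
  rw [h, det_one, map_zero] at this
  exact zero_ne_one this

/-- The translation `p(X) ↦ p(XM)`. -/
def rightMul (M : Matrix (Fin N) (Fin N) ℂ) :
    MvPolynomial (Fin N × Fin N) ℂ →ₐ[ℂ] MvPolynomial (Fin N × Fin N) ℂ :=
  aeval fun ij => ∑ k, X (ij.1, k) * C (M k ij.2)

/-- The translation `p(X) ↦ p(MX)`. -/
def leftMul (M : Matrix (Fin N) (Fin N) ℂ) :
    MvPolynomial (Fin N × Fin N) ℂ →ₐ[ℂ] MvPolynomial (Fin N × Fin N) ℂ :=
  aeval fun ij => ∑ k, C (M ij.1 k) * X (k, ij.2)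

theorem eval_rightMul (M M' : Matrix (Fin N) (Fin N) ℂ) (p : MvPolynomial (Fin N × Fin N) ℂ) :
    eval (ent M') (rightMul M p) = eval (ent (M' * M)) p := by
  induction p using MvPolynomial.induction_on with
  | C r => simp [rightMul]
  | add p q hp hq => simp only [map_add, hp, hq]
  | mul_X p i hp =>
    rw [map_mul, map_mul, map_mul, hp]
    simp [rightMul, ent, Matrix.mul_apply]

theorem eval_leftMul (M M' : Matrix (Fin N) (Fin N) ℂ) (p : MvPolynomial (Fin N × Fin N) ℂ) :
    eval (ent M') (leftMul M p) = eval (ent (M * M')) p := by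
  induction p using MvPolynomial.induction_on with
  | C r => simp [leftMul]
  | add p q hp hq => simp only [map_add, hp, hq]
  | mul_X p i hp =>
    rw [map_mul, map_mul, map_mul, hp]
    simp [leftMul, ent, Matrix.mul_apply]

theorem lieDeriv_C (Z : Matrix (Fin N) (Fin N) ℂ) (r : ℂ) : lieDeriv Z (C r) = 0 :=
  (lieDeriv Z).map_algebraMap r

theorem lieDeriv_mul (Z : Matrix (Fin N) (Fin N) ℂ) (p q : MvPolynomial (Fin N × Fin N) ℂ) :
    lieDeriv Z (p * q) = lieDeriv Z p * q + p * lieDeriv Z q := by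
  rw [Derivation.leibniz, smul_eq_mul, smul_eq_mul]; ring

theorem lieDeriv_rightMul (Z M : Matrix (Fin N) (Fin N) ℂ)
    (p : MvPolynomial (Fin N × Fin N) ℂ) :
    lieDeriv Z (rightMul M p) = rightMul M (lieDeriv Z p) := by
  induction p using MvPolynomial.induction_on with
  | C r => rw [lieDeriv_C, map_zero, rightMul, aeval_C]; exact lieDeriv_C Z r
  | add p q hp hq => simp only [map_add, hp, hq]
  | mul_X p i hp =>
    rw [map_mul, lieDeriv_mul, lieDeriv_mul, map_add, map_mul, map_mul, hp]
    congr 2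
    simp only [rightMul, lieDeriv_X, aeval_X, map_sum, map_mul, algHom_C,
      algebraMap_eq, lieDeriv_mul, lieDeriv_C, mul_zero, add_zero, Finset.mul_sum, Finset.sum_mul]
    rw [Finset.sum_comm]
    refine Finset.sum_congr rfl fun k _ => Finset.sum_congr rfl fun l _ => ?_
    ring

theorem lieDeriv_leftMul {Z Z' M : Matrix (Fin N) (Fin N) ℂ} (h : M * Z = Z' * M)
    (p : MvPolynomial (Fin N × Fin N) ℂ) :
    lieDeriv Z (leftMul M p) = leftMul M (lieDeriv Z' p) := by
  induction p using MvPolynomial.induction_on with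
  | C r => rw [lieDeriv_C, map_zero, leftMul, aeval_C]; exact lieDeriv_C Z r
  | add p q hp hq => simp only [map_add, hp, hq]
  | mul_X p i hp =>
    rw [map_mul, lieDeriv_mul, lieDeriv_mul, map_add, map_mul, map_mul, hp]
    congr 2
    refine eq_of_eval_ent fun Y => ?_
    have h2 : (M * Z * Y) i.1 i.2 = (Z' * (M * Y)) i.1 i.2 := by rw [h, mul_assoc]
    rw [eval_leftMul, lieDeriv_X, map_sum]
    simp only [map_mul, eval_C, eval_X]
    rw [leftMul, aeval_X, map_sum]
    simp only [lieDeriv_mul, lieDeriv_C, zero_mul, zero_add, lieDeriv_X]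
    rw [mul_assoc, Matrix.mul_apply, Matrix.mul_apply] at h2
    simpa [ent, Matrix.mul_apply] using h2

variable {R : Matrix (Fin d) (Fin d) (MvPolynomial (Fin N × Fin N) ℂ)} {v : Fin d → ℂ}
  {lam : Fin N → ℕ}

/-- The action of the Lie algebra. -/
def lieAct (R : Matrix (Fin d) (Fin d) (MvPolynomial (Fin N × Fin N) ℂ))
    (Z : Matrix (Fin N) (Fin N) ℂ) : Matrix (Fin d) (Fin d) ℂ := ev (R.map (lieDeriv Z)) 1

theorem lieAct_apply (Z : Matrix (Fin N) (Fin N) ℂ) (i j : Fin d) :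
    lieAct R Z i j = eval (ent 1) (lieDeriv Z (R i j)) := rfl

theorem lieAct_add (Z W : Matrix (Fin N) (Fin N) ℂ) :
    lieAct R (Z + W) = lieAct R Z + lieAct R W := by
  ext i j
  simp [lieAct_apply, lieDeriv_add]

theorem lieAct_smul (r : ℂ) (Z : Matrix (Fin N) (Fin N) ℂ) :
    lieAct R (r • Z) = r • lieAct R Z := by
  ext i j
  simp [lieAct_apply, lieDeriv_smul]

/-- The action of the Lie algebra as a linear map. -/
def lieActHom (R : Matrix (Fin d) (Fin d) (MvPolynomial (Fin N × Fin N) ℂ)) :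
    Matrix (Fin N) (Fin N) ℂ →ₗ[ℂ] Matrix (Fin d) (Fin d) ℂ where
  toFun := lieAct R
  map_add' := lieAct_add
  map_smul' := lieAct_smul

theorem IsHighestRep.rightMul_apply (h : IsHighestRep R v lam) (M : Matrix (Fin N) (Fin N) ℂ)
    (i j : Fin d) : rightMul M (R i j) = ∑ k, R i k * C (ev R M k j) := by
  refine eq_of_eval_ent fun M' => ?_
  rw [eval_rightMul, ← ev_apply, h.mul, Matrix.mul_apply, map_sum]
  simp [ev_apply]

theorem IsHighestRep.leftMul_apply (h : IsHighestRep R v lam) (M : Matrix (Fin N) (Fin N) ℂ)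
    (i j : Fin d) : leftMul M (R i j) = ∑ k, C (ev R M i k) * R k j := by
  refine eq_of_eval_ent fun M' => ?_
  rw [eval_leftMul, ← ev_apply, h.mul, Matrix.mul_apply, map_sum]
  simp [ev_apply]

theorem IsHighestRep.eval_lieDeriv (h : IsHighestRep R v lam) (Z M : Matrix (Fin N) (Fin N) ℂ)
    (i j : Fin d) : eval (ent M) (lieDeriv Z (R i j)) = (lieAct R Z * ev R M) i j := by
  have h1 := congrArg (fun p => eval (ent 1) (lieDeriv Z p)) (h.rightMul_apply M i j)
  simp only [lieDeriv_rightMul, eval_rightMul, one_mul, map_sum, lieDeriv_mul, lieDeriv_C,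
    mul_zero, add_zero, map_mul, eval_C] at h1
  exact h1

theorem IsHighestRep.lieDeriv_apply (h : IsHighestRep R v lam) (Z : Matrix (Fin N) (Fin N) ℂ)
    (i j : Fin d) : lieDeriv Z (R i j) = ∑ k, C (lieAct R Z i k) * R k j := by
  refine eq_of_eval_ent fun M => ?_
  rw [h.eval_lieDeriv, Matrix.mul_apply, map_sum]
  simp [ev_apply]

theorem IsHighestRep.ev_mul_lieAct (h : IsHighestRep R v lam) {Z Z' M : Matrix (Fin N) (Fin N) ℂ}
    (hM : M * Z = Z' * M) : ev R M * lieAct R Z = lieAct R Z' * ev R M := by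
  ext i j
  have h1 := congrArg (fun p => eval (ent 1) (lieDeriv Z p)) (h.leftMul_apply M i j)
  simp only [lieDeriv_leftMul hM, eval_leftMul, mul_one, map_sum, lieDeriv_mul, lieDeriv_C,
    zero_mul, zero_add, map_mul, eval_C, h.eval_lieDeriv] at h1
  rw [h1, Matrix.mul_apply]
  simp [h.one]

/-- The order is reversed twice: left-multiplication derivations compose in the opposite order to
the matrices, and so do their values at 1 on the matrix coefficients. -/
theorem IsHighestRep.lieAct_commutator (h : IsHighestRep R v lam)
    (Z W : Matrix (Fin N) (Fin N) ℂ) :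
    lieAct R Z * lieAct R W - lieAct R W * lieAct R Z = lieAct R (Z * W - W * Z) := by
  have hX : ∀ Z W : Matrix (Fin N) (Fin N) ℂ, ∀ i, lieDeriv W (lieDeriv Z (X i)) =
      lieDeriv (Z * W) (X i) := by
    intro Z W i
    refine eq_of_eval_ent fun Y => ?_
    have h2 : (Z * (W * Y)) i.1 i.2 = (Z * W * Y) i.1 i.2 := by rw [mul_assoc]
    rw [Matrix.mul_apply, Matrix.mul_apply] at h2
    rw [lieDeriv_X, lieDeriv_X, map_sum, map_sum, map_sum]
    simp only [lieDeriv_mul, lieDeriv_C, zero_mul, zero_add, map_mul, eval_C, eval_X]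
    refine Eq.trans (Finset.sum_congr rfl fun k _ => ?_) h2
    rw [lieDeriv_X, map_sum, Matrix.mul_apply]
    simp [ent]
  have hD : ∀ p, lieDeriv W (lieDeriv Z p) - lieDeriv Z (lieDeriv W p) =
      lieDeriv (Z * W - W * Z) p := by
    intro p
    induction p using MvPolynomial.induction_on with
    | C r => simp only [lieDeriv_C, map_zero, sub_zero]
    | add p q hp hq => simp only [map_add, ← hp, ← hq]; ring
    | mul_X p i hp =>
      have e : lieDeriv (Z * W - W * Z) (X i) =
          lieDeriv W (lieDeriv Z (X i)) - lieDeriv Z (lieDeriv W (X i)) := by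
        rw [hX, hX, sub_eq_add_neg (Z * W), ← neg_one_smul ℂ (W * Z), lieDeriv_add, lieDeriv_smul,
          Derivation.add_apply, Derivation.smul_apply, neg_one_smul, sub_eq_add_neg]
      rw [lieDeriv_mul, lieDeriv_mul, lieDeriv_mul, ← hp, e]
      simp only [map_add, lieDeriv_mul]
      ring
  have key : ∀ Z W : Matrix (Fin N) (Fin N) ℂ, ∀ i j,
      eval (ent 1) (lieDeriv W (lieDeriv Z (R i j))) = (lieAct R Z * lieAct R W) i j := by
    intro Z W i j
    rw [h.lieDeriv_apply Z]
    simp only [map_sum, lieDeriv_mul, lieDeriv_C, zero_mul, zero_add, map_mul, eval_C]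
    rfl
  ext i j
  rw [Matrix.sub_apply, ← key, ← key, lieAct_apply, ← hD, map_sub]

theorem IsHighestRep.eq_zero_of_dense (h : IsHighestRep R v lam) {A : Matrix (Fin d) (Fin d) ℂ}
    {r : MvPolynomial (Fin N × Fin N) ℂ} (hr : r ≠ 0)
    (hA : ∀ M, M.det ≠ 0 → eval (ent M) r ≠ 0 → A *ᵥ (ev R M *ᵥ v) = 0) : A = 0 := by
  refine h.cyclic A fun M _ => ?_
  funext i
  have hp : ∀ M, (A *ᵥ (ev R M *ᵥ v)) i =
      eval (ent M) (∑ j, C (A i j) * ∑ k, R j k * C (v k)) := by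
    intro M
    simp [mulVec, dotProduct, ev_apply]
  have h0 : (∑ j, C (A i j) * ∑ k, R j k * C (v k)) = 0 := by
    refine eq_of_eval_ent_of_ne (mul_ne_zero hr (det_genMat_ne_zero (N := N))) fun M hM => ?_
    rw [map_mul, eval_ent_det] at hM
    rw [← hp, hA M (right_ne_zero_of_mul hM) (left_ne_zero_of_mul hM), map_zero]
    rfl
  rw [hp, h0, map_zero]
  rfl

/-- This takes the place of Schur's lemma: A - κ kills the cyclic vector and commutes with the
action, so it kills the whole orbit. -/
theorem IsHighestRep.eq_smul_one (h : IsHighestRep R v lam) {A : Matrix (Fin d) (Fin d) ℂ} {κ : ℂ}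
    (hA : ∀ M, M.det ≠ 0 → ev R M * A = A * ev R M) (hv : A *ᵥ v = κ • v) : A = κ • 1 := by
  refine sub_eq_zero.1 (h.cyclic _ fun M hM => ?_)
  rw [mulVec_mulVec, sub_mul, ← hA M hM, smul_mul_assoc, one_mul, sub_mulVec, ← mulVec_mulVec, hv,
    mulVec_smul, smul_mulVec, sub_self]

theorem lieAct_mulVec {Z : Matrix (Fin N) (Fin N) ℂ} {φ : ℝ → ℂ} {φ' : ℂ} (hφ : HasDerivAt φ φ' 0)
    (hv : ∀ᶠ s : ℝ in nhds 0, ev R (1 + (s : ℂ) • Z) *ᵥ v = φ s • v) :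
    lieAct R Z *ᵥ v = φ' • v := by
  funext i
  have h1 : ∀ j, HasDerivAt (fun s : ℝ => ev R (1 + (s : ℂ) • Z) i j) (lieAct R Z i j) 0 := by
    intro j
    have := hasDerivAt_aeval (A := ℂ) (lieDeriv Z)
      (fun ij s => (1 + (s : ℂ) • Z) ij.1 ij.2) 0 (fun ij => by
        rw [lieDeriv_X]
        have e : HasDerivAt (fun s : ℝ => (1 : Matrix (Fin N) (Fin N) ℂ) ij.1 ij.2 +
            (s : ℂ) * Z ij.1 ij.2) (Z ij.1 ij.2) 0 := by
          simpa using ((Complex.ofRealCLM.hasDerivAt (x := (0 : ℝ))).mul_const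
            (Z ij.1 ij.2)).const_add ((1 : Matrix (Fin N) (Fin N) ℂ) ij.1 ij.2)
        simpa [Matrix.one_apply] using e) (R i j)
    have e0 : (1 + ((0 : ℝ) : ℂ) • Z) = 1 := by simp
    simp only [e0] at this
    exact this
  have h2 : HasDerivAt (fun s : ℝ => (ev R (1 + (s : ℂ) • Z) *ᵥ v) i) ((lieAct R Z *ᵥ v) i) 0 := by
    simp only [mulVec, dotProduct]
    exact HasDerivAt.fun_sum fun j _ => (h1 j).mul_const _
  have h3 : HasDerivAt (fun s : ℝ => (φ s • v) i) ((φ' • v) i) 0 := by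
    simpa using hφ.mul_const (v i)
  exact h2.unique (h3.congr_of_eventuallyEq (hv.mono fun s hs => congrFun hs i))

end HighestRep

end ThreeArch
end

/-! ### The Casimir element of a highest weight representation -/

noncomputable section

namespace ThreeArch

open Matrix MvPolynomial

section Casimir

variable {N d : ℕ} {R : Matrix (Fin d) (Fin d) (MvPolynomial (Fin N × Fin N) ℂ)} {v : Fin d → ℂ}
  {lam : Fin N → ℕ}

theorem blockTriangular_one_add_single {i j : Fin N} (hij : i ≤ j) (s : ℂ) :
    (1 + s • single i j (1 : ℂ)).BlockTriangular id := by
  intro k l hkl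
  have hkl' : l < k := hkl
  have h1 : ¬ (i = k ∧ j = l) := by
    rintro ⟨rfl, rfl⟩
    exact absurd hij (not_le.2 hkl')
  simp [hkl'.ne', h1]

theorem IsHighestRep.lieAct_single_lt (h : IsHighestRep R v lam) {i j : Fin N} (hij : i < j) :
    lieAct R (single i j 1) *ᵥ v = 0 := by
  have hd : ∀ (s : ℂ) k, (1 + s • single i j (1 : ℂ)) k k = 1 := by
    intro s k
    have : ¬ (i = k ∧ j = k) := by rintro ⟨rfl, rfl⟩; exact lt_irrefl _ hij
    simp [this]
  have := lieAct_mulVec (R := R) (v := v) (Z := single i j 1) (hasDerivAt_const (0 : ℝ) (1 : ℂ))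
    (Filter.Eventually.of_forall fun s => by
      rw [h.highest _ _ (blockTriangular_one_add_single hij.le _)]
      · simp only [hd, one_pow, Finset.prod_const_one]
      · rw [det_of_isUpperTriangular (blockTriangular_one_add_single hij.le _)]
        simp only [hd, Finset.prod_const_one]
        exact one_ne_zero)
  simpa using this

theorem IsHighestRep.lieAct_single_self (h : IsHighestRep R v lam) (i : Fin N) :
    lieAct R (single i i 1) *ᵥ v = (lam i : ℂ) • v := by
  have hd : ∀ (s : ℂ) k, (1 + s • single i i (1 : ℂ)) k k = if k = i then 1 + s else 1 := by
    intro s k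
    by_cases hk : k = i
    · subst hk; simp
    · simp [hk, Ne.symm hk]
  have hφ : HasDerivAt (fun s : ℝ => (1 + (s : ℂ)) ^ lam i) (lam i : ℂ) 0 := by
    have h1 : HasDerivAt (fun s : ℝ => 1 + (s : ℂ)) 1 0 := by
      simpa using (Complex.ofRealCLM.hasDerivAt (x := (0 : ℝ))).const_add 1
    simpa using h1.fun_pow (lam i)
  refine lieAct_mulVec hφ ?_
  have hne : ∀ᶠ s : ℝ in nhds 0, (1 + (s : ℂ)) ≠ 0 := by
    have hc : Continuous fun s : ℝ => 1 + (s : ℂ) := by fun_prop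
    exact hc.continuousAt.eventually_ne (by simp)
  filter_upwards [hne] with s hs
  rw [h.highest _ _ (blockTriangular_one_add_single le_rfl _)]
  · simp only [hd, ite_pow, one_pow, Finset.prod_ite_eq', Finset.mem_univ, if_true]
  · rw [det_of_isUpperTriangular (blockTriangular_one_add_single le_rfl _)]
    simp only [hd, Finset.prod_ite_eq', Finset.mem_univ, if_true]
    exact hs

/-- One half of the invariance of the tensor Σ E_ij ⊗ E_ji under conjugation: a matrix on the left
of the first factor may be moved to the right of the second elementary matrix. -/
theorem sum_single_left {V : Type*} [AddCommGroup V] [Module ℂ V]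
    (B : Matrix (Fin N) (Fin N) ℂ →ₗ[ℂ] Matrix (Fin N) (Fin N) ℂ →ₗ[ℂ] V)
    (A D : Matrix (Fin N) (Fin N) ℂ) :
    ∑ i, ∑ j, B (A * single i j 1) (single j i 1 * D) =
      ∑ i, ∑ j, B (single i j 1) (single j i 1 * A * D) := by
  have h1 : ∀ i j, A * single i j 1 = ∑ k, A k i • single k j (1 : ℂ) := by
    intro i j
    ext k l
    simp [Matrix.mul_apply, Matrix.single_apply, Matrix.sum_apply, ite_and]
  have h2 : ∀ i j, single j i 1 * A = ∑ k, A i k • single j k (1 : ℂ) := by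
    intro i j
    ext k l
    simp [Matrix.mul_apply, Matrix.single_apply, Matrix.sum_apply, ite_and]
  simp only [h1, h2, map_sum, map_smul, LinearMap.sum_apply, LinearMap.smul_apply, Finset.sum_mul,
    smul_mul_assoc]
  rw [Finset.sum_comm]
  conv_rhs => rw [Finset.sum_comm]
  exact Finset.sum_congr rfl fun j _ => Finset.sum_comm

theorem sum_single_right {V : Type*} [AddCommGroup V] [Module ℂ V]
    (B : Matrix (Fin N) (Fin N) ℂ →ₗ[ℂ] Matrix (Fin N) (Fin N) ℂ →ₗ[ℂ] V)
    (A D : Matrix (Fin N) (Fin N) ℂ) :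
    ∑ i, ∑ j, B (single i j 1 * A) (D * single j i 1) =
      ∑ i, ∑ j, B (single i j 1) (D * (A * single j i 1)) := by
  have h1 : ∀ i j, A * single j i 1 = ∑ k, A k j • single k i (1 : ℂ) := by
    intro i j
    ext k l
    simp [Matrix.mul_apply, Matrix.single_apply, Matrix.sum_apply, ite_and]
  have h2 : ∀ i j, single i j 1 * A = ∑ k, A j k • single i k (1 : ℂ) := by
    intro i j
    ext k l
    simp [Matrix.mul_apply, Matrix.single_apply, Matrix.sum_apply, ite_and]
  simp only [h1, h2, map_sum, map_smul, LinearMap.sum_apply, LinearMap.smul_apply, Finset.mul_sum,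
    mul_smul_comm]
  exact Finset.sum_congr rfl fun j _ => Finset.sum_comm

/-- The Casimir element. -/
def casimirAct (R : Matrix (Fin d) (Fin d) (MvPolynomial (Fin N × Fin N) ℂ)) :
    Matrix (Fin d) (Fin d) ℂ :=
  ∑ i, ∑ j, lieAct R (single i j 1) * lieAct R (single j i 1)

theorem IsHighestRep.ev_mul_casimirAct (h : IsHighestRep R v lam) {M : Matrix (Fin N) (Fin N) ℂ}
    (hM : M.det ≠ 0) : ev R M * casimirAct R = casimirAct R * ev R M := by
  have hu : IsUnit M.det := isUnit_iff_ne_zero.2 hM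
  have h1 : ∀ Z, ev R M * lieAct R Z = lieAct R (M * Z * M⁻¹) * ev R M := fun Z =>
    h.ev_mul_lieAct (by rw [mul_assoc, nonsing_inv_mul _ hu, mul_one])
  let B : Matrix (Fin N) (Fin N) ℂ →ₗ[ℂ] Matrix (Fin N) (Fin N) ℂ →ₗ[ℂ]
      Matrix (Fin d) (Fin d) ℂ := (LinearMap.mul ℂ (Matrix (Fin d) (Fin d) ℂ)).compl₁₂
        (lieActHom R) (lieActHom R)
  have hB : ∀ Z W, B Z W = lieAct R Z * lieAct R W := fun Z W => rfl
  have h2 : ∑ i, ∑ j, B (M * single i j 1 * M⁻¹) (M * single j i 1 * M⁻¹) = casimirAct R := by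
    have e1 := sum_single_left (B.compl₁₂ (LinearMap.mulRight ℂ M⁻¹) (LinearMap.mulLeft ℂ M)) M M⁻¹
    have e2 := sum_single_right B M⁻¹ M
    simp only [LinearMap.compl₁₂_apply, LinearMap.mulRight_apply, LinearMap.mulLeft_apply,
      mul_assoc, mul_nonsing_inv _ hu, mul_one] at e1
    simp only [← mul_assoc, mul_nonsing_inv _ hu, one_mul] at e2
    simp only [← mul_assoc] at e1
    rw [e1, e2]
    rfl
  refine Eq.trans ?_ (congrArg (· * ev R M) h2)
  simp only [casimirAct, Finset.mul_sum, Finset.sum_mul, hB]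
  refine Finset.sum_congr rfl fun i _ => Finset.sum_congr rfl fun j _ => ?_
  rw [← mul_assoc, h1, mul_assoc, h1, ← mul_assoc]

/-- The Casimir element commutes with the group, so its value on v suffices. For i > j the operator
E_ji raises weights and kills v; for i < j the product E_ij E_ji acts on v as the commutator E_ii -
E_jj. -/
theorem IsHighestRep.casimirAct_eq (h : IsHighestRep R v lam) :
    casimirAct R = (∑ i, ∑ j, if i = j then (lam i : ℂ) ^ 2 else
      if i < j then (lam i : ℂ) - lam j else 0) • 1 := by
  refine h.eq_smul_one (fun M hM => h.ev_mul_casimirAct hM) ?_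
  rw [casimirAct, sum_mulVec, Finset.sum_smul]
  refine Finset.sum_congr rfl fun i _ => ?_
  rw [sum_mulVec, Finset.sum_smul]
  refine Finset.sum_congr rfl fun j _ => ?_
  rcases lt_trichotomy i j with hij | rfl | hij
  · rw [if_neg hij.ne, if_pos hij]
    have h1 := h.lieAct_commutator (single i j 1) (single j i 1)
    rw [single_mul_single_same, single_mul_single_same, mul_one] at h1
    have h2 : lieAct R (single i i 1 - single j j 1) =
        lieAct R (single i i 1) - lieAct R (single j j 1) := (lieActHom R).map_sub _ _
    rw [h2, sub_eq_iff_eq_add] at h1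
    rw [h1, add_mulVec, sub_mulVec, h.lieAct_single_self, h.lieAct_single_self, ← mulVec_mulVec,
      h.lieAct_single_lt hij, mulVec_zero, add_zero, sub_smul]
  · rw [if_pos rfl, ← mulVec_mulVec, h.lieAct_single_self, mulVec_smul, h.lieAct_single_self,
      smul_smul, sq]
  · rw [if_neg hij.ne', if_neg hij.not_gt, ← mulVec_mulVec, h.lieAct_single_lt hij, mulVec_zero,
      zero_smul]

theorem IsHighestRep.sum_lieAct_single (h : IsHighestRep R v lam) :
    ∑ i, lieAct R (single i i 1) = (∑ i, (lam i : ℂ)) • 1 := by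
  refine h.eq_smul_one (fun M hM => ?_) ?_
  · have h1 : ∑ i, lieAct R (single i i 1) = lieAct R 1 := by
      change ∑ i, lieActHom R (single i i 1) = lieActHom R 1
      rw [← map_sum, sum_single_one]
    rw [h1]
    exact h.ev_mul_lieAct (by rw [mul_one, one_mul])
  · rw [sum_mulVec, Finset.sum_smul]
    exact Finset.sum_congr rfl fun i _ => h.lieAct_single_self i

/-! ### The character -/

/-- Restriction to diagonal matrices. -/
def diagHom (N : ℕ) : MvPolynomial (Fin N × Fin N) ℂ →ₐ[ℂ] MvPolynomial (Fin N) ℂ :=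
  aeval fun ij => if ij.1 = ij.2 then X ij.1 else 0

theorem eval_diagHom (x : Fin N → ℂ) (p : MvPolynomial (Fin N × Fin N) ℂ) :
    eval x (diagHom N p) = eval (ent (diagonal x)) p := by
  induction p using MvPolynomial.induction_on with
  | C r => simp [diagHom]
  | add p q hp hq => simp only [map_add, hp, hq]
  | mul_X p i hp =>
    rw [map_mul, map_mul, map_mul, hp]
    simp only [diagHom, aeval_X, eval_X, ent, diagonal_apply]
    split_ifs <;> simp

/-- Along diagonal matrices, multiplication by 1 + sE_kk scales the k-th eigenvalue. -/
theorem euler_diagHom (k : Fin N) (p : MvPolynomial (Fin N × Fin N) ℂ) :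
    euler k (diagHom N p) = diagHom N (lieDeriv (single k k 1) p) := by
  have hX : ∀ i j, euler k (diagHom N (X (i, j))) =
      diagHom N (lieDeriv (single k k 1) (X (i, j))) := by
    intro i j
    refine MvPolynomial.funext fun x => ?_
    rw [eval_diagHom, lieDeriv_X, map_sum, diagHom, aeval_X]
    simp only [map_mul, eval_C, eval_X, ent]
    rw [Finset.sum_eq_single j]
    · by_cases hij : i = j
      · subst hij
        rw [if_pos rfl, euler_apply, pderiv_X]
        by_cases hk : i = k
        · subst hk; simp
        · simp [hk, Ne.symm hk]
      · have : ¬ (k = i ∧ k = j) := by rintro ⟨rfl, rfl⟩; exact hij rfl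
        simp [hij, this]
    · intro l _ hl
      simp [hl]
    · simp
  induction p using MvPolynomial.induction_on with
  | C r =>
    rw [lieDeriv_C, map_zero, diagHom, aeval_C]
    exact (euler k).map_algebraMap r
  | add p q hp hq => simp only [map_add, hp, hq]
  | mul_X p i hp =>
    rw [map_mul, Derivation.leibniz, lieDeriv_mul, map_add, map_mul, map_mul, hp, hX, smul_eq_mul,
      smul_eq_mul]
    ring

/-- The character, as a polynomial in the eigenvalues. -/
def character (R : Matrix (Fin d) (Fin d) (MvPolynomial (Fin N × Fin N) ℂ)) :
    MvPolynomial (Fin N) ℂ := diagHom N R.trace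

theorem eval_character (x : Fin N → ℂ) : eval x (character R) = (ev R (diagonal x)).trace := by
  rw [character, eval_diagHom]
  simp [Matrix.trace, ev_apply]

theorem IsHighestRep.eval_euler_character (h : IsHighestRep R v lam) (k : Fin N) (x : Fin N → ℂ) :
    eval x (euler k (character R)) = (lieAct R (single k k 1) * ev R (diagonal x)).trace := by
  rw [character, euler_diagHom, eval_diagHom, Matrix.trace, map_sum, map_sum]
  exact Finset.sum_congr rfl fun i _ => h.eval_lieDeriv _ _ _ _

theorem IsHighestRep.eval_euler_euler_character (h : IsHighestRep R v lam) (k : Fin N)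
    (x : Fin N → ℂ) :
    eval x (euler k (euler k (character R))) =
      (lieAct R (single k k 1) * lieAct R (single k k 1) * ev R (diagonal x)).trace := by
  rw [character, euler_diagHom, euler_diagHom, eval_diagHom, Matrix.trace, map_sum, map_sum,
    map_sum]
  refine Finset.sum_congr rfl fun i _ => ?_
  rw [diag_apply, h.lieDeriv_apply]
  simp only [map_sum, lieDeriv_mul, lieDeriv_C, zero_mul, zero_add, map_mul, eval_C,
    h.eval_lieDeriv]
  rw [diag_apply, mul_assoc, Matrix.mul_apply]

theorem IsHighestRep.sum_euler_character (h : IsHighestRep R v lam) :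
    ∑ k, euler k (character R) = C (∑ i, (lam i : ℂ)) * character R := by
  refine MvPolynomial.funext fun x => ?_
  rw [map_sum, map_mul, eval_C]
  simp only [h.eval_euler_character, eval_character]
  rw [← Matrix.trace_sum, ← Finset.sum_mul, h.sum_lieAct_single, smul_mul_assoc, one_mul,
    Matrix.trace_smul, smul_eq_mul]

/-- The radial part of the Casimir operator. For T the action of diag(x) and S_ij = tr(E_ij E_ji T),
moving T through E_ij gives x_j S_ij = x_i S_ji, and the commutator gives S_ij - S_ji as a
difference of Euler derivatives. For distinct x these two equations determine S_ij when i ≠ j, and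
S_ii is a second Euler derivative. -/
theorem IsHighestRep.casimir_character (h : IsHighestRep R v lam) (x : Fin N → ℂ)
    (hx : Function.Injective x) :
    ∑ k, eval x (euler k (euler k (character R))) +
      ∑ k, ∑ l ∈ Finset.univ.erase k, (x l + x k) / (x k - x l) *
        eval x (euler k (character R)) =
    (∑ i, ∑ j, if i = j then (lam i : ℂ) ^ 2 else
      if i < j then (lam i : ℂ) - lam j else 0) * eval x (character R) := by
  set T := ev R (diagonal x) with hT
  set S : Fin N → Fin N → ℂ := fun i j =>
    (lieAct R (single i j 1) * lieAct R (single j i 1) * T).trace with hS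
  set E : Fin N → ℂ := fun i => eval x (euler i (character R)) with hE
  have h1 : ∑ i, ∑ j, S i j = (∑ i, ∑ j, if i = j then (lam i : ℂ) ^ 2 else
      if i < j then (lam i : ℂ) - lam j else 0) * eval x (character R) := by
    have := congrArg (fun A => (A * T).trace) h.casimirAct_eq
    simp only [casimirAct, Finset.sum_mul, Matrix.trace_sum, smul_mul_assoc, one_mul,
      Matrix.trace_smul, smul_eq_mul] at this
    rw [eval_character]
    simp only [Finset.sum_mul]
    exact this
  have h2 : ∀ i j, x j * S i j = x i * S j i := by
    intro i j
    have hc : T * lieAct R (x j • single i j 1) = lieAct R (x i • single i j 1) * T := by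
      refine h.ev_mul_lieAct ?_
      ext k l
      simp only [diagonal_mul, mul_diagonal, Matrix.smul_apply, Matrix.single_apply, smul_eq_mul]
      split_ifs with hkl
      · obtain ⟨rfl, rfl⟩ := hkl; ring
      · ring
    rw [lieAct_smul, lieAct_smul, Matrix.mul_smul, Matrix.smul_mul] at hc
    have e1 : x j * S i j = ((x j • (T * lieAct R (single i j 1))) * lieAct R (single j i 1)).trace := by
      rw [Matrix.smul_mul, Matrix.trace_smul, smul_eq_mul, hS, mul_assoc T,
        Matrix.trace_mul_comm T]
    rw [e1, hc, Matrix.smul_mul, Matrix.trace_smul, smul_eq_mul, mul_assoc, Matrix.trace_mul_comm,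
      mul_assoc, Matrix.trace_mul_comm]
  have h3 : ∀ i j, S i j - S j i = E i - E j := by
    intro i j
    have hc := congrArg (fun A => (A * T).trace)
      (h.lieAct_commutator (single i j 1) (single j i 1))
    have e2 : lieAct R (single i i 1 - single j j 1) =
        lieAct R (single i i 1) - lieAct R (single j j 1) := (lieActHom R).map_sub _ _
    simp only [single_mul_single_same, mul_one, e2, sub_mul, Matrix.trace_sub] at hc
    rw [hE]
    simp only [h.eval_euler_character]
    exact hc
  have h4 : ∀ i j, i ≠ j → S i j = x i / (x i - x j) * E i - x i / (x i - x j) * E j := by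
    intro i j hij
    have hne : x i - x j ≠ 0 := sub_ne_zero.2 fun e => hij (hx e)
    field_simp
    linear_combination x i * h3 i j - h2 i j
  have h5 : ∀ i, eval x (euler i (euler i (character R))) = S i i := fun i =>
    h.eval_euler_euler_character i x
  rw [← h1]
  have h6 : ∑ i, ∑ j, S i j = ∑ i, S i i + ∑ i, ∑ j ∈ Finset.univ.erase i,
      (x i / (x i - x j) * E i - x i / (x i - x j) * E j) := by
    rw [← Finset.sum_add_distrib]
    refine Finset.sum_congr rfl fun i _ => ?_
    rw [← Finset.add_sum_erase _ _ (Finset.mem_univ i)]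
    congr 1
    exact Finset.sum_congr rfl fun j hj => h4 i j (Finset.ne_of_mem_erase hj).symm
  have h7 : ∑ i, ∑ j ∈ Finset.univ.erase i, x i / (x i - x j) * E j =
      ∑ i, ∑ j ∈ Finset.univ.erase i, x j / (x j - x i) * E i :=
    Finset.sum_comm' (by simp [eq_comm])
  rw [h6, Finset.sum_congr rfl fun i _ => h5 i]
  congr 1
  simp only [Finset.sum_sub_distrib]
  rw [h7, ← Finset.sum_sub_distrib]
  refine Finset.sum_congr rfl fun i _ => ?_
  rw [← Finset.sum_sub_distrib]
  refine Finset.sum_congr rfl fun j hj => ?_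
  rw [← neg_sub (x i) (x j), div_neg]
  ring

/-- Permuting the eigenvalues is conjugation by a permutation matrix, which does not change the
trace. -/
theorem IsHighestRep.rename_character (h : IsHighestRep R v lam) (σ : Equiv.Perm (Fin N)) :
    rename σ (character R) = character R := by
  refine MvPolynomial.funext fun x => ?_
  rw [eval_rename, eval_character, eval_character]
  have h1 : diagonal (x ∘ σ) = (1 : Matrix (Fin N) (Fin N) ℂ).submatrix σ (Equiv.refl _) *
      diagonal x * (1 : Matrix (Fin N) (Fin N) ℂ).submatrix (Equiv.refl _) σ := by
    rw [one_submatrix_mul, mul_submatrix_one]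
    ext i j
    simp [diagonal_apply]
  have h2 : (1 : Matrix (Fin N) (Fin N) ℂ).submatrix (Equiv.refl _) σ *
      (1 : Matrix (Fin N) (Fin N) ℂ).submatrix σ (Equiv.refl _) = 1 := by
    rw [submatrix_mul_equiv, mul_one]
    ext i j
    simp [Matrix.one_apply]
  rw [h1, h.mul, h.mul, Matrix.trace_mul_comm, ← mul_assoc, ← h.mul, h2, h.one, one_mul]

end Casimir

end ThreeArch
end

/-! ### Weight bounds by degeneration of matrices -/

noncomputable section

namespace ThreeArch

open Matrix MvPolynomial

section Weights

variable {N d : ℕ} {R : Matrix (Fin d) (Fin d) (MvPolynomial (Fin N × Fin N) ℂ)} {v : Fin d → ℂ}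
  {lam : Fin N → ℕ}

theorem coeff_mul_C_right {σ : Type*} (m : σ →₀ ℕ) (p : MvPolynomial σ ℂ) (r : ℂ) :
    coeff m (p * C r) = coeff m p * r := by
  rw [mul_comm, coeff_C_mul, mul_comm]

/-- The projection to the weight space of weight `μ`. -/
def weightProj (R : Matrix (Fin d) (Fin d) (MvPolynomial (Fin N × Fin N) ℂ)) (μ : Fin N →₀ ℕ) :
    Matrix (Fin d) (Fin d) ℂ := of fun i j => coeff μ (diagHom N (R i j))

theorem coeff_character (μ : Fin N →₀ ℕ) : coeff μ (character R) = (weightProj R μ).trace := by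
  simp [character, Matrix.trace, weightProj, coeff_sum]

/-- The weight projections are the coefficients of the action of diag(x); at x = (1, …, 1) they add
up to the identity. -/
theorem IsHighestRep.eq_of_weightProj (h : IsHighestRep R v lam) {w w' : Fin d → ℂ}
    (hw : ∀ μ, weightProj R μ *ᵥ w = weightProj R μ *ᵥ w') : w = w' := by
  funext i
  have h1 : ∑ j, diagHom N (R i j) * C (w j) = ∑ j, diagHom N (R i j) * C (w' j) := by
    ext μ
    rw [coeff_sum, coeff_sum]
    simp only [coeff_mul_C_right]
    exact congrFun (hw μ) i
  have h2 := congrArg (eval fun _ => 1) h1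
  simp only [map_sum, map_mul, eval_diagHom, eval_C, ← ev_apply, diagonal_one, h.one] at h2
  simpa [Matrix.one_apply] using h2

theorem coeff_aeval_C_mul_X (t : Fin N → ℂ) (p : MvPolynomial (Fin N) ℂ) (μ : Fin N →₀ ℕ) :
    coeff μ (aeval (fun k => C (t k) * X k) p : MvPolynomial (Fin N) ℂ) =
      coeff μ p * ∏ k, t k ^ μ k := by
  induction p using MvPolynomial.induction_on' with
  | monomial n r =>
    have h1 : (aeval (fun k => C (t k) * X k) (monomial n r) : MvPolynomial (Fin N) ℂ) =
        C (∏ k, t k ^ n k) * monomial n r := by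
      rw [aeval_monomial, monomial_eq, Finsupp.prod_fintype _ _ fun i => by simp,
        Finsupp.prod_fintype _ _ fun i => by simp, algebraMap_eq]
      simp only [mul_pow, Finset.prod_mul_distrib, map_prod, map_pow]
      ring
    rw [h1, coeff_C_mul, coeff_monomial]
    split_ifs with hn
    · rw [hn, mul_comm]
    · simp
  | add p q hp hq => rw [map_add, coeff_add, hp, hq, coeff_add, add_mul]

theorem IsHighestRep.weightProj_mul_ev (h : IsHighestRep R v lam) (μ : Fin N →₀ ℕ)
    (t : Fin N → ℂ) :
    weightProj R μ * ev R (diagonal t) = (∏ k, t k ^ μ k) • weightProj R μ := by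
  ext i l
  have h1 : ∑ j, diagHom N (R i j) * C (ev R (diagonal t) j l) =
      aeval (fun k => C (t k) * X k) (diagHom N (R i l)) := by
    refine MvPolynomial.funext fun x => ?_
    have h2 : eval x (aeval (fun k => C (t k) * X k) (diagHom N (R i l)) : MvPolynomial (Fin N) ℂ) =
        eval (fun k => x k * t k) (diagHom N (R i l)) := by
      rw [← coe_aeval_eq_eval, ← coe_aeval_eq_eval, RingHom.coe_coe, RingHom.coe_coe,
        ← AlgHom.comp_apply, comp_aeval]
      congr 2
      funext k
      simp [mul_comm]
    rw [h2, map_sum]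
    simp only [map_mul, eval_diagHom, eval_C, ← ev_apply]
    rw [← diagonal_mul_diagonal, h.mul, Matrix.mul_apply]
  have h3 := congrArg (coeff μ) h1
  rw [coeff_sum, coeff_aeval_C_mul_X] at h3
  simp only [coeff_mul_C_right] at h3
  rw [Matrix.smul_apply, smul_eq_mul, mul_comm (∏ k, _)]
  exact h3

/-- The diagonal matrix with entry `t` at `k` and `1` elsewhere. -/
def diagAt (k : Fin N) (t : ℂ) : Matrix (Fin N) (Fin N) ℂ := diagonal (Function.update 1 k t)

theorem prod_update_one_pow (k : Fin N) (t : ℂ) (μ : Fin N → ℕ) :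
    ∏ l, Function.update (1 : Fin N → ℂ) k t l ^ μ l = t ^ μ k := by
  rw [Finset.prod_eq_single k]
  · simp
  · intro l _ hl; simp [Function.update_of_ne hl]
  · simp

theorem IsHighestRep.weightProj_mul_ev_diagAt (h : IsHighestRep R v lam) (μ : Fin N →₀ ℕ)
    (k : Fin N) (t : ℂ) :
    weightProj R μ * ev R (diagAt k t) = t ^ μ k • weightProj R μ := by
  rw [diagAt, h.weightProj_mul_ev, prod_update_one_pow]

theorem det_diagAt (k : Fin N) (t : ℂ) : (diagAt k t).det = t := by
  rw [diagAt, det_diagonal]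
  simpa using prod_update_one_pow k t fun _ => 1

theorem IsHighestRep.ev_diagAt (h : IsHighestRep R v lam) (k : Fin N) {t : ℂ} (ht : t ≠ 0) :
    ev R (diagAt k t) *ᵥ v = t ^ lam k • v := by
  rw [h.highest (diagAt k t) (by rwa [det_diagAt]) (blockTriangular_diagonal _)]
  simp only [diagAt, diagonal_apply_eq, prod_update_one_pow]

theorem continuous_ev {P : ℂ → Matrix (Fin N) (Fin N) ℂ} (hP : ∀ i j, Continuous fun s => P s i j) :
    Continuous fun s => ev R (P s) :=
  continuous_matrix fun i j => (MvPolynomial.continuous_eval (R i j)).comp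
    (continuous_pi fun ij => hP ij.1 ij.2)

theorem eq_of_eq_of_ne_zero {α : Type*} [TopologicalSpace α] [T2Space α] {f g : ℂ → α}
    (hf : Continuous f) (hg : Continuous g) (h : ∀ s, s ≠ 0 → f s = g s) : f 0 = g 0 :=
  congrFun (hf.ext_on (dense_compl_singleton (0 : ℂ)) hg fun s hs => h s hs) 0

/-- No weight exceeds, in any coordinate, the first entry of the highest weight. It suffices to
treat M v for M with M_kz ≠ 0. An upper unipotent `u`, which fixes v, clears row k of M except in
column z. Then scaling row k of Mu by s⁻¹ equals scaling column z of a matrix P(s) by s⁻¹, where P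
is polynomial in s. Comparing the two actions, the μ-component of M v equals s^(μ_k - λ_z) times an
expression continuous in s, and it vanishes as s tends to 0. -/
theorem IsHighestRep.weightProj_eq_zero (h : IsHighestRep R v lam) (μ : Fin N →₀ ℕ)
    {k z : Fin N} (hz : ∀ i, z ≤ i) (hμ : lam z < μ k) : weightProj R μ = 0 := by
  refine h.eq_zero_of_dense (MvPolynomial.X_ne_zero (k, z)) fun M _ hkz => ?_
  rw [eval_X] at hkz
  have hkz : M k z ≠ 0 := hkz
  set u : Matrix (Fin N) (Fin N) ℂ := of fun i j =>
    if i = j then 1 else if i = z then -(M k j / M k z) else 0 with hu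
  have hut : u.BlockTriangular id := by
    intro i j hij
    have hij' : j < i := hij
    have hiz : i ≠ z := fun e => absurd (hz j) (not_le.2 (e ▸ hij'))
    rw [hu, of_apply, if_neg hij'.ne', if_neg hiz]
  have hud : ∀ i, u i i = 1 := fun i => by simp [hu]
  have huv : ev R u *ᵥ v = v := by
    rw [h.highest u _ hut]
    · simp [hud]
    · rw [det_of_isUpperTriangular hut]; simp [hud]
  have hMuz : ∀ i, (M * u) i z = M i z := by
    intro i
    rw [Matrix.mul_apply, Finset.sum_eq_single z]
    · rw [hud, mul_one]
    · intro l _ hl; simp [hu, hl]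
    · simp
  have hMuk : ∀ j, j ≠ z → (M * u) k j = 0 := by
    intro j hj
    rw [Matrix.mul_apply, Finset.sum_eq_add_of_mem z j (Finset.mem_univ _) (Finset.mem_univ _)
      hj.symm]
    · rw [hud]
      simp only [hu, of_apply, if_neg hj.symm, if_true]
      field_simp
      ring
    · intro l _ hl; simp [hu, hl.1, hl.2]
  let P : ℂ → Matrix (Fin N) (Fin N) ℂ := fun s => of fun i j =>
    if i = k then (if j = z then M k z else 0) else if j = z then M i z * s else (M * u) i j
  have hP : ∀ i j, Continuous fun s => P s i j := by
    intro i j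
    simp only [P, of_apply]
    split_ifs <;> fun_prop
  have key : ∀ s : ℂ, s ≠ 0 → weightProj R μ *ᵥ (ev R M *ᵥ v) =
      s ^ (μ k - lam z) • (weightProj R μ *ᵥ (ev R (P s) *ᵥ v)) := by
    intro s hs
    have e1 : diagAt k s⁻¹ * (M * u) = P s * diagAt z s⁻¹ := by
      ext i j
      simp only [diagAt, diagonal_mul, mul_diagonal, P, of_apply]
      by_cases hi : i = k
      · subst hi
        by_cases hj : j = z
        · subst hj; simp [hMuz, mul_comm]
        · simp [hj, hMuk j hj]
      · by_cases hj : j = z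
        · subst hj; simp [hi, hMuz, hs]
        · simp [hi, hj]
    have e2 : ev R (diagAt k s⁻¹) *ᵥ (ev R M *ᵥ v) = s⁻¹ ^ lam z • (ev R (P s) *ᵥ v) := by
      rw [← mulVec_smul, ← h.ev_diagAt z (inv_ne_zero hs)]
      conv_lhs => rw [← huv]
      rw [mulVec_mulVec, mulVec_mulVec, mulVec_mulVec, ← h.mul, ← h.mul, ← h.mul, mul_assoc, e1]
    have e3 := congrArg (fun w => weightProj R μ *ᵥ w) e2
    simp only [mulVec_smul] at e3
    rw [mulVec_mulVec, h.weightProj_mul_ev_diagAt, smul_mulVec] at e3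
    have e4 : s ^ μ k • s⁻¹ ^ μ k • (weightProj R μ *ᵥ (ev R M *ᵥ v)) =
        weightProj R μ *ᵥ (ev R M *ᵥ v) := by
      rw [smul_smul, ← mul_pow, mul_inv_cancel₀ hs, one_pow, one_smul]
    rw [← e4, e3, smul_smul]
    congr 1
    rw [← Nat.sub_add_cancel hμ.le, pow_add, Nat.add_sub_cancel, mul_assoc, ← mul_pow,
      mul_inv_cancel₀ hs, one_pow, mul_one]
  have := eq_of_eq_of_ne_zero (f := fun _ => weightProj R μ *ᵥ (ev R M *ᵥ v))
    (g := fun s => s ^ (μ k - lam z) • (weightProj R μ *ᵥ (ev R (P s) *ᵥ v))) continuous_const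
    (by
      have hc := continuous_ev (R := R) hP
      fun_prop) key
  rw [this, zero_pow (Nat.sub_pos_of_lt hμ).ne', zero_smul]

/-- Where the highest weight takes its top value, even lower triangular transvections fix v. In a
component with μ_j ≤ λ_j, conjugation by a diagonal matrix with entry t at j replaces r by tr at the
cost of t^(λ_j - μ_j), and t → 0 shows that the component does not depend on r. Components with
larger μ_j are zero by the weight bound. -/
theorem IsHighestRep.ev_one_add_single (h : IsHighestRep R v lam) {i j z : Fin N}
    (hz : ∀ i, z ≤ i) (hij : i ≠ j) (hj : lam j = lam z) (r : ℂ) :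
    ev R (1 + r • single j i 1) *ᵥ v = v := by
  refine h.eq_of_weightProj fun μ => ?_
  by_cases hμ : lam z < μ j
  · rw [h.weightProj_eq_zero μ hz hμ, zero_mulVec, zero_mulVec]
  have hle : μ j ≤ lam j := by rw [hj]; exact not_lt.1 hμ
  have key : ∀ t : ℂ, t ≠ 0 → ∀ r, weightProj R μ *ᵥ (ev R (1 + r • single j i 1) *ᵥ v) =
      t ^ (lam j - μ j) • (weightProj R μ *ᵥ (ev R (1 + (t * r) • single j i 1) *ᵥ v)) := by
    intro t ht r
    have e1 : diagAt j t * (1 + r • single j i 1) = (1 + (t * r) • single j i 1) * diagAt j t := by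
      rw [mul_add, add_mul, mul_one, one_mul]
      congr 1
      ext k l
      simp only [diagAt, diagonal_mul, mul_diagonal, Matrix.smul_apply, Matrix.single_apply,
        smul_eq_mul]
      split_ifs with hkl
      · obtain ⟨rfl, rfl⟩ := hkl
        simp [Function.update_of_ne hij]
      · simp
    have e2 : ev R (diagAt j t) *ᵥ (ev R (1 + r • single j i 1) *ᵥ v) =
        t ^ lam j • (ev R (1 + (t * r) • single j i 1) *ᵥ v) := by
      rw [← mulVec_smul, ← h.ev_diagAt j ht, mulVec_mulVec, mulVec_mulVec, ← h.mul, ← h.mul, e1]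
    have e3 := congrArg (fun w => weightProj R μ *ᵥ w) e2
    simp only [mulVec_smul] at e3
    rw [mulVec_mulVec, h.weightProj_mul_ev_diagAt, smul_mulVec] at e3
    have e4 : t ^ lam j = t ^ μ j * t ^ (lam j - μ j) := by
      rw [← pow_add, Nat.add_sub_cancel' hle]
    rw [e4, mul_smul] at e3
    exact smul_right_injective _ (pow_ne_zero (μ j) ht) e3
  have lim : ∀ r, weightProj R μ *ᵥ (ev R (1 + r • single j i 1) *ᵥ v) =
      (0 : ℂ) ^ (lam j - μ j) • (weightProj R μ *ᵥ (ev R (1 + ((0 : ℂ) * r) • single j i 1) *ᵥ v)) := by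
    intro r
    refine eq_of_eq_of_ne_zero (f := fun _ => weightProj R μ *ᵥ (ev R (1 + r • single j i 1) *ᵥ v))
      (g := fun t => t ^ (lam j - μ j) •
        (weightProj R μ *ᵥ (ev R (1 + (t * r) • single j i 1) *ᵥ v))) continuous_const ?_
      fun t ht => key t ht r
    have hc := continuous_ev (R := R) (P := fun t => 1 + (t * r) • single j i (1 : ℂ)) (by
      intro k l
      simp only [Matrix.add_apply, Matrix.smul_apply, smul_eq_mul]
      fun_prop)
    fun_prop
  rw [lim r]
  have h0 := lim 0
  rw [mul_zero, zero_smul, add_zero, h.one, one_mulVec] at h0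
  rw [zero_mul, zero_smul, add_zero, h.one, one_mulVec]
  exact h0.symm

end Weights

end ThreeArch
end

/-! ### Rectangular highest weights -/

noncomputable section

namespace ThreeArch

open Matrix MvPolynomial

section Rect

/-- The weight with `b` entries `c`, followed by zeros. -/
def rectWeight (a b c : ℕ) (i : Fin (a + b)) : ℕ := if (i : ℕ) < b then c else 0

/-- The decomposition of the indices in the first `b` and the last `a`. -/
def blockEquiv (a b : ℕ) : Fin b ⊕ Fin a ≃ Fin (a + b) :=
  finSumFinEquiv.trans (finCongr (add_comm b a))

theorem blockEquiv_inl (a b : ℕ) (i : Fin b) : (blockEquiv a b (Sum.inl i) : ℕ) = i := by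
  simp [blockEquiv]

theorem blockEquiv_inr (a b : ℕ) (i : Fin a) : (blockEquiv a b (Sum.inr i) : ℕ) = b + i := by
  simp [blockEquiv, add_comm]

variable {a b c d : ℕ} {R : Matrix (Fin d) (Fin d) (MvPolynomial (Fin (a + b) × Fin (a + b)) ℂ)}
  {v : Fin d → ℂ}

theorem rectWeight_inl (i : Fin b) : rectWeight a b c (blockEquiv a b (Sum.inl i)) = c := by
  rw [rectWeight, blockEquiv_inl, if_pos i.2]

theorem rectWeight_inr (i : Fin a) : rectWeight a b c (blockEquiv a b (Sum.inr i)) = 0 := by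
  rw [rectWeight, blockEquiv_inr, if_neg (by omega)]

theorem prod_rectWeight (x : Fin (a + b) → ℂ) :
    ∏ i, x i ^ rectWeight a b c i = ∏ i : Fin b, x (blockEquiv a b (Sum.inl i)) ^ c := by
  rw [← Equiv.prod_comp (blockEquiv a b), Fintype.prod_sum_type]
  simp [rectWeight_inl, rectWeight_inr]

/-- A matrix in block form. -/
def blockMat (A : Matrix (Fin b) (Fin b) ℂ) (B : Matrix (Fin b) (Fin a) ℂ)
    (C : Matrix (Fin a) (Fin b) ℂ) (D : Matrix (Fin a) (Fin a) ℂ) :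
    Matrix (Fin (a + b)) (Fin (a + b)) ℂ :=
  (fromBlocks A B C D).submatrix (blockEquiv a b).symm (blockEquiv a b).symm

theorem blockMat_mul (A A' : Matrix (Fin b) (Fin b) ℂ) (B B' : Matrix (Fin b) (Fin a) ℂ)
    (C C' : Matrix (Fin a) (Fin b) ℂ) (D D' : Matrix (Fin a) (Fin a) ℂ) :
    blockMat A B C D * blockMat A' B' C' D' =
      blockMat (A * A' + B * C') (A * B' + B * D') (C * A' + D * C') (C * B' + D * D') := by
  rw [blockMat, blockMat, submatrix_mul_equiv, fromBlocks_multiply, blockMat]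

theorem exists_blockMat (M : Matrix (Fin (a + b)) (Fin (a + b)) ℂ) :
    ∃ B C D, M = blockMat (of fun i j => M (blockEquiv a b (Sum.inl i)) (blockEquiv a b (Sum.inl j)))
      B C D := by
  refine ⟨of fun i j => M (blockEquiv a b (Sum.inl i)) (blockEquiv a b (Sum.inr j)),
    of fun i j => M (blockEquiv a b (Sum.inr i)) (blockEquiv a b (Sum.inl j)),
    of fun i j => M (blockEquiv a b (Sum.inr i)) (blockEquiv a b (Sum.inr j)), ?_⟩
  ext i j
  obtain ⟨i, rfl⟩ := (blockEquiv a b).surjective i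
  obtain ⟨j, rfl⟩ := (blockEquiv a b).surjective j
  rw [blockMat, submatrix_apply, Equiv.symm_apply_apply, Equiv.symm_apply_apply]
  rcases i with i | i <;> rcases j with j | j <;> simp

theorem blockTriangular_blockMat {A : Matrix (Fin b) (Fin b) ℂ} (B : Matrix (Fin b) (Fin a) ℂ)
    {D : Matrix (Fin a) (Fin a) ℂ} (hA : A.BlockTriangular id) (hD : D.BlockTriangular id) :
    (blockMat A B 0 D).BlockTriangular id := by
  intro i j hij
  obtain ⟨i, rfl⟩ := (blockEquiv a b).surjective i
  obtain ⟨j, rfl⟩ := (blockEquiv a b).surjective j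
  have hij' : (blockEquiv a b j : ℕ) < blockEquiv a b i := hij
  rw [blockMat, submatrix_apply, Equiv.symm_apply_apply, Equiv.symm_apply_apply]
  rcases i with i | i <;> rcases j with j | j
  · rw [blockEquiv_inl, blockEquiv_inl] at hij'
    exact hA (show j < i from hij')
  · rw [blockEquiv_inl, blockEquiv_inr] at hij'
    omega
  · rfl
  · rw [blockEquiv_inr, blockEquiv_inr] at hij'
    exact hD (show j < i from Fin.lt_def.2 (by omega))

theorem det_blockMat (A : Matrix (Fin b) (Fin b) ℂ) (B : Matrix (Fin b) (Fin a) ℂ)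
    (D : Matrix (Fin a) (Fin a) ℂ) : (blockMat A B 0 D).det = A.det * D.det := by
  rw [blockMat, det_submatrix_equiv_self, det_fromBlocks_zero₂₁]

theorem blockMat_inl (A : Matrix (Fin b) (Fin b) ℂ) (B : Matrix (Fin b) (Fin a) ℂ)
    (C : Matrix (Fin a) (Fin b) ℂ) (D : Matrix (Fin a) (Fin a) ℂ) (i j : Fin b) :
    blockMat A B C D (blockEquiv a b (Sum.inl i)) (blockEquiv a b (Sum.inl j)) = A i j := by
  simp [blockMat]

theorem blockMat_one_zero_eq_diagonal :
    (blockMat 1 0 0 0 : Matrix (Fin (a + b)) (Fin (a + b)) ℂ) =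
      diagonal fun n : Fin (a + b) => if (n : ℕ) < b then 1 else 0 := by
  ext i j
  obtain ⟨i, rfl⟩ := (blockEquiv a b).surjective i
  obtain ⟨j, rfl⟩ := (blockEquiv a b).surjective j
  rw [blockMat, submatrix_apply, Equiv.symm_apply_apply, Equiv.symm_apply_apply, diagonal_apply]
  rcases i with i | i <;> rcases j with j | j <;>
    simp [blockEquiv_inl, blockEquiv_inr, Matrix.one_apply]

theorem IsHighestRep.ev_blockMat_of_triangular (h : IsHighestRep R v (rectWeight a b c))
    {A : Matrix (Fin b) (Fin b) ℂ} (B : Matrix (Fin b) (Fin a) ℂ) {D : Matrix (Fin a) (Fin a) ℂ}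
    (hA : A.BlockTriangular id) (hD : D.BlockTriangular id) (hA0 : A.det ≠ 0) (hD0 : D.det ≠ 0) :
    ev R (blockMat A B 0 D) *ᵥ v = A.det ^ c • v := by
  rw [h.highest _ (by rw [det_blockMat]; exact mul_ne_zero hA0 hD0)
    (blockTriangular_blockMat B hA hD), prod_rectWeight, det_of_isUpperTriangular hA,
    ← Finset.prod_pow]
  simp only [blockMat_inl]

/-- The first b entries of the weight are all equal to its top value, so transvections in this block
fix v. Together with diagonal matrices they generate the invertible matrices of the block. -/
theorem IsHighestRep.ev_blockMat (h : IsHighestRep R v (rectWeight a b c))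
    (A : Matrix (Fin b) (Fin b) ℂ) (hA : A.det ≠ 0) :
    ev R (blockMat A 0 0 1) *ᵥ v = A.det ^ c • v := by
  refine diagonal_transvection_induction_of_det_ne_zero
    (fun A => ev R (blockMat A 0 0 1) *ᵥ v = A.det ^ c • v) A hA (fun D hD => ?_) ?_ ?_
  · exact h.ev_blockMat_of_triangular 0 (blockTriangular_diagonal _) blockTriangular_one hD (by simp)
  · rintro ⟨i, j, hij, r⟩
    have hb : 0 < b := i.pos
    have h1 : blockMat (transvection i j r) 0 0 (1 : Matrix (Fin a) (Fin a) ℂ) =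
        1 + r • single (blockEquiv a b (Sum.inl i)) (blockEquiv a b (Sum.inl j)) 1 := by
      ext k l
      obtain ⟨k, rfl⟩ := (blockEquiv a b).surjective k
      obtain ⟨l, rfl⟩ := (blockEquiv a b).surjective l
      rw [blockMat, submatrix_apply, Equiv.symm_apply_apply, Equiv.symm_apply_apply]
      rcases k with k | k <;> rcases l with l | l <;>
        simp [transvection, Matrix.one_apply, Matrix.single_apply]
    rw [TransvectionStruct.toMatrix_mk, det_transvection_of_ne _ _ hij, one_pow, one_smul, h1]
    refine h.ev_one_add_single (z := ⟨0, by omega⟩) (fun i => Fin.le_def.2 (Nat.zero_le _)) ?_ ?_ r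
    · intro e
      exact hij (Sum.inl_injective ((blockEquiv a b).injective e)).symm
    · rw [rectWeight_inl, rectWeight, if_pos hb]
  · intro A B _ _ ihA ihB
    have h1 : blockMat (A * B) 0 0 (1 : Matrix (Fin a) (Fin a) ℂ) =
        blockMat A 0 0 1 * blockMat B 0 0 1 := by
      rw [blockMat_mul]; simp
    rw [h1, h.mul, ← mulVec_mulVec, ihB, mulVec_smul, ihA, smul_smul, det_mul, mul_pow, mul_comm]

/-- The matrices diag(1, …, 1, s, …, s) fix v, as the last a entries of the weight are 0. By
continuity so does their limit at s = 0. -/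
theorem IsHighestRep.ev_blockMat_one_zero (h : IsHighestRep R v (rectWeight a b c)) :
    ev R (blockMat 1 0 0 0) *ᵥ v = v := by
  have h1 : ∀ s : ℂ, s ≠ 0 → ev R (blockMat 1 0 0 (s • 1)) *ᵥ v = v := by
    intro s hs
    rw [h.ev_blockMat_of_triangular 0 blockTriangular_one
      (D := s • (1 : Matrix (Fin a) (Fin a) ℂ)) ?_ (by simp) (by simp [hs])]
    · simp
    · rw [smul_one_eq_diagonal]; exact blockTriangular_diagonal _
  have h2 := eq_of_eq_of_ne_zero (f := fun s : ℂ => ev R (blockMat 1 0 0 (s • 1)) *ᵥ v)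
    (g := fun _ => v) (by
      have hc := continuous_ev (R := R)
        (P := fun s : ℂ => blockMat 1 0 0 (s • (1 : Matrix (Fin a) (Fin a) ℂ))) (by
          intro i j
          obtain ⟨i, rfl⟩ := (blockEquiv a b).surjective i
          obtain ⟨j, rfl⟩ := (blockEquiv a b).surjective j
          simp only [blockMat, submatrix_apply, Equiv.symm_apply_apply]
          rcases i with i | i <;> rcases j with j | j <;> simp <;> fun_prop)
      fun_prop) continuous_const h1
  simpa using h2

/-- The idempotent on the left sees only the first b rows of M. If their leading block A is
invertible, these rows agree with those of the product of A ⊕ 1 and an upper unipotent matrix, and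
both factors act on v by scalars. -/
theorem IsHighestRep.ev_proj (h : IsHighestRep R v (rectWeight a b c))
    (M : Matrix (Fin (a + b)) (Fin (a + b)) ℂ)
    (hM : (of fun i j => M (blockEquiv a b (Sum.inl i)) (blockEquiv a b (Sum.inl j))).det ≠ 0) :
    ∃ κ : ℂ, ev R (blockMat 1 0 0 0) *ᵥ (ev R M *ᵥ v) = κ • v := by
  set A : Matrix (Fin b) (Fin b) ℂ :=
    of fun i j => M (blockEquiv a b (Sum.inl i)) (blockEquiv a b (Sum.inl j)) with hA
  obtain ⟨B, C', D, hMb⟩ := exists_blockMat M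
  rw [← hA] at hMb
  have h1 : blockMat 1 0 0 0 * M =
      blockMat 1 0 0 0 * (blockMat A 0 0 1 * blockMat 1 (A⁻¹ * B) 0 1) := by
    rw [hMb, blockMat_mul, blockMat_mul, blockMat_mul]
    simp only [Matrix.one_mul, Matrix.zero_mul, Matrix.mul_one, Matrix.mul_zero, add_zero, zero_add]
    rw [← Matrix.mul_assoc, mul_nonsing_inv _ (isUnit_iff_ne_zero.2 hM), Matrix.one_mul]
  refine ⟨A.det ^ c, ?_⟩
  rw [mulVec_mulVec, ← h.mul, h1, h.mul, h.mul, ← mulVec_mulVec, ← mulVec_mulVec,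
    h.ev_blockMat_of_triangular _ blockTriangular_one blockTriangular_one (by simp) (by simp),
    det_one, one_pow, one_smul, h.ev_blockMat A hM, mulVec_smul, h.ev_blockMat_one_zero]

/-- The idempotent sends a dense part of the orbit of v into the line of v, so it has rank one with
image spanned by v. Since it also fixes v, its trace is 1. -/
theorem IsHighestRep.trace_ev_proj (h : IsHighestRep R v (rectWeight a b c)) (hv : v ≠ 0) :
    (ev R (blockMat 1 0 0 0)).trace = 1 := by
  obtain ⟨i, hi⟩ := Function.ne_iff.1 hv
  have hi : v i ≠ 0 := hi
  set P := ev R (blockMat 1 0 0 0) with hP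
  have hQ : P - (v i)⁻¹ • vecMulVec v (P i) = 0 := by
    refine h.eq_zero_of_dense (r := (of fun k l => (X (blockEquiv a b (Sum.inl k),
      blockEquiv a b (Sum.inl l)) : MvPolynomial (Fin (a + b) × Fin (a + b)) ℂ)).det) ?_ ?_
    · intro e
      have := congrArg (eval (ent 1)) e
      rw [RingHom.map_det, map_zero] at this
      have e1 : (eval (ent 1)).mapMatrix (of fun k l => (X (blockEquiv a b (Sum.inl k),
        blockEquiv a b (Sum.inl l)) : MvPolynomial (Fin (a + b) × Fin (a + b)) ℂ)) = 1 := by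
        ext k l
        simp [ent, Matrix.one_apply]
      rw [e1, det_one] at this
      exact one_ne_zero this
    · intro M _ hM
      rw [RingHom.map_det] at hM
      obtain ⟨κ, hκ⟩ := h.ev_proj M (by
        convert hM using 2
        ext k l
        simp [ent])
      rw [← hP] at hκ
      rw [sub_mulVec, smul_mulVec, hκ]
      funext j
      have e2 : (vecMulVec v (P i) *ᵥ (ev R M *ᵥ v)) j = v j * (κ * v i) := by
        have := congrFun hκ i
        simp only [Pi.smul_apply, smul_eq_mul] at this
        rw [← this]
        simp only [mulVec, dotProduct, vecMulVec_apply, Finset.mul_sum, mul_assoc]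
      simp only [Pi.sub_apply, Pi.smul_apply, smul_eq_mul, e2, Pi.zero_apply]
      field_simp
      ring
  have h1 := congrArg Matrix.trace (sub_eq_zero.1 hQ)
  rw [h1, Matrix.trace_smul, trace_vecMulVec, dotProduct_comm]
  have h2 := congrFun h.ev_blockMat_one_zero i
  rw [← hP] at h2
  have h3 : P i ⬝ᵥ v = v i := h2
  rw [h3, smul_eq_mul, inv_mul_cancel₀ hi]

theorem sum_rectWeight (a b c : ℕ) : ∑ i, (rectWeight a b c i : ℂ) = b * c := by
  rw [← Equiv.sum_comp (blockEquiv a b), Fintype.sum_sum_type]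
  simp [rectWeight_inl, rectWeight_inr]

theorem casimir_rectWeight (a b c : ℕ) :
    (∑ i, ∑ j, if i = j then (rectWeight a b c i : ℂ) ^ 2 else
      if i < j then (rectWeight a b c i : ℂ) - rectWeight a b c j else 0) = b * c * (a + c) := by
  -- Off the diagonal only pairs with i < b ≤ j contribute, each the value c. The factor with a and
  -- b exchanged and the index reversed is the indicator of b ≤ j, so that the double sum becomes a
  -- product.
  have h : ∀ i j : Fin (a + b), (if i = j then (rectWeight a b c i : ℂ) ^ 2 else
      if i < j then (rectWeight a b c i : ℂ) - rectWeight a b c j else 0) =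
      (if i = j then (rectWeight a b c i : ℂ) ^ 2 else 0) +
      (rectWeight a b c i : ℂ) * rectWeight b a 1 (finCongr (add_comm a b) (Fin.rev j)) := by
    intro i j
    have h1 : ((finCongr (add_comm a b) (Fin.rev j) : Fin (b + a)) : ℕ) = a + b - (j + 1) := by
      simp [Fin.val_rev]
    simp only [rectWeight, h1]
    have hi := i.2
    have hj := j.2
    by_cases hij : i = j
    · subst hij
      rw [if_pos rfl, if_pos rfl]
      split_ifs <;> first | (exfalso; omega) | simp
    · have hij' : (i : ℕ) ≠ j := fun e => hij (Fin.ext e)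
      rw [if_neg hij, if_neg hij, zero_add]
      by_cases hlt : i < j
      · have hlt' : (i : ℕ) < j := hlt
        rw [if_pos hlt]
        split_ifs <;> first | (exfalso; omega) | simp
      · have hlt' : ¬ (i : ℕ) < j := hlt
        rw [if_neg hlt]
        split_ifs <;> first | (exfalso; omega) | simp
  simp only [h, Finset.sum_add_distrib]
  have h2 : ∑ i, ∑ j, (rectWeight a b c i : ℂ) *
      rectWeight b a 1 (finCongr (add_comm a b) (Fin.rev j)) = (b * c) * (a * 1) := by
    rw [← Finset.sum_mul_sum, sum_rectWeight]
    congr 1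
    refine (Equiv.sum_comp Fin.revPerm
      (fun j => (rectWeight b a 1 (finCongr (add_comm a b) j) : ℂ))).trans ?_
    rw [Equiv.sum_comp (finCongr (add_comm a b)) (fun j => (rectWeight b a 1 j : ℂ)), sum_rectWeight]
    simp
  rw [h2]
  simp only [Finset.sum_ite_eq, Finset.mem_univ, if_true]
  rw [← Equiv.sum_comp (blockEquiv a b), Fintype.sum_sum_type]
  simp [rectWeight_inl, rectWeight_inr]
  ring

theorem IsHighestRep.isRectCharacter (h : IsHighestRep R v (rectWeight a b c)) (hv : v ≠ 0) :
    IsRectCharacter a b c (character R) where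
  symm := h.rename_character
  degree n hn k := by
    by_contra hlt
    have hN : 0 < a + b := k.pos
    rw [mem_support_iff, coeff_character, h.weightProj_eq_zero n (k := k) (z := ⟨0, hN⟩)
      (fun i => Fin.le_def.2 (Nat.zero_le _))] at hn
    · simp at hn
    · rw [rectWeight]
      split_ifs <;> omega
  euler_sum := by
    rw [h.sum_euler_character, sum_rectWeight]
    push_cast
    rfl
  casimir x _ hx := by
    rw [h.casimir_character x hx, casimir_rectWeight]
    push_cast
    rfl
  norm := by
    -- The normalization point has its ones in the last b places, while the weight is supported on
    -- the first b; symmetry of the character allows the reversal.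
    rw [← h.rename_character Fin.revPerm, eval_rename, eval_character]
    refine Eq.trans ?_ (h.trace_ev_proj hv)
    rw [blockMat_one_zero_eq_diagonal]
    congr 3
    funext n
    obtain ⟨m, rfl⟩ := Fin.revPerm.surjective n
    simp only [Function.comp, Fin.revPerm_apply, Fin.rev_rev, Fin.val_rev]
    refine Fin.addCases (fun s => ?_) (fun r => ?_) m
    · rw [Fin.addCases_left, Fin.val_castAdd, if_neg (by omega)]
    · rw [Fin.addCases_right, Fin.val_natAdd, if_pos (by omega)]

/-- The dimension is the value of the Schur function at `1`. -/
theorem IsHighestRep.dim_eq_schur (h : IsHighestRep R v (rectWeight a b c)) (hv : v ≠ 0) :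
    (d : ℂ) = schur (rect b c) fun _ : Fin (a + b) => 1 := by
  rw [← (h.isRectCharacter hv).eval_eq_schur, eval_character]
  have : diagonal (fun _ : Fin (a + b) => (1 : ℂ)) = 1 := diagonal_one
  rw [this, h.one, trace_one, Fintype.card_fin]

end Rect

end ThreeArch
end

noncomputable section

namespace ThreeArch

open Matrix MvPolynomial

/-! ### Irreducible representations in coordinates -/

section Coordinates

theorem colLen_rect_le (a b c : ℕ) : (rect b c).colLen 0 ≤ a + b := by
  by_contra h
  have h1 : (a + b, 0) ∈ rect b c := YoungDiagram.mem_iff_lt_colLen.mpr (not_le.mp h)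
  have := (mem_rect.mp h1).1
  omega

theorem rowLen_rect (a b c : ℕ) (i : Fin (a + b)) : (rect b c).rowLen i = rectWeight a b c i := by
  refine eq_of_forall_lt_iff fun j => ?_
  rw [← YoungDiagram.mem_iff_lt_rowLen, mem_rect, rectWeight]
  split_ifs with h <;> simp [h]

variable {N d : ℕ}

/-- A matrix of polynomials which is multiplicative on invertible matrices is multiplicative. -/
theorem ev_mul_of_invertible {R : Matrix (Fin d) (Fin d) (MvPolynomial (Fin N × Fin N) ℂ)}
    (h : ∀ M M' : Matrix (Fin N) (Fin N) ℂ, M.det ≠ 0 → M'.det ≠ 0 →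
      ev R (M * M') = ev R M * ev R M') (M M' : Matrix (Fin N) (Fin N) ℂ) :
    ev R (M * M') = ev R M * ev R M' := by
  have h1 : ∀ M M' : Matrix (Fin N) (Fin N) ℂ, M'.det ≠ 0 →
      ev R (M * M') = ev R M * ev R M' := by
    intro M M' hM'
    ext1 i j
    have key : rightMul M' (R i j) = ∑ k, R i k * C (ev R M' k j) := by
      refine eq_of_eval_ent_of_ne det_genMat_ne_zero fun M hM => ?_
      rw [eval_ent_det] at hM
      rw [eval_rightMul, ← ev_apply, h M M' hM hM', Matrix.mul_apply, map_sum]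
      exact Finset.sum_congr rfl fun k _ => by rw [map_mul, eval_C, ev_apply]
    rw [ev_apply, ← eval_rightMul, key, Matrix.mul_apply, map_sum]
    exact Finset.sum_congr rfl fun k _ => by rw [map_mul, eval_C, ev_apply R M]
  ext1 i j
  have key : leftMul M (R i j) = ∑ k, C (ev R M i k) * R k j := by
    refine eq_of_eval_ent_of_ne det_genMat_ne_zero fun M' hM' => ?_
    rw [eval_ent_det] at hM'
    rw [eval_leftMul, ← ev_apply, h1 M M' hM', Matrix.mul_apply, map_sum]
    exact Finset.sum_congr rfl fun k _ => by rw [map_mul, eval_C, ev_apply R M']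
  rw [ev_apply, ← eval_leftMul, key, Matrix.mul_apply, map_sum]
  exact Finset.sum_congr rfl fun k _ => by rw [map_mul, eval_C, ev_apply R M']

theorem exists_gl {M : Matrix (Fin N) (Fin N) ℂ} (hM : M.det ≠ 0) :
    ∃ g : GL (Fin N) ℂ, (g : Matrix (Fin N) (Fin N) ℂ) = M :=
  ⟨Matrix.GeneralLinearGroup.mkOfDetNeZero M hM, rfl⟩

/-- In an irreducible representation, a linear map vanishing on an orbit vanishes. -/
theorem eq_zero_of_orbit {G V V' : Type*} [Group G] [AddCommGroup V] [Module ℂ V]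
    [AddCommGroup V'] [Module ℂ V']
    {ρ : Representation ℂ G V} (hρ : ρ.IsIrreducible) {v : V} (hv : v ≠ 0) (f : V →ₗ[ℂ] V')
    (h : ∀ g, f (ρ g v) = 0) : f = 0 := by
  -- The largest invariant subspace on which f vanishes. It contains the nonzero vector v, so
  -- irreducibility makes it everything.
  let W : Subrepresentation ρ :=
    { toSubmodule := ⨅ g, LinearMap.ker (f ∘ₗ ρ g)
      apply_mem_toSubmodule := by
        intro g w hw
        simp only [Submodule.mem_iInf, LinearMap.mem_ker, LinearMap.comp_apply] at hw ⊢
        intro g'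
        rw [← Module.End.mul_apply, ← map_mul]
        exact hw _ }
  have hmem : ∀ w, w ∈ W.toSubmodule ↔ ∀ g, f (ρ g w) = 0 := fun w => by
    simp [W, Submodule.mem_iInf]
  have hvW : v ∈ W.toSubmodule := (hmem v).mpr h
  rcases hρ.eq_bot_or_eq_top W with hW | hW
  · rw [hW] at hvW
    exact absurd ((Submodule.mem_bot ℂ).mp hvW) hv
  · ext w
    have hw : w ∈ W.toSubmodule := by rw [hW]; exact Submodule.mem_top
    simpa using (hmem w).mp hw 1

/-- The dimension of the irreducible representation with a rectangular diagram. -/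
theorem IsIrrepWithDiagram.finrank_eq_schur {a b c : ℕ} {V : Type*} [AddCommGroup V] [Module ℂ V]
    {ρ : Representation ℂ (GL (Fin (a + b)) ℂ) V} (h : IsIrrepWithDiagram ρ (rect b c)) :
    (Module.finrank ℂ V : ℂ) = schur (rect b c) fun _ : Fin (a + b) => 1 := by
  have := h.finite
  let B := Module.finBasis ℂ V
  choose p hp using h.polynomial
  -- The polynomials that give the matrix coefficients in a basis. They are defined on all matrices,
  -- which extends the representation from the group to the full matrix monoid.
  let R : Matrix (Fin (Module.finrank ℂ V)) (Fin (Module.finrank ℂ V))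
      (MvPolynomial (Fin (a + b) × Fin (a + b)) ℂ) := of fun i j => p (B.coord i) (B j)
  have hR : ∀ g : GL (Fin (a + b)) ℂ,
      ev R (g : Matrix (Fin (a + b)) (Fin (a + b)) ℂ) = LinearMap.toMatrix B B (ρ g) := by
    intro g
    ext1 i j
    rw [ev_apply, LinearMap.toMatrix_apply, ← Module.Basis.coord_apply, hp]
    rfl
  obtain ⟨v, hv, hhigh⟩ := h.highest
  have hrep : ∀ (g : GL (Fin (a + b)) ℂ) (w : V),
      ev R (g : Matrix (Fin (a + b)) (Fin (a + b)) ℂ) *ᵥ B.repr w = B.repr (ρ g w) := by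
    intro g w
    rw [hR, LinearMap.toMatrix_mulVec_repr]
  have hH : IsHighestRep R (B.repr v) (rectWeight a b c) := by
    refine ⟨ev_mul_of_invertible ?_, ?_, ?_, ?_⟩
    · intro M M' hM hM'
      obtain ⟨g, rfl⟩ := exists_gl hM
      obtain ⟨g', rfl⟩ := exists_gl hM'
      rw [← Units.val_mul, hR, hR, hR, map_mul, LinearMap.toMatrix_mul]
    · rw [← Units.val_one, hR, map_one, LinearMap.toMatrix_one]
    · intro M hM hM'
      obtain ⟨g, rfl⟩ := exists_gl hM
      rw [hrep, hhigh g hM', map_smul, Finsupp.coe_smul]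
      simp only [rowLen_rect]
    · intro A hA
      have h0 : Matrix.toLin B B A = 0 := by
        refine eq_zero_of_orbit h.irreducible hv _ fun g => ?_
        apply B.repr.injective
        have := hA g g.det_ne_zero
        rw [hrep] at this
        rw [map_zero]
        refine DFunLike.coe_injective ?_
        rw [Matrix.repr_toLin, this]
        rfl
      exact (Matrix.toLin B B).map_eq_zero_iff.mp h0
  refine hH.dim_eq_schur fun h0 => hv ?_
  exact B.repr.map_eq_zero_iff.mp (DFunLike.coe_injective h0)

end Coordinates

end ThreeArch
end

noncomputable section

namespace ThreeArch

open Matrix MvPolynomial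

/-! ### Existence of the irreducible representation with a rectangular diagram -/

section Existence

/-- A finite-dimensional representation with a nonzero cyclic vector has an irreducible quotient
in which the vector does not vanish. -/
theorem exists_irreducible_quotient {G V : Type*} [Group G] [AddCommGroup V] [Module ℂ V]
    [Module.Finite ℂ V] (ρ : Representation ℂ G V) {v : V} (hv : v ≠ 0)
    (hcyc : ∀ W : Submodule ℂ V, (∀ g, W ≤ W.comap (ρ g)) → v ∈ W → W = ⊤) :
    ∃ (W : Submodule ℂ V) (hW : ∀ g, W ≤ W.comap (ρ g)), v ∉ W ∧
      (ρ.quotient W hW).IsIrreducible := by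
  -- An invariant subspace maximal among those that avoid v. An invariant subspace strictly above it
  -- contains v and is everything, so the quotient is irreducible.
  obtain ⟨W, ⟨hW, hvW⟩, hmax⟩ := (set_has_maximal_iff_noetherian (R := ℂ) (M := V)).mpr
    inferInstance {W | (∀ g, W ≤ W.comap (ρ g)) ∧ v ∉ W}
    ⟨⊥, fun _ => bot_le, fun h => hv ((Submodule.mem_bot ℂ).mp h)⟩
  refine ⟨W, hW, hvW, ?_⟩
  have hne : (⊥ : Subrepresentation (ρ.quotient W hW)) ≠ ⊤ := by
    intro h
    have h1 : W.mkQ v ∈ (⊤ : Subrepresentation (ρ.quotient W hW)).toSubmodule := Submodule.mem_top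
    rw [← h] at h1
    exact hvW ((Submodule.Quotient.mk_eq_zero W).mp ((Submodule.mem_bot ℂ).mp h1))
  have : Nontrivial (Subrepresentation (ρ.quotient W hW)) := ⟨⊥, ⊤, hne⟩
  refine ⟨fun S => ?_⟩
  have hS : ∀ g, S.toSubmodule.comap W.mkQ ≤ (S.toSubmodule.comap W.mkQ).comap (ρ g) :=
    fun g w hw => S.apply_mem_toSubmodule g hw
  have hle : W ≤ S.toSubmodule.comap W.mkQ := fun w hw => by
    have : W.mkQ w = 0 := (Submodule.Quotient.mk_eq_zero W).mpr hw
    rw [Submodule.mem_comap, this]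
    exact zero_mem _
  by_cases hvS : v ∈ S.toSubmodule.comap W.mkQ
  · right
    have h1 := hcyc _ hS hvS
    refine Subrepresentation.toSubmodule_injective (eq_top_iff.mpr fun x _ => ?_)
    obtain ⟨w, rfl⟩ := W.mkQ_surjective x
    exact (h1 ▸ Submodule.mem_top : w ∈ S.toSubmodule.comap W.mkQ)
  · left
    have h1 : S.toSubmodule.comap W.mkQ = W :=
      (eq_of_le_of_not_lt hle (hmax _ ⟨hS, hvS⟩)).symm
    refine Subrepresentation.toSubmodule_injective (eq_bot_iff.mpr fun x hx => ?_)
    obtain ⟨w, rfl⟩ := W.mkQ_surjective x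
    have hw : w ∈ S.toSubmodule.comap W.mkQ := hx
    rw [h1] at hw
    exact (Submodule.mem_bot ℂ).mpr ((Submodule.Quotient.mk_eq_zero W).mpr hw)

variable {N : ℕ}

/-- The action of `GL_N` on the polynomials on matrices by right translation. -/
def translation (N : ℕ) : Representation ℂ (GL (Fin N) ℂ) (MvPolynomial (Fin N × Fin N) ℂ) where
  toFun g := (rightMul (g : Matrix (Fin N) (Fin N) ℂ)).toLinearMap
  map_one' := LinearMap.ext fun p => eq_of_eval_ent fun M => by
    rw [AlgHom.toLinearMap_apply, eval_rightMul, Units.val_one, mul_one]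
    rfl
  map_mul' g g' := LinearMap.ext fun p => eq_of_eval_ent fun M => by
    rw [Module.End.mul_apply, AlgHom.toLinearMap_apply, AlgHom.toLinearMap_apply,
      AlgHom.toLinearMap_apply, eval_rightMul, eval_rightMul, eval_rightMul, Units.val_mul,
      mul_assoc]

/-- The polynomial `p(XY)` in the entries of `Y`, with polynomials in the entries of `X` as
coefficients. -/
def comul (N : ℕ) : MvPolynomial (Fin N × Fin N) ℂ →ₐ[ℂ]
    MvPolynomial (Fin N × Fin N) (MvPolynomial (Fin N × Fin N) ℂ) :=
  aeval fun ij => ∑ k, C (X (ij.1, k)) * X (k, ij.2)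

theorem comul_X (i : Fin N × Fin N) : comul N (X i) = ∑ k, C (X (i.1, k)) * X (k, i.2) :=
  aeval_X _ _

theorem eval_comul (M : Matrix (Fin N) (Fin N) ℂ) (p : MvPolynomial (Fin N × Fin N) ℂ) :
    eval (fun ij => algebraMap ℂ (MvPolynomial (Fin N × Fin N) ℂ) (ent M ij)) (comul N p) =
      rightMul M p := by
  induction p using MvPolynomial.induction_on with
  | C r =>
    rw [← MvPolynomial.algebraMap_eq, AlgHom.commutes, AlgHom.commutes,
      IsScalarTower.algebraMap_apply ℂ (MvPolynomial (Fin N × Fin N) ℂ)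
        (MvPolynomial (Fin N × Fin N) (MvPolynomial (Fin N × Fin N) ℂ)),
      MvPolynomial.algebraMap_eq (MvPolynomial (Fin N × Fin N) ℂ) (Fin N × Fin N), eval_C]
  | add p q hp hq => simp only [map_add, hp, hq]
  | mul_X p i hp =>
    rw [map_mul, map_mul, map_mul, hp, comul_X, rightMul, aeval_X, map_sum]
    refine congrArg _ (Finset.sum_congr rfl fun k _ => ?_)
    rw [map_mul, eval_C, eval_X]
    rfl

/-- As a polynomial in Y, p(XY) has finitely many coefficients, and every translate of p is a
combination of them. Hence the translates span a finite-dimensional space. -/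
theorem rightMul_mem_span (M : Matrix (Fin N) (Fin N) ℂ) (p : MvPolynomial (Fin N × Fin N) ℂ) :
    rightMul M p ∈ Submodule.span ℂ
      ((fun m => (comul N p).coeff m) '' ((comul N p).support : Set (Fin N × Fin N →₀ ℕ))) := by
  rw [← eval_comul, eval_eq']
  refine Submodule.sum_mem _ fun m hm => ?_
  have : ∏ i, algebraMap ℂ (MvPolynomial (Fin N × Fin N) ℂ) (ent M i) ^ m i =
      algebraMap ℂ _ (∏ i, ent M i ^ m i) := by
    rw [map_prod]
    exact Finset.prod_congr rfl fun i _ => (map_pow _ _ _).symm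
  rw [this, mul_comm, ← Algebra.smul_def]
  exact Submodule.smul_mem _ _ (Submodule.subset_span ⟨m, hm, rfl⟩)

theorem exists_polynomial_rightMul (L : MvPolynomial (Fin N × Fin N) ℂ →ₗ[ℂ] ℂ)
    (p : MvPolynomial (Fin N × Fin N) ℂ) : ∃ r : MvPolynomial (Fin N × Fin N) ℂ,
      ∀ M, L (rightMul M p) = eval (ent M) r :=
  ⟨AddMonoidAlgebra.map L.toAddMonoidHom (comul N p), fun M => by
    rw [eval_map_linear, eval_comul]⟩

/-- The submodule spanned by the translates of a polynomial. -/
def translates (p : MvPolynomial (Fin N × Fin N) ℂ) :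
    Submodule ℂ (MvPolynomial (Fin N × Fin N) ℂ) :=
  Submodule.span ℂ (Set.range fun g : GL (Fin N) ℂ => translation N g p)

theorem mem_translates (p : MvPolynomial (Fin N × Fin N) ℂ) : p ∈ translates p :=
  Submodule.subset_span ⟨1, LinearMap.congr_fun (map_one (translation N)) p⟩

theorem translates_le_comap (p : MvPolynomial (Fin N × Fin N) ℂ) (g : GL (Fin N) ℂ) :
    translates p ≤ (translates p).comap (translation N g) := by
  refine Submodule.span_le.mpr ?_
  rintro _ ⟨g', rfl⟩
  rw [SetLike.mem_coe, Submodule.mem_comap, ← Module.End.mul_apply, ← map_mul]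
  exact Submodule.subset_span (Set.mem_range_self (g * g'))

theorem finite_translates (p : MvPolynomial (Fin N × Fin N) ℂ) :
    Module.Finite ℂ (translates p) := by
  have hfin : Module.Finite ℂ (Submodule.span ℂ
      ((fun m => (comul N p).coeff m) '' ((comul N p).support : Set (Fin N × Fin N →₀ ℕ)))) :=
    Module.Finite.span_of_finite ℂ ((comul N p).support.finite_toSet.image _)
  refine Submodule.finiteDimensional_of_le (S₂ := Submodule.span ℂ
      ((fun m => (comul N p).coeff m) '' ((comul N p).support : Set (Fin N × Fin N →₀ ℕ))))
    (Submodule.span_le.mpr ?_)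
  rintro _ ⟨g, rfl⟩
  exact rightMul_mem_span _ p

/-- A nonzero polynomial on which the upper triangular matrices act through the weight of a diagram
gives rise to the irreducible representation with this diagram. -/
theorem exists_isIrrepWithDiagram {μ : YoungDiagram} (hμ : μ.colLen 0 ≤ N)
    {p : MvPolynomial (Fin N × Fin N) ℂ} (hp : p ≠ 0)
    (hhigh : ∀ g : GL (Fin N) ℂ, (g : Matrix (Fin N) (Fin N) ℂ).BlockTriangular id →
      translation N g p = (∏ i : Fin N, (g : Matrix (Fin N) (Fin N) ℂ) i i ^ μ.rowLen i) • p) :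
    ∃ (V : Type) (_ : AddCommGroup V) (_ : Module ℂ V)
      (ρ : Representation ℂ (GL (Fin N) ℂ) V), IsIrrepWithDiagram ρ μ := by
  have := finite_translates p
  let ρ := (translation N).subrepresentation (translates p) (translates_le_comap p)
  have hρ : ∀ g (w : translates p), ((ρ g w : translates p) : MvPolynomial (Fin N × Fin N) ℂ) =
      rightMul (g : Matrix (Fin N) (Fin N) ℂ) w := fun g w => rfl
  let v : translates p := ⟨p, mem_translates p⟩
  have hv : v ≠ 0 := fun h => hp (congrArg Subtype.val h)
  have hcyc : ∀ W : Submodule ℂ (translates p), (∀ g, W ≤ W.comap (ρ g)) → v ∈ W → W = ⊤ := by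
    intro W hW hvW
    have hle : translates p ≤ W.map (translates p).subtype := by
      refine Submodule.span_le.mpr ?_
      rintro _ ⟨g, rfl⟩
      exact ⟨ρ g v, hW g hvW, rfl⟩
    refine eq_top_iff.mpr fun w _ => ?_
    obtain ⟨w', hw', h⟩ := hle w.2
    rwa [← Subtype.ext (a1 := w') (a2 := w) h]
  obtain ⟨W, hW, hvW, hirr⟩ := exists_irreducible_quotient ρ hv hcyc
  refine ⟨translates p ⧸ W, inferInstance, inferInstance, ρ.quotient W hW, inferInstance, hirr,
    ?_, hμ, W.mkQ v, ?_, ?_⟩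
  · intro f x
    obtain ⟨w, rfl⟩ := W.mkQ_surjective x
    obtain ⟨L, hL⟩ := (f ∘ₗ W.mkQ).exists_extend
    obtain ⟨r, hr⟩ := exists_polynomial_rightMul L w
    refine ⟨r, fun g => ?_⟩
    refine Eq.trans ?_ (hr g)
    rw [← hρ]
    exact (LinearMap.congr_fun hL (ρ g w)).symm
  · exact fun h => hvW ((Submodule.Quotient.mk_eq_zero W).mp h)
  · intro g hg
    rw [← map_smul]
    refine congrArg W.mkQ (Subtype.ext ?_)
    exact hhigh g hg

/-- The power of the leading minor of the generic matrix. -/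
def minorPow (a b c : ℕ) : MvPolynomial (Fin (a + b) × Fin (a + b)) ℂ :=
  ((genMat (a + b)).submatrix (fun i => blockEquiv a b (Sum.inl i))
    fun i => blockEquiv a b (Sum.inl i)).det ^ c

theorem eval_minorPow (a b c : ℕ) (M : Matrix (Fin (a + b)) (Fin (a + b)) ℂ) :
    eval (ent M) (minorPow a b c) = (M.submatrix (fun i => blockEquiv a b (Sum.inl i))
      fun i => blockEquiv a b (Sum.inl i)).det ^ c := by
  rw [minorPow, map_pow, RingHom.map_det]
  congr 2
  ext1 i j
  simp [genMat, ent]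

theorem minorPow_ne_zero (a b c : ℕ) : minorPow a b c ≠ 0 := by
  intro h
  have h1 := eval_minorPow a b c 1
  rw [h, map_zero, submatrix_one _
    fun i j hij => Sum.inl_injective ((blockEquiv a b).injective hij), det_one, one_pow] at h1
  exact zero_ne_one h1

/-- For upper triangular M, the leading b × b block of M'M is the product of the leading blocks,
since the entries of M below its leading block vanish. The minor is thus multiplied by the first b
diagonal entries of M. -/
theorem rightMul_minorPow (a b c : ℕ) {M : Matrix (Fin (a + b)) (Fin (a + b)) ℂ}
    (hM : M.BlockTriangular id) :
    rightMul M (minorPow a b c) = (∏ i, M i i ^ rectWeight a b c i) • minorPow a b c := by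
  refine eq_of_eval_ent fun M' => ?_
  rw [eval_rightMul, smul_eval, eval_minorPow, eval_minorPow, prod_rectWeight,
    Finset.prod_pow, ← mul_pow]
  congr 1
  have h1 : (M' * M).submatrix (fun i => blockEquiv a b (Sum.inl i))
      (fun i => blockEquiv a b (Sum.inl i)) =
      M'.submatrix (fun i => blockEquiv a b (Sum.inl i)) (fun i => blockEquiv a b (Sum.inl i)) *
      M.submatrix (fun i => blockEquiv a b (Sum.inl i))
        (fun i => blockEquiv a b (Sum.inl i)) := by
    ext1 i j
    rw [submatrix_apply, Matrix.mul_apply, ← Equiv.sum_comp (blockEquiv a b),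
      Fintype.sum_sum_type, Matrix.mul_apply]
    refine add_eq_left.mpr (Finset.sum_eq_zero fun k _ => ?_)
    rw [hM (show blockEquiv a b (Sum.inl j) < blockEquiv a b (Sum.inr k) from ?_), mul_zero]
    rw [Fin.lt_def, blockEquiv_inl, blockEquiv_inr]
    omega
  rw [h1, det_mul, mul_comm, det_of_isUpperTriangular]
  · rfl
  · intro i j hij
    refine hM (show blockEquiv a b (Sum.inl j) < blockEquiv a b (Sum.inl i) from ?_)
    rw [Fin.lt_def, blockEquiv_inl, blockEquiv_inl]
    exact hij

theorem exists_isIrrepWithDiagram_rect (a b c : ℕ) :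
    ∃ (V : Type) (_ : AddCommGroup V) (_ : Module ℂ V)
      (ρ : Representation ℂ (GL (Fin (a + b)) ℂ) V), IsIrrepWithDiagram ρ (rect b c) :=
  exists_isIrrepWithDiagram (colLen_rect_le a b c) (minorPow_ne_zero a b c) fun g hg => by
    simp only [rowLen_rect]
    exact rightMul_minorPow a b c hg

end Existence

end ThreeArch
end

noncomputable section

namespace ThreeArch

/-! ### The homogeneous case at the cube roots of unity -/

section CubeRoots

theorem card_rect (b c : ℕ) : (rect b c).cells.card = b * c := by
  simp [rect]

theorem schur_const (μ : YoungDiagram) {N : ℕ} (x : ℂ) :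
    schur μ (fun _ : Fin N => x) = x ^ μ.cells.card * schur μ fun _ : Fin N => 1 := by
  have : Fintype (Tableau μ N) := Fintype.ofFinite _
  simp [schur, finsum_eq_sum_of_fintype, mul_comm]

theorem q_eq : q = -1 / 2 + Real.sqrt 3 / 2 * Complex.I := by
  have h : (2 * Real.pi * Complex.I / 3 : ℂ) = ((Real.pi - Real.pi / 3 : ℝ) : ℂ) * Complex.I := by
    push_cast
    ring
  rw [q, h, Complex.exp_mul_I, ← Complex.ofReal_cos, ← Complex.ofReal_sin, Real.cos_pi_sub,
    Real.sin_pi_sub, Real.cos_pi_div_three, Real.sin_pi_div_three]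
  push_cast
  ring

theorem exp_pi_div_six :
    Complex.exp (Real.pi * Complex.I / 6) = Real.sqrt 3 / 2 + 1 / 2 * Complex.I := by
  have h : (Real.pi * Complex.I / 6 : ℂ) = ((Real.pi / 6 : ℝ) : ℂ) * Complex.I := by
    push_cast
    ring
  rw [h, Complex.exp_mul_I, ← Complex.ofReal_cos, ← Complex.ofReal_sin, Real.cos_pi_div_six,
    Real.sin_pi_div_six]
  push_cast
  ring

theorem exp_neg_pi_div_six :
    Complex.exp (-(Real.pi * Complex.I / 6)) = Real.sqrt 3 / 2 - 1 / 2 * Complex.I := by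
  have h : (-(Real.pi * Complex.I / 6) : ℂ) = ((-(Real.pi / 6) : ℝ) : ℂ) * Complex.I := by
    push_cast
    ring
  rw [h, Complex.exp_mul_I, ← Complex.ofReal_cos, ← Complex.ofReal_sin, Real.cos_neg,
    Real.sin_neg, Real.cos_pi_div_six, Real.sin_pi_div_six]
  push_cast
  ring

theorem sqrt_three_mul_self : (Real.sqrt 3 : ℂ) * Real.sqrt 3 = 3 := by
  rw [← Complex.ofReal_mul, Real.mul_self_sqrt (by norm_num)]
  norm_num

theorem one_sub_q : 1 - q = Real.sqrt 3 * Complex.exp (-(Real.pi * Complex.I / 6)) := by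
  rw [q_eq, exp_neg_pi_div_six]
  linear_combination (-1 / 2 : ℂ) * sqrt_three_mul_self

theorem one_sub_q_sq : 1 - q ^ 2 = Real.sqrt 3 * Complex.exp (Real.pi * Complex.I / 6) := by
  rw [q_eq, exp_pi_div_six]
  linear_combination (-(1 / 2) - Complex.I ^ 2 / 4 : ℂ) * sqrt_three_mul_self
    - (3 / 4 : ℂ) * Complex.I_sq

theorem q_ne_one : q ≠ 1 := by
  intro h
  have h1 := one_sub_q
  rw [h, sub_self, eq_comm, mul_eq_zero] at h1
  rcases h1 with h1 | h1
  · have h2 := sqrt_three_mul_self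
    rw [h1] at h2
    norm_num at h2
  · exact Complex.exp_ne_zero _ h1

theorem sqrt_three_pow (n : ℕ) :
    (Real.sqrt 3 : ℂ) ^ n = (((3 : ℝ) ^ ((n : ℝ) / 2) : ℝ) : ℂ) := by
  rw [← Complex.ofReal_pow, Real.sqrt_eq_rpow, ← Real.rpow_natCast, ← Real.rpow_mul (by norm_num)]
  congr 2
  ring

/-- Here Γ_k = (q - q²)/(1 - q) = q, and homogeneity of degree bc extracts q^(bc) from the Schur
function. The differences are 1 - q² = √3 e^(iπ/6) and 1 - q = √3 e^(-iπ/6). In units of π/6 the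
phases are ab from the first, -c(a + b) from the second and 4bc from q^(bc), in total ab + 3bc - ca.
-/
theorem value_phi_cubeRoots (a b c : ℕ) :
    value (phi a b c) (fun _ => 1) (fun _ => q ^ 2) (fun _ => q) =
      Complex.exp (Real.pi * Complex.I * (a * b + 3 * b * c - c * a) / 6) *
        (((3 : ℝ) ^ (((a * b + b * c + c * a : ℕ) : ℝ) / 2) : ℝ) : ℂ) *
        schur (rect b c) fun _ : Fin (a + b) => 1 := by
  have hq : (1 : ℂ) - q ≠ 0 := sub_ne_zero.mpr (Ne.symm q_ne_one)
  rw [value_phi_const 1 (q ^ 2) (fun _ => q) (fun _ => q) (fun _ => q_ne_one) fun _ => by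
    rw [eq_div_iff hq]
    ring, schur_const, card_rect, ← sqrt_three_pow, ← mul_assoc]
  congr 1
  rw [Finset.prod_const, Finset.card_univ, Fintype.card_fin, one_sub_q, one_sub_q_sq, q, mul_pow,
    ← pow_mul, mul_pow, ← Complex.exp_nat_mul, ← Complex.exp_nat_mul, ← Complex.exp_nat_mul]
  have hexp : (Real.pi * Complex.I * (a * b + 3 * b * c - c * a) / 6 : ℂ) =
      ((a * b : ℕ) : ℂ) * (Real.pi * Complex.I / 6) +
      ((c * (a + b) : ℕ) : ℂ) * -(Real.pi * Complex.I / 6) +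
      ((b * c : ℕ) : ℂ) * (2 * Real.pi * Complex.I / 3) := by
    push_cast
    ring
  rw [hexp, Complex.exp_add, Complex.exp_add,
    show a * b + b * c + c * a = a * b + c * (a + b) by ring, pow_add]
  ring

end CubeRoots

end ThreeArch
end

/-! ### The theorem -/

theorem mainTheorem5 :
    ∃ Φ : ∀ a b c : ℕ, MvPolynomial (ThreeArch.Param a b c) ℂ,
      -- `Φ` is the unique family with the defining properties
      ThreeArch.IsThreeArchFamily Φ ∧
      (∀ Φ' : ∀ a b c : ℕ, MvPolynomial (ThreeArch.Param a b c) ℂ,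
        ThreeArch.IsThreeArchFamily Φ' → Φ' = Φ) ∧
      ∀ a b c : ℕ,
        -- the explicit formula for pairwise distinct `α_i`
        (∀ (α : Fin (b + c) → ℂ) (β : Fin (a + c) → ℂ) (γ : Fin (a + b) → ℂ),
          Function.Injective α →
            ThreeArch.value (Φ a b c) α β γ = ThreeArch.subsetSum α β γ) ∧
        -- the unitary integral and the Schur function at `α_i = α`, `β_j = β`
        (∀ (α β : ℂ) (γ Γ : Fin (a + b) → ℂ) (C' : ℂ),
          (∀ k, γ k ≠ α) →
          (∀ k, Γ k = (γ k - β) / (α - γ k)) →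
          C' = (α - β) ^ (a * b) * ∏ k, (α - γ k) ^ c →
            ThreeArch.value (Φ a b c) (fun _ => α) (fun _ => β) γ =
              C' * ∫ Ω : ThreeArch.U c,
                Matrix.det (1 + Matrix.diagonal Γ ⊗ₖ (Ω : Matrix (Fin c) (Fin c) ℂ)) *
                  Matrix.det ((Ω⁻¹ : ThreeArch.U c) : Matrix (Fin c) (Fin c) ℂ) ^ b
                ∂(ThreeArch.unitaryHaar c) ∧
            ThreeArch.value (Φ a b c) (fun _ => α) (fun _ => β) γ =
              C' * ThreeArch.schur (ThreeArch.rect b c) Γ) ∧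
        -- the homogeneous case and the dimension of the representation of `GL(a + b)`
        (∃ (V : Type) (_ : AddCommGroup V) (_ : Module ℂ V)
          (ρ : Representation ℂ (GL (Fin (a + b)) ℂ) V),
          ThreeArch.IsIrrepWithDiagram ρ (ThreeArch.rect b c)) ∧
        (∀ (V : Type*) [AddCommGroup V] [Module ℂ V]
          (ρ : Representation ℂ (GL (Fin (a + b)) ℂ) V),
          ThreeArch.IsIrrepWithDiagram ρ (ThreeArch.rect b c) →
            ThreeArch.value (Φ a b c) (fun _ => 1) (fun _ => ThreeArch.q ^ 2)
                (fun _ => ThreeArch.q) =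
              Complex.exp (Real.pi * Complex.I * (a * b + 3 * b * c - c * a) / 6) *
                (((3 : ℝ) ^ (((a * b + b * c + c * a : ℕ) : ℝ) / 2) : ℝ) : ℂ) *
                (Module.finrank ℂ V : ℂ)) := by
  refine ⟨ThreeArch.phi, ThreeArch.isThreeArchFamily_phi,
    fun Φ' h => h.unique ThreeArch.isThreeArchFamily_phi, fun a b c => ⟨?_, ?_, ?_, ?_⟩⟩
  · exact fun α β γ hα => ThreeArch.isThreeArchFamily_phi.value_eq_subsetSum a b c α β γ hα
  · rintro α β γ Γ C' hγ hΓ rfl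
    have h := ThreeArch.value_phi_const (c := c) α β γ Γ hγ hΓ
    exact ⟨by rw [h, ThreeArch.integral_unitary_eq_schur], h⟩
  · exact ThreeArch.exists_isIrrepWithDiagram_rect a b c
  · intro V _ _ ρ hρ
    rw [ThreeArch.value_phi_cubeRoots, hρ.finrank_eq_schur]
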